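/- **Setting.** Let $\mathrm{Im}\,\tau>0$, let $$\vartheta(z)=-\sum_{j\in\mathbb Z}\exp\big(\pi\imath\tau(j+\tfrac12)^2+2\pi\imath(j+\tfrac12)(z+\tfrac12)\big)$$ be the odd Jacobi theta function, and put $\phi(z,u)=\frac{\vartheta'(0)\vartheta(z+u)}{\vartheta(z)\vartheta(u)}$, $f(z,u)=\partial_u\phi(z,u)$, $E_1=\vartheta'/\vartheta$, $E_2=-E_1'$. Let $\nu\in\mathbb C\setminus\{0\}$ and let $q_i,p_i$ ($i=1,\dots,N$) be smooth $2\pi$-periodic complex-valued fields of $x\in\mathbb R$ with the canonical brackets $\{p_i(x),q_j(y)\}=\delta_{ij}\delta(x-y)$, $\{p_i(x),p_j(y)\}=\{q_i(x),q_j(y)\}=0$. Write $q_{ij}=q_i-q_j$ and $\alpha_i^2=\partial_xq_i+\nu$, and assume that for all $x$: $\vartheta(q_{ij}(x))\ne0$ for $i\ne j$ and $\alpha_i^2(x)\neq0$ for all $i$. The spectral parameters $z,w$ satisfy $\vartheta(z),\vartheta(w),\vartheta(z-w)\ne0$. For matrices, $A_1=A\otimes1$, $A_2=1\otimes A$, the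 $E_{ij}$ are the matrix units, and exchanging the indices $1,2$ exchanges the tensor factors. For real $\varepsilon\ne0$ put $u_{ij}(x)=q_i(x-\varepsilon)-q_j(x)-\nu\varepsilon$ and $$U_{ij}(z,x)=\phi(z,u_{ij}(x))\,\frac{\prod_{a}\vartheta(q_j(x)-q_a(x-\varepsilon)+\nu\varepsilon)}{\vartheta(\nu\varepsilon)\prod_{a\ne j}\vartheta(q_j(x)-q_a(x))}\,e^{-\varepsilon p_j(x)},$$ $$\mathbf r_{12}(u|x)=\sum_{i\ne j}\phi(u,q_{ij}(x))E_{ij}\otimes E_{ji}+E_1(u)\sum_iE_{ii}\otimes E_{ii}-\sum_{i\neq j}E_1(q_{ij}(x))E_{ii}\otimes E_{jj},$$ $\mathbf s^+_{12}(z,x)=\mathbf s_{12}(z,x)+\sum_{i,j}E_1(u_{ji}(x))E_{ii}\otimes E_{jj}$ and $\mathbf s^-_{12}(w,x)=\mathbf s_{21}(w,x)+\sum_{i,j}E_1(u_{ij}(x))E_{ii}\otimes E_{jj}$, where $$U_1(z,x)\mathbf s_{12}(z,x)=\sum_{i,j}U_{ij}(z,x)\big(E_1(z+u_{ij}(x))-E_1(u_{ij}(x))\big)E_{ij}\otimes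 E_{ii},$$ $$U_2(w,x)\mathbf s_{21}(w,x)=\sum_{i,j}U_{ij}(w,x)\big(E_1(w+u_{ij}(x))-E_1(u_{ij}(x))\big)E_{ii}\otimes E_{ij}$$ (at zeros of $\vartheta(z+u_{ij})$, resp. $\vartheta(w+u_{ij})$, the coefficients are understood by continuity). Let $$P_i=p_i-\sum_{m\ne i}\alpha_m^2E_1(q_{im})+\frac{\alpha_{i,x}}{\alpha_i},\qquad \frac{\alpha_{i,x}}{\alpha_i}=\frac{\partial_x(\alpha_i^2)}{2\alpha_i^2},$$ $$U^{2dCM}_{ij}(z,x)=\delta_{ij}\Big(P_i+\alpha_i^2E_1(z)-\frac{\alpha_{i,x}}{\alpha_i}\Big)+(1-\delta_{ij})\phi(z,q_{ij})\alpha_j^2,$$ $$\mathbf r^{2dCM}_{12}(z,w|x)=(E_1(z-w)+E_1(w))\sum_iE_{ii}\otimes E_{ii}+\sum_{i\ne j}\phi(z-w,q_{ij})E_{ij}\otimes E_{ji}-\sum_{i\ne j}\phi(-w,q_{ij})E_{ii}\otimes E_{ji}.$$ The Ruijsenaars--Schneider structure is $$\{U_1(z,x),U_2(w,y)\}=-\varepsilon\delta(x-y)\Big(U_1(z,x)U_2(w,x)\mathbf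 r_{12}(z-w|x)-\mathbf r_{12}(z-w|x-\varepsilon)U_1(z,x)U_2(w,x)+U_1(z,x)\mathbf s^+_{12}(z,x)U_2(w,x)-U_2(w,x)\mathbf s^-_{12}(w,x)U_1(z,x)\Big)$$ $$-\varepsilon\delta(x-y+\varepsilon)U_1(z,x)U_2(w,y)\mathbf s_{12}^-(w,y)+\varepsilon\delta(x-y-\varepsilon)U_1(z,x)U_2(w,y)\mathbf s^+_{12}(z,x),\qquad(\mathrm{RS})$$ and the Maillet structure for $U=U^{2dCM}$, $\mathbf r=\mathbf r^{2dCM}$ is $$\{U_1(z,x),U_2(w,y)\}=\Big(-\partial_x\mathbf r_{12}(z,w|x)+[U_1(z,x),\mathbf r_{12}(z,w|x)]-[U_2(w,y),\mathbf r_{21}(w,z|x)]\Big)\delta(x-y)-\Big(\mathbf r_{12}(z,w|x)+\mathbf r_{21}(w,z|x)\Big)\delta'(x-y).\qquad(\mathrm M)$$ Brackets are understood as distributions on the circle, that is, as the canonical brackets of the functionals obtained by integrating against smooth $2\pi$-periodic test functions of $x$ and of $y$. **Theorem.** In the limit $\varepsilon\to0$ the structure (RS) reduces to the Maillet structure (M):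 1. $U_{ij}(z,x)=-\frac{\delta_{ij}}{\nu\varepsilon}+\frac1\nu U^{2dCM}_{ij}(z,x)+O(\varepsilon)$ uniformly in $x$, and the fields $(P_i,q_j)$ are canonical: $\{P_i(x),q_j(y)\}=\delta_{ij}\delta(x-y)$, $\{P_i(x),P_j(y)\}=0$. 2. (RS) holds for all sufficiently small $\varepsilon\neq0$. As $\varepsilon\to0$ its left-hand side tends to $\frac1{\nu^2}\{U^{2dCM}_1(z,x),U_2^{2dCM}(w,y)\}$ (the bracket being canonical in $P,q$), its right-hand side tends, as a distribution in $(x,y)$, to $\frac1{\nu^2}$ times the right-hand side of (M), and so (M) holds for $U^{2dCM}$ with the $r$-matrix $\mathbf r^{2dCM}$. 3. ($\delta'$-part) For every $x$, $$\lim_{\varepsilon\to0}\varepsilon^2\Big(U_1(z,x)U_2(w,x)\mathbf s_{12}^-(w,x)+U_1(z,x)U_2(w,x)\mathbf s_{12}^+(z,x)\Big)=\frac1{\nu^2}\Big(\mathbf r^{2dCM}_{12}(z,w|x)+\mathbf r_{21}^{2dCM}(w,z|x)\Big).$$ 4. ($\delta$-part) For every $x$ the following limit exists, and $$0=-\partial_x\mathbf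 r^{2dCM}_{12}(z,w|x)+[U_1^{2dCM}(z,x),\mathbf r^{2dCM}_{12}(z,w|x)]-[U_2^{2dCM}(w,x),\mathbf r_{21}^{2dCM}(w,z|x)]$$ $$+\sum_{i\ne j}(\alpha_j^2-\alpha_i^2)\Big(f(w,q_{ji})E_{ii}\otimes E_{ji}+E_2(q_{ji})E_{ii}\otimes E_{jj}\Big)$$ $$+\nu^2\lim_{\varepsilon\to0}\varepsilon\Big(U_1(z,x)U_2(w,x)\mathbf r_{12}(z-w|x)-\mathbf r_{12}(z-w|x-\varepsilon)U_1(z,x)U_2(w,x)+[U_1(z,x)\mathbf s^+_{12}(z,x),U_2(w,x)]-[U_2(w,x)\mathbf s_{12}^-(w,x),U_1(z,x)]\Big).$$ -/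

import Mathlib

open Complex Filter Topology Asymptotics
open scoped ContDiff Kronecker Matrix

noncomputable section

namespace EllipticField

/-! ### Elliptic functions -/

/-- The odd Jacobi theta function with moduli `τ`, that is minus the theta function with
characteristics `1/2, 1/2`. -/
def theta (τ z : ℂ) : ℂ :=
  -∑' j : ℤ, cexp (2 * Real.pi * I * ((j : ℂ) + 1 / 2) ^ 2 * (τ / 2)
    + 2 * Real.pi * I * ((j : ℂ) + 1 / 2) * (z + 1 / 2))

/-- The elliptic Kronecker function `φ(z,u) = ϑ'(0) ϑ(z+u) / (ϑ(z) ϑ(u))`. -/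
def kronecker (τ z u : ℂ) : ℂ :=
  deriv (theta τ) 0 * theta τ (z + u) / (theta τ z * theta τ u)

/-- The derivative `f(z,u) = ∂_u φ(z,u)`. -/
def kroneckerD (τ z u : ℂ) : ℂ := deriv (fun v => kronecker τ z v) u

/-- The first Eisenstein function `E₁ = ϑ'/ϑ`. -/
def E1 (τ u : ℂ) : ℂ := deriv (theta τ) u / theta τ u

/-- The second Eisenstein function `E₂ = -E₁'`. -/
def E2 (τ u : ℂ) : ℂ := -deriv (E1 τ) u

lemma theta_eq_jacobiTheta₂ (τ z : ℂ) :
    theta τ z = -(cexp (Real.pi * I * (τ / 4 + z + 1 / 2)) *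
      jacobiTheta₂ (z + 1 / 2 + τ / 2) τ) := by
  unfold theta jacobiTheta₂
  rw [← tsum_mul_left]
  congr 1
  refine tsum_congr fun j => ?_
  rw [jacobiTheta₂_term, ← Complex.exp_add]
  congr 1
  ring

lemma differentiable_theta {τ : ℂ} (hτ : 0 < τ.im) : Differentiable ℂ (theta τ) := by
  have h : theta τ = fun z => -(cexp (Real.pi * I * (τ / 4 + z + 1 / 2)) *
      jacobiTheta₂ (z + 1 / 2 + τ / 2) τ) := funext fun z => theta_eq_jacobiTheta₂ τ z
  rw [h]
  intro z
  have h1 : DifferentiableAt ℂ (fun z : ℂ => jacobiTheta₂ (z + 1 / 2 + τ / 2) τ) z :=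
    (differentiableAt_jacobiTheta₂_fst (z + 1 / 2 + τ / 2) hτ).comp
      (f := fun z : ℂ => z + 1 / 2 + τ / 2) z (by fun_prop)
  exact ((by fun_prop : DifferentiableAt ℂ
    (fun z : ℂ => cexp (Real.pi * I * (τ / 4 + z + 1 / 2))) z).mul h1).neg

/-- Away from the zeros of the theta functions, `∂_u φ(z,u) = φ(z,u) (E₁(z+u) - E₁(u))`. -/
lemma kroneckerD_eq {τ : ℂ} (hτ : 0 < τ.im) {z u : ℂ}
    (hu : theta τ u ≠ 0) (hzu : theta τ (z + u) ≠ 0) (hz : theta τ z ≠ 0) :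
    kroneckerD τ z u = kronecker τ z u * (E1 τ (z + u) - E1 τ u) := by
  have h1 : HasDerivAt (fun v => theta τ (z + v)) (deriv (theta τ) (z + u)) u := by
    have := (differentiable_theta hτ (z + u)).hasDerivAt
    exact this.comp_const_add z u
  have h2 : HasDerivAt (theta τ) (deriv (theta τ) u) u := (differentiable_theta hτ u).hasDerivAt
  have h3 := (h1.const_mul (deriv (theta τ) 0)).div (h2.const_mul (theta τ z))
    (mul_ne_zero hz hu)
  have h4 : kroneckerD τ z u = _ := h3.deriv
  rw [h4]
  unfold kronecker E1
  field_simp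

/-! ### Fields on the circle, functionals and the canonical Poisson bracket -/

/-- Smooth `2π`-periodic complex valued functions of a real variable. -/
def IsLoop (h : ℝ → ℂ) : Prop := ContDiff ℝ ∞ h ∧ Function.Periodic h (2 * Real.pi)

/-- Smooth test functions of two variables, `2π`-periodic in each of them. -/
def IsTest₂ (ψ : ℝ → ℝ → ℂ) : Prop :=
  ContDiff ℝ ∞ (fun s : ℝ × ℝ => ψ s.1 s.2) ∧
    (∀ x y, ψ (x + 2 * Real.pi) y = ψ x y) ∧ ∀ x y, ψ x (y + 2 * Real.pi) = ψ x y

variable {N : ℕ}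

/-- `gq a = δF/δq_a` and `gp a = δF/δp_a` at the point `(q, p)` of the phase space of `N` pairs of
fields on the circle. -/
def HasFunctionalDeriv (F : (Fin N → ℝ → ℂ) → (Fin N → ℝ → ℂ) → ℂ)
    (q p gq gp : Fin N → ℝ → ℂ) : Prop :=
  (∀ a, IsLoop (gq a)) ∧ (∀ a, IsLoop (gp a)) ∧
    ∀ h k : Fin N → ℝ → ℂ, (∀ a, IsLoop (h a)) → (∀ a, IsLoop (k a)) →
      HasDerivAt (fun t : ℂ => F (fun a x => q a x + t * h a x) (fun a x => p a x + t * k a x))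
        (∑ a, ∫ x in (0 : ℝ)..(2 * Real.pi), (gq a x * h a x + gp a x * k a x)) 0

/-- The canonical bracket `{p_i(x), q_j(y)} = δ_ij δ(x-y)`, `{p_i(x), p_j(y)} = {q_i(x), q_j(y)} = 0`
of the functionals `F` and `G` exists at the point `(q, p)` and has the value `B` there. -/
def HasPoissonBracket (F G : (Fin N → ℝ → ℂ) → (Fin N → ℝ → ℂ) → ℂ)
    (q p : Fin N → ℝ → ℂ) (B : ℂ) : Prop :=
  ∃ Fq Fp Gq Gp : Fin N → ℝ → ℂ,
    HasFunctionalDeriv F q p Fq Fp ∧ HasFunctionalDeriv G q p Gq Gp ∧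
    B = ∑ a, ∫ x in (0 : ℝ)..(2 * Real.pi), (Fp a x * Gq a x - Fq a x * Gp a x)

/-- The functional `∫ φ(x) A(x) dx`, where `A` is a function on the circle built from the fields. -/
def smear (φ : ℝ → ℂ) (A : (Fin N → ℝ → ℂ) → (Fin N → ℝ → ℂ) → ℝ → ℂ) :
    (Fin N → ℝ → ℂ) → (Fin N → ℝ → ℂ) → ℂ :=
  fun q p => ∫ x in (0 : ℝ)..(2 * Real.pi), φ x * A q p x

/-! ### Tensor notation and matrix valued distributions on the torus -/

/-- `Mat(N, ℂ) ⊗ Mat(N, ℂ)`; the coefficient of `E_ij ⊗ E_kl` is the entry at `(i, k), (j, l)`. -/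
abbrev Mat₂ (N : ℕ) := Matrix (Fin N × Fin N) (Fin N × Fin N) ℂ

/-- `E_ij ⊗ E_kl`. -/
def EE (i j k l : Fin N) : Mat₂ N := Matrix.single i j (1 : ℂ) ⊗ₖ Matrix.single k l (1 : ℂ)

/-- `A₁ = A ⊗ 1`. -/
def in₁ (A : Matrix (Fin N) (Fin N) ℂ) : Mat₂ N := A ⊗ₖ (1 : Matrix (Fin N) (Fin N) ℂ)

/-- `A₂ = 1 ⊗ A`. -/
def in₂ (A : Matrix (Fin N) (Fin N) ℂ) : Mat₂ N := (1 : Matrix (Fin N) (Fin N) ℂ) ⊗ₖ A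

/-- Interchange of the tensor components. -/
def flip₁₂ (M : Mat₂ N) : Mat₂ N := M.submatrix Prod.swap Prod.swap

/-- The commutator of two matrices. -/
def comm (A B : Mat₂ N) : Mat₂ N := A * B - B * A

/-- Entrywise derivative of a matrix valued function of `x`. -/
def dx (R : ℝ → Mat₂ N) (x : ℝ) : Mat₂ N := Matrix.of fun a b => deriv (fun s => R s a b) x

/-- The value of the distribution `δ(x - y + c) K(x, y)` on the test function `ψ`. -/
def pairDelta (c : ℝ) (K : ℝ → ℝ → Mat₂ N) (ψ : ℝ → ℝ → ℂ) : Mat₂ N :=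
  Matrix.of fun a b => ∫ x in (0 : ℝ)..(2 * Real.pi), ψ x (x + c) * K x (x + c) a b

/-- The value of the distribution `δ'(x - y) K(x, y)`, where `δ'(x - y) = ∂_x δ(x - y)`, on the
test function `ψ`. -/
def pairDelta' (K : ℝ → ℝ → Mat₂ N) (ψ : ℝ → ℝ → ℂ) : Mat₂ N :=
  Matrix.of fun a b =>
    -∫ y in (0 : ℝ)..(2 * Real.pi), deriv (fun x => ψ x y * K x y a b) y

/-! ### The 1+1 Ruijsenaars-Schneider field theory -/

/-- The argument `q_i(x - ε) - q_j(x) - ν ε`. -/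
def shiftArg (ν : ℂ) (ε : ℝ) (q : Fin N → ℝ → ℂ) (x : ℝ) (i j : Fin N) : ℂ :=
  q i (x - ε) - q j x - ν * ε

/-- The factor of the `U`-matrix that depends on the second index only. -/
def factorRS (τ ν : ℂ) (ε : ℝ) (q p : Fin N → ℝ → ℂ) (x : ℝ) (j : Fin N) : ℂ :=
  (∏ a, theta τ (q j x - q a (x - ε) + ν * ε)) /
    (theta τ (ν * ε) * ∏ a ∈ Finset.univ.erase j, theta τ (q j x - q a x)) *
    cexp (-ε * p j x)

/-- The `U`-matrix of the Ruijsenaars-Schneider field theory. -/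
def URS (τ ν : ℂ) (ε : ℝ) (q p : Fin N → ℝ → ℂ) (z : ℂ) (x : ℝ) : Matrix (Fin N) (Fin N) ℂ :=
  Matrix.of fun i j => kronecker τ z (shiftArg ν ε q x i j) * factorRS τ ν ε q p x j

/-- The matrix with the entries `U_ij(z,x) (E₁(z + u_ij) - E₁(u_ij))`,
`u_ij = q_i(x - ε) - q_j(x) - ν ε`; written through `∂_u φ`, it is also defined at the removable
singularities `ϑ(z + u_ij) = 0`. -/
def dURS (τ ν : ℂ) (ε : ℝ) (q p : Fin N → ℝ → ℂ) (z : ℂ) (x : ℝ) : Matrix (Fin N) (Fin N) ℂ :=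
  Matrix.of fun i j => kroneckerD τ z (shiftArg ν ε q x i j) * factorRS τ ν ε q p x j

lemma dURS_apply_eq {τ : ℂ} (hτ : 0 < τ.im) (ν : ℂ) (ε : ℝ) (q p : Fin N → ℝ → ℂ) {z : ℂ} (x : ℝ)
    (i j : Fin N) (hz : theta τ z ≠ 0) (hu : theta τ (shiftArg ν ε q x i j) ≠ 0)
    (hzu : theta τ (z + shiftArg ν ε q x i j) ≠ 0) :
    dURS τ ν ε q p z x i j = URS τ ν ε q p z x i j *
      (E1 τ (z + shiftArg ν ε q x i j) - E1 τ (shiftArg ν ε q x i j)) := by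
  simp only [dURS, URS, Matrix.of_apply, kroneckerD_eq hτ hu hzu hz]
  ring

/-- `𝐫₁₂(u|x)`. -/
def rRS (τ : ℂ) (q : Fin N → ℝ → ℂ) (u : ℂ) (x : ℝ) : Mat₂ N :=
  (∑ i, ∑ j ∈ Finset.univ.erase i, kronecker τ u (q i x - q j x) • EE i j j i)
    + E1 τ u • (∑ i, EE i i i i)
    - ∑ i, ∑ j ∈ Finset.univ.erase i, E1 τ (q i x - q j x) • EE i i j j

/-- `𝐬₁₂(z,x)`, the solution of `U₁(z,x) 𝐬₁₂(z,x) = ∑ (dU)_ij(z,x) E_ij ⊗ E_ii`. -/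
def s12 (τ ν : ℂ) (ε : ℝ) (q p : Fin N → ℝ → ℂ) (z : ℂ) (x : ℝ) : Mat₂ N :=
  in₁ (URS τ ν ε q p z x)⁻¹ * ∑ i, ∑ j, dURS τ ν ε q p z x i j • EE i j i i

/-- `𝐬₂₁(w,x)`, the solution of `U₂(w,x) 𝐬₂₁(w,x) = ∑ (dU)_ij(w,x) E_ii ⊗ E_ij`. -/
def s21 (τ ν : ℂ) (ε : ℝ) (q p : Fin N → ℝ → ℂ) (w : ℂ) (x : ℝ) : Mat₂ N :=
  in₂ (URS τ ν ε q p w x)⁻¹ * ∑ i, ∑ j, dURS τ ν ε q p w x i j • EE i i i j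

/-- `𝐮₁₂⁺(x)`. -/
def uPlus (τ ν : ℂ) (ε : ℝ) (q : Fin N → ℝ → ℂ) (x : ℝ) : Mat₂ N :=
  ∑ i, ∑ j, E1 τ (shiftArg ν ε q x j i) • EE i i j j

/-- `𝐮₁₂⁻(x)`. -/
def uMinus (τ ν : ℂ) (ε : ℝ) (q : Fin N → ℝ → ℂ) (x : ℝ) : Mat₂ N :=
  ∑ i, ∑ j, E1 τ (shiftArg ν ε q x i j) • EE i i j j

/-- `𝐬₁₂⁺(z,x)`. -/
def sPlus (τ ν : ℂ) (ε : ℝ) (q p : Fin N → ℝ → ℂ) (z : ℂ) (x : ℝ) : Mat₂ N :=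
  s12 τ ν ε q p z x + uPlus τ ν ε q x

/-- `𝐬₁₂⁻(w,x)`. -/
def sMinus (τ ν : ℂ) (ε : ℝ) (q p : Fin N → ℝ → ℂ) (w : ℂ) (x : ℝ) : Mat₂ N :=
  s21 τ ν ε q p w x + uMinus τ ν ε q x

/-- The right-hand side of the Ruijsenaars-Schneider `r`-matrix structure
`{U₁(z,x), U₂(w,y)} = ...`, evaluated on the test function `ψ(x, y)`. -/
def rhsRS (τ ν : ℂ) (ε : ℝ) (q p : Fin N → ℝ → ℂ) (z w : ℂ) (ψ : ℝ → ℝ → ℂ) : Mat₂ N :=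
  let U₁ : ℝ → Mat₂ N := fun x => in₁ (URS τ ν ε q p z x);
  let U₂ : ℝ → Mat₂ N := fun x => in₂ (URS τ ν ε q p w x);
  (-ε : ℂ) • pairDelta 0 (fun x _ =>
        U₁ x * U₂ x * rRS τ q (z - w) x - rRS τ q (z - w) (x - ε) * U₁ x * U₂ x
          + U₁ x * sPlus τ ν ε q p z x * U₂ x - U₂ x * sMinus τ ν ε q p w x * U₁ x) ψ
    + (-ε : ℂ) • pairDelta ε (fun x y => U₁ x * U₂ y * sMinus τ ν ε q p w y) ψ
    + (ε : ℂ) • pairDelta (-ε) (fun x y => U₁ x * U₂ y * sPlus τ ν ε q p z x) ψ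

/-- The coefficient of `-ε δ(x - y)` that is left when `δ(x - y ± ε)` are expanded:
`U₁U₂𝐫₁₂ - 𝐫₁₂(x - ε)U₁U₂ + [U₁𝐬₁₂⁺, U₂] - [U₂𝐬₁₂⁻, U₁]`. -/
def localRS (τ ν : ℂ) (ε : ℝ) (q p : Fin N → ℝ → ℂ) (z w : ℂ) (x : ℝ) : Mat₂ N :=
  let U₁ := in₁ (URS τ ν ε q p z x)
  let U₂ := in₂ (URS τ ν ε q p w x)
  U₁ * U₂ * rRS τ q (z - w) x - rRS τ q (z - w) (x - ε) * U₁ * U₂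
    + comm (U₁ * sPlus τ ν ε q p z x) U₂ - comm (U₂ * sMinus τ ν ε q p w x) U₁

/-! ### The 1+1 Calogero-Moser field theory and the Maillet structure -/

/-- `α_j² = q_{j,x} + ν`. -/
def alphaSq (ν : ℂ) (q : Fin N → ℝ → ℂ) (j : Fin N) (x : ℝ) : ℂ := deriv (q j) x + ν

/-- `α_{j,x} / α_j = (α_j²)_x / (2 α_j²)`, the same for each choice of the square root. -/
def alphaLogD (ν : ℂ) (q : Fin N → ℝ → ℂ) (j : Fin N) (x : ℝ) : ℂ :=
  deriv (alphaSq ν q j) x / (2 * alphaSq ν q j x)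

/-- The `U`-matrix of the Calogero-Moser field theory. -/
def UCM (τ ν : ℂ) (q p : Fin N → ℝ → ℂ) (z : ℂ) (x : ℝ) : Matrix (Fin N) (Fin N) ℂ :=
  Matrix.of fun i j =>
    if i = j then p i x + alphaSq ν q i x * E1 τ z - alphaLogD ν q i x
    else kronecker τ z (q i x - q j x) * alphaSq ν q j x

/-- The momenta of the Calogero-Moser field theory in terms of the fields of the
Ruijsenaars-Schneider one: `p_i - ∑_{m ≠ i} α_m² E₁(q_i - q_m) + α_{i,x} / α_i`. -/
def momentumCM (τ ν : ℂ) (q p : Fin N → ℝ → ℂ) (i : Fin N) (x : ℝ) : ℂ :=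
  p i x - (∑ m ∈ Finset.univ.erase i, alphaSq ν q m x * E1 τ (q i x - q m x)) + alphaLogD ν q i x

/-- `𝐫₁₂(z,w|x)` of the Calogero-Moser field theory. -/
def rCM (τ : ℂ) (q : Fin N → ℝ → ℂ) (z w : ℂ) (x : ℝ) : Mat₂ N :=
  (E1 τ (z - w) + E1 τ w) • (∑ i, EE i i i i)
    + (∑ i, ∑ j ∈ Finset.univ.erase i, kronecker τ (z - w) (q i x - q j x) • EE i j j i)
    - ∑ i, ∑ j ∈ Finset.univ.erase i, kronecker τ (-w) (q i x - q j x) • EE i i j i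

/-- The coefficient `-∂_x 𝐫₁₂(z,w|x) + [U₁(z,x), 𝐫₁₂(z,w|x)] - [U₂(w,y), 𝐫₂₁(w,z|x)]`
of `δ(x - y)` in the Maillet structure. -/
def localMaillet (U : ℂ → ℝ → Matrix (Fin N) (Fin N) ℂ) (r : ℂ → ℂ → ℝ → Mat₂ N)
    (z w : ℂ) (x y : ℝ) : Mat₂ N :=
  -dx (r z w) x + comm (in₁ (U z x)) (r z w x) - comm (in₂ (U w y)) (flip₁₂ (r w z x))

/-- The right-hand side of the Maillet `r`-matrix structure `{U₁(z,x), U₂(w,y)} = ...` with the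
`r`-matrix `r`, evaluated on the test function `ψ(x, y)`. -/
def rhsMaillet (U : ℂ → ℝ → Matrix (Fin N) (Fin N) ℂ) (r : ℂ → ℂ → ℝ → Mat₂ N)
    (z w : ℂ) (ψ : ℝ → ℝ → ℂ) : Mat₂ N :=
  pairDelta 0 (localMaillet U r z w) ψ
    - pairDelta' (fun x _ => r z w x + flip₁₂ (r w z x)) ψ

end EllipticField

end

open EllipticField

/-!
All identities between elliptic functions used here come from one source. Multiplying the series of
`ϑ(x + y)` and `ϑ(x - y)` and sorting the pairs of indices by parity gives a `2 × 2` determinant in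
theta functions of modulus `2τ` (`theta_add_mul_theta_sub`). Hence the three-term relation
(`theta_three_term`) and, by differentiation and specialisation, the Fay identity and its
degenerations for the Kronecker function.

The entry `U_kl(z, x)` of the Ruijsenaars-Schneider matrix depends on the fields `q_a(x)`,
`q_a(x - ε)` and `p_l(x)` only, and on `p_l` through `exp(-ε p_l)`. Denote the partial derivatives
in `q_a(x - ε)` and `q_a(x)` by `partialShifted` and `partialLocal`. The canonical bracket of two
entries is then `-ε` times a combination of products of one entry of `U` with one partial derivative
of another, at coinciding points or at points shifted by `ε`. The matrices `s⁺`, `s⁻` encode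
`partialShifted` (`mul_sPlus_apply`, `mul_sMinus_apply`). That the coefficient of `δ(x - y)` is the
combination of `partialLocal` is the exchange relation `exchange_apply`, which the elliptic
identities prove entry by entry; this gives `hasPoissonBracket_URS`.

For the limit, `UnifLim` is a calculus of limits `ε → 0` that are uniform in `x` with an error
`O(ε)`. Since `q_i(x - ε) - q_i(x) - νε = -ε α_i² + O(ε²)`, the pole of the Kronecker function at
the origin yields the expansion of `U` (`unifLim_URS`), the limits of `ε` times `partialShifted`
(`limitShifted`) and the limits of the sum of both partial derivatives (`limitTotal`), in which the
poles cancel. The symmetric part of the Calogero-Moser r-matrix has the entries `limitShifted`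
(`rCM_add_flip_apply`), and the local term of the Maillet structure is given by `limitTotal` up to a
term that is itself a derivative of `limitShifted` (`localMaillet_apply`,
`hasDerivAt_limitShifted`); here the Fay identity enters once more.

Tested against `ψ(x, y)`, the Ruijsenaars-Schneider structure is the integral of a density on the
diagonal, in which the leading term `-1/(νε)` of `U` turns a difference of shifted terms into a
derivative of `ψ`. Its limit (`unifLim_densityRS`) is what an integration by parts makes of the
Maillet structure (`rhsMaillet_apply`). The bracket of the Calogero-Moser matrices and the canonical
brackets of the momenta are computed directly from their functional derivatives: the integrand of
the difference of both sides is the derivative of a periodic function.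
-/

noncomputable section

namespace EllipticField

/-! ### Addition theorems of the theta function -/

section Theta

variable {τ : ℂ}

/-- The pairs of integers, split by the parity of the sum of their components: `(m, n)` is
`(c + d, c - d - 1)` or `(c + d, c - d)`. -/
def parityEquiv : (ℤ × ℤ) ⊕ (ℤ × ℤ) ≃ ℤ × ℤ :=
  Equiv.ofBijective
    (Sum.elim (fun s => (s.1 + s.2, s.1 - s.2 - 1)) (fun s => (s.1 + s.2, s.1 - s.2))) (by
      constructor
      · rintro (⟨c, d⟩ | ⟨c, d⟩) (⟨c', d'⟩ | ⟨c', d'⟩) h <;>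
          simp only [Sum.elim_inl, Sum.elim_inr, Prod.mk.injEq] at h <;>
          simp only [Sum.inl.injEq, Sum.inr.injEq, Prod.mk.injEq, reduceCtorEq] <;> omega
      · rintro ⟨m, n⟩
        rcases Int.even_or_odd' (m + n) with ⟨c, hc | hc⟩
        · exact ⟨Sum.inr (c, m - c), Prod.ext (by simp) (by simp; omega)⟩
        · exact ⟨Sum.inl (c + 1, m - c - 1), Prod.ext (by simp) (by simp; omega)⟩)

lemma parityEquiv_inl (c d : ℤ) : parityEquiv (Sum.inl (c, d)) = (c + d, c - d - 1) := rfl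

lemma parityEquiv_inr (c d : ℤ) : parityEquiv (Sum.inr (c, d)) = (c + d, c - d) := rfl

/-- The theta series of modulus `2τ` over the integers: the even Fourier part. -/
def thetaEven (τ x : ℂ) : ℂ := jacobiTheta₂ (2 * x) (2 * τ)

/-- The theta series of modulus `2τ` over the half-integers: the odd Fourier part. -/
def thetaOdd (τ x : ℂ) : ℂ :=
  cexp (2 * Real.pi * I * x + Real.pi * I * τ / 2) * jacobiTheta₂ (2 * x + τ) (2 * τ)

/-- Multiplying the two series of `ϑ(x+y)` and `ϑ(x-y)` and summing over pairs of indices of equal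
and of opposite parity separately yields a `2 × 2` determinant, so that the three-term relation
below is a Plücker relation. -/
lemma theta_add_mul_theta_sub (hτ : 0 < τ.im) (x y : ℂ) :
    theta τ (x + y) * theta τ (x - y) =
      thetaEven τ x * thetaOdd τ y - thetaOdd τ x * thetaEven τ y := by
  have h2τ : 0 < (2 * τ).im := by simpa using hτ
  have hs : ∀ u {σ : ℂ}, 0 < σ.im → Summable (fun n => ‖jacobiTheta₂_term n u σ‖) := fun u σ h =>
    ((summable_jacobiTheta₂_term_iff u σ).2 h).norm
  have key : ∀ u v : ℂ, ∀ {σ : ℂ}, 0 < σ.im → HasSum (fun s : ℤ × ℤ =>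
      jacobiTheta₂_term s.1 u σ * jacobiTheta₂_term s.2 v σ)
      (jacobiTheta₂ u σ * jacobiTheta₂ v σ) := fun u v σ h => by
    have h1 := (summable_mul_of_summable_norm (hs u h) (hs v h)).hasSum
    rwa [← tsum_mul_tsum_of_summable_norm (hs u h) (hs v h)] at h1
  rw [theta_eq_jacobiTheta₂, theta_eq_jacobiTheta₂]
  have hL := (parityEquiv.hasSum_iff.2
    (key (x + y + 1 / 2 + τ / 2) (x - y + 1 / 2 + τ / 2) hτ)).mul_left
      (cexp (Real.pi * I * (τ / 4 + (x + y) + 1 / 2)) *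
        cexp (Real.pi * I * (τ / 4 + (x - y) + 1 / 2)))
  have hA := ((key (2 * x) (2 * y + τ) h2τ).mul_left
    (cexp (2 * Real.pi * I * y + Real.pi * I * τ / 2)))
  have hB := ((key (2 * x + τ) (2 * y) h2τ).mul_left
    (-cexp (2 * Real.pi * I * x + Real.pi * I * τ / 2)))
  have hR : HasSum (Sum.elim
      (fun s : ℤ × ℤ => cexp (2 * Real.pi * I * y + Real.pi * I * τ / 2) *
        (jacobiTheta₂_term s.1 (2 * x) (2 * τ) * jacobiTheta₂_term s.2 (2 * y + τ) (2 * τ)))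
      (fun s : ℤ × ℤ => -cexp (2 * Real.pi * I * x + Real.pi * I * τ / 2) *
        (jacobiTheta₂_term s.1 (2 * x + τ) (2 * τ) * jacobiTheta₂_term s.2 (2 * y) (2 * τ)))) _ :=
    HasSum.sum (by simpa [Function.comp_def] using hA) (by simpa [Function.comp_def] using hB)
  have hshift : ∀ (n : ℤ) (a b : ℂ), b = a + n * (2 * Real.pi * I) → cexp b = cexp a := by
    rintro n a b rfl
    exact Complex.exp_periodic.int_mul n a
  have heq := hL.unique (hR.congr_fun ?_)
  · unfold thetaEven thetaOdd
    linear_combination heq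
  · rintro (⟨c, d⟩ | ⟨c, d⟩)
    · simp only [parityEquiv_inl, Function.comp_def, Sum.elim_inl,
        jacobiTheta₂_term, ← Complex.exp_add]
      refine hshift c _ _ ?_
      push_cast
      ring
    · simp only [parityEquiv_inr, Function.comp_def, Sum.elim_inr,
        jacobiTheta₂_term, ← Complex.exp_add, neg_mul]
      rw [← neg_one_mul (cexp _), ← Complex.exp_pi_mul_I, ← Complex.exp_add]
      refine hshift c _ _ ?_
      push_cast
      ring

/-- The Weierstrass three-term relation. -/
lemma theta_three_term (hτ : 0 < τ.im) (x y u v : ℂ) :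
    theta τ (x + y) * theta τ (x - y) * (theta τ (u + v) * theta τ (u - v)) +
      theta τ (y + u) * theta τ (y - u) * (theta τ (x + v) * theta τ (x - v)) +
      theta τ (u + x) * theta τ (u - x) * (theta τ (y + v) * theta τ (y - v)) = 0 := by
  simp only [theta_add_mul_theta_sub hτ]
  ring

lemma theta_neg (hτ : 0 < τ.im) (v : ℂ) : theta τ (-v) = -theta τ v := by
  by_cases h : ∃ s, theta τ s ≠ 0
  · obtain ⟨s, hs⟩ := h
    have h1 := theta_add_mul_theta_sub hτ ((s + v) / 2) ((s - v) / 2)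
    have h2 := theta_add_mul_theta_sub hτ ((s - v) / 2) ((s + v) / 2)
    rw [show (s + v) / 2 + (s - v) / 2 = s by ring,
      show (s + v) / 2 - (s - v) / 2 = v by ring] at h1
    rw [show (s - v) / 2 + (s + v) / 2 = s by ring,
      show (s - v) / 2 - (s + v) / 2 = -v by ring] at h2
    exact mul_left_cancel₀ hs (by linear_combination h1 + h2)
  · push Not at h
    simp [h]

lemma theta_zero (hτ : 0 < τ.im) : theta τ 0 = 0 := by
  have := theta_neg hτ 0
  rw [neg_zero] at this
  linear_combination this / 2

lemma theta_sub_comm (hτ : 0 < τ.im) (a b : ℂ) : theta τ (a - b) = -theta τ (b - a) := by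
  rw [← neg_sub, theta_neg hτ]

lemma hasDerivAt_theta (hτ : 0 < τ.im) (u : ℂ) :
    HasDerivAt (theta τ) (deriv (theta τ) u) u := (differentiable_theta hτ u).hasDerivAt

lemma deriv_theta_neg (hτ : 0 < τ.im) (v : ℂ) :
    deriv (theta τ) (-v) = deriv (theta τ) v := by
  have h1 : HasDerivAt (fun s => -theta τ (-s)) (-(deriv (theta τ) (-v) * -1)) v :=
    ((hasDerivAt_theta hτ (-v)).comp v (hasDerivAt_neg v)).neg
  have h2 : (fun s => -theta τ (-s)) = theta τ := funext fun s => by rw [theta_neg hτ, neg_neg]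
  rw [h2] at h1
  have := h1.unique (hasDerivAt_theta hτ v)
  linear_combination this

lemma analyticAt_theta (hτ : 0 < τ.im) (u : ℂ) : AnalyticAt ℂ (theta τ) u :=
  (differentiable_theta hτ).analyticAt u

lemma differentiable_thetaEven (hτ : 0 < τ.im) : Differentiable ℂ (thetaEven τ) := fun x =>
  (differentiableAt_jacobiTheta₂_fst (2 * x) (by simpa using hτ)).comp
    (f := fun x : ℂ => 2 * x) x (by fun_prop)

lemma differentiable_thetaOdd (hτ : 0 < τ.im) : Differentiable ℂ (thetaOdd τ) := fun x => by
  have h1 : DifferentiableAt ℂ (fun x : ℂ => jacobiTheta₂ (2 * x + τ) (2 * τ)) x :=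
    (differentiableAt_jacobiTheta₂_fst (2 * x + τ) (by simpa using hτ)).comp
      (f := fun x : ℂ => 2 * x + τ) x (by fun_prop)
  exact (by fun_prop : DifferentiableAt ℂ
    (fun x : ℂ => cexp (2 * Real.pi * I * x + Real.pi * I * τ / 2)) x).mul h1

/-- If `ϑ'(0)` vanished, so would the Wronskian of the even and the odd Fourier part; these would
be proportional, and `ϑ` would vanish identically. -/
lemma deriv_theta_zero_ne_zero (hτ : 0 < τ.im) {z : ℂ} (hz : theta τ z ≠ 0) :
    deriv (theta τ) 0 ≠ 0 := by
  intro h0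
  set A := thetaEven τ
  set B := thetaOdd τ
  have hA := differentiable_thetaEven hτ
  have hB := differentiable_thetaOdd hτ
  have hW : ∀ x, A x * deriv B x - B x * deriv A x = 0 := fun x => by
    have h1 : HasDerivAt (fun y => A x * B y - B x * A y) (A x * deriv B x - B x * deriv A x) x :=
      ((hB x).hasDerivAt.const_mul _).sub ((hA x).hasDerivAt.const_mul _)
    have h2 : HasDerivAt (fun y => theta τ (x + y) * theta τ (x - y))
        (deriv (theta τ) (x + x) * theta τ (x - x) +
          theta τ (x + x) * -deriv (theta τ) (x - x)) x :=
      ((hasDerivAt_theta hτ (x + x)).comp_const_add x x).mul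
        ((hasDerivAt_theta hτ (x - x)).comp_const_sub x x)
    have h3 : (fun y => theta τ (x + y) * theta τ (x - y)) = fun y => A x * B y - B x * A y :=
      funext fun y => theta_add_mul_theta_sub hτ x y
    rw [h3] at h2
    rw [h1.unique h2, sub_self, h0, theta_zero hτ]
    ring
  obtain ⟨a, ha⟩ : ∃ a, A a ≠ 0 := by
    by_contra! h
    have h1 := theta_add_mul_theta_sub hτ z 0
    simp only [A] at h
    rw [h, h, add_zero, sub_zero] at h1
    exact hz (by simpa using h1)
  have hev : ∀ᶠ x in 𝓝 a, A x ≠ 0 := hA.continuous.continuousAt.eventually_ne ha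
  obtain ⟨r, hr, hball⟩ := Metric.eventually_nhds_iff_ball.1 hev
  have hconst : ∀ x ∈ Metric.ball a r, B x / A x = B a / A a := fun x hx =>
    (convex_ball a r).is_const_of_fderivWithin_eq_zero (𝕜 := ℂ) (f := fun x => B x / A x)
      (fun y hy => ((hB y).div (hA y) (hball y hy)).differentiableWithinAt)
      (fun y hy => by
        rw [fderivWithin_of_isOpen Metric.isOpen_ball hy]
        have h1 := (hB y).hasDerivAt.div (hA y).hasDerivAt (hball y hy)
        have h2 : (deriv B y * A y - B y * deriv A y) / A y ^ 2 = 0 := by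
          rw [show deriv B y * A y - B y * deriv A y = 0 by linear_combination hW y, zero_div]
        rw [h2] at h1
        exact h1.hasFDerivAt.fderiv.trans (by simp))
      hx (Metric.mem_ball_self hr)
  have hBA : B = fun x => B a / A a * A x := by
    refine AnalyticOnNhd.eq_of_eventuallyEq (𝕜 := ℂ) (z₀ := a) (fun x _ => hB.analyticAt x)
      (fun x _ => (hA.const_mul _).analyticAt x) ?_
    filter_upwards [Metric.ball_mem_nhds a hr] with x hx
    rw [← hconst x hx, div_mul_cancel₀ _ (hball x hx)]
  have h1 := theta_add_mul_theta_sub hτ z 0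
  have hBz := congrFun hBA z
  have hB0 := congrFun hBA 0
  simp only [A, B] at hBz hB0
  rw [add_zero, sub_zero, hBz, hB0] at h1
  exact hz (mul_self_eq_zero.1 (h1.trans (by ring)))

/-- The derivative of the three-term relation at coinciding arguments: the addition theorem
`E₁(a) + E₁(b) + E₁(c) - E₁(a+b+c) = ϑ'(0)ϑ(a+b)ϑ(b+c)ϑ(c+a) / (ϑ(a)ϑ(b)ϑ(c)ϑ(a+b+c))`
without denominators. -/
lemma theta_deriv_add (hτ : 0 < τ.im) (a b c : ℂ) :
    deriv (theta τ) a * theta τ b * theta τ c * theta τ (a + b + c)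
      + theta τ a * deriv (theta τ) b * theta τ c * theta τ (a + b + c)
      + theta τ a * theta τ b * deriv (theta τ) c * theta τ (a + b + c)
      - theta τ a * theta τ b * theta τ c * deriv (theta τ) (a + b + c)
      = deriv (theta τ) 0 * theta τ (a + b) * theta τ (b + c) * theta τ (c + a) := by
  set v := (a + b) / 2
  set y := (a - b) / 2
  set x := c + (a + b) / 2
  have hd : ∀ s, HasDerivAt (theta τ) (deriv (theta τ) s) s := hasDerivAt_theta hτ
  have h := ((((hd (v + v)).comp_add_const v v).mul ((hd (v - v)).comp_sub_const v v)).const_mul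
      (theta τ (x + y) * theta τ (x - y))).add
    ((((hd (y + v)).comp_const_add y v).mul ((hd (y - v)).comp_const_sub y v)).mul_const
      (theta τ (x + v) * theta τ (x - v))) |>.add
    ((((hd (v + x)).comp_add_const v x).mul ((hd (v - x)).comp_sub_const v x)).mul_const
      (theta τ (y + v) * theta τ (y - v)))
  have h0 := h.unique ((hasDerivAt_const v (0 : ℂ)).congr_of_eventuallyEq
    (Eventually.of_forall fun u => theta_three_term hτ x y u v))
  have e1 : v + v = a + b := by simp only [v]; ring
  have e2 : v - v = 0 := by ring
  have e3 : y + v = a := by simp only [v, y]; ring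
  have e4 : y - v = -b := by simp only [v, y]; ring
  have e5 : v + x = a + b + c := by simp only [v, x]; ring
  have e6 : v - x = -c := by simp only [v, x]; ring
  have e7 : x + v = a + b + c := by simp only [v, x]; ring
  have e8 : x - v = c := by simp only [v, x]; ring
  have e9 : x + y = c + a := by simp only [x, y]; ring
  have e10 : x - y = b + c := by simp only [x, y]; ring
  simp only [e1, e2, e3, e4, e5, e6, e7, e8, e9, e10, theta_neg hτ, deriv_theta_neg hτ,
    theta_zero hτ] at h0
  linear_combination -h0

end Theta

/-! ### The Kronecker and the Eisenstein functions -/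

section Kronecker

variable {τ : ℂ}

lemma hasDerivAt_kronecker (hτ : 0 < τ.im) {z u : ℂ} (hz : theta τ z ≠ 0) (hu : theta τ u ≠ 0) :
    HasDerivAt (fun v => kronecker τ z v) (deriv (theta τ) 0 / theta τ z *
      ((deriv (theta τ) (z + u) * theta τ u - theta τ (z + u) * deriv (theta τ) u) /
        theta τ u ^ 2)) u := by
  have h1 : HasDerivAt (fun v => theta τ (z + v)) (deriv (theta τ) (z + u)) u :=
    (hasDerivAt_theta hτ (z + u)).comp_const_add z u
  have h3 := (h1.const_mul (deriv (theta τ) 0)).div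
    ((hasDerivAt_theta hτ u).const_mul (theta τ z)) (mul_ne_zero hz hu)
  refine h3.congr_deriv ?_
  field_simp

lemma kroneckerD_eq_theta (hτ : 0 < τ.im) {z u : ℂ} (hz : theta τ z ≠ 0) (hu : theta τ u ≠ 0) :
    kroneckerD τ z u = deriv (theta τ) 0 / theta τ z *
      ((deriv (theta τ) (z + u) * theta τ u - theta τ (z + u) * deriv (theta τ) u) /
        theta τ u ^ 2) :=
  (hasDerivAt_kronecker hτ hz hu).deriv

lemma hasDerivAt_kronecker' (hτ : 0 < τ.im) {z u : ℂ} (hz : theta τ z ≠ 0) (hu : theta τ u ≠ 0) :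
    HasDerivAt (fun v => kronecker τ z v) (kroneckerD τ z u) u := by
  rw [kroneckerD_eq_theta hτ hz hu]
  exact hasDerivAt_kronecker hτ hz hu

lemma analyticAt_E1 (hτ : 0 < τ.im) {u : ℂ} (hu : theta τ u ≠ 0) : AnalyticAt ℂ (E1 τ) u :=
  (analyticAt_theta hτ u).deriv.div (analyticAt_theta hτ u) hu

lemma analyticAt_E2 (hτ : 0 < τ.im) {u : ℂ} (hu : theta τ u ≠ 0) : AnalyticAt ℂ (E2 τ) u :=
  (analyticAt_E1 hτ hu).deriv.neg

lemma analyticAt_kronecker (hτ : 0 < τ.im) {z u : ℂ} (hz : theta τ z ≠ 0) (hu : theta τ u ≠ 0) :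
    AnalyticAt ℂ (fun v => kronecker τ z v) u := by
  have h1 : AnalyticAt ℂ (fun v => theta τ (z + v)) u :=
    (analyticAt_theta hτ (z + u)).comp (f := fun v => z + v) (by fun_prop)
  exact (analyticAt_const.mul h1).div (analyticAt_const.mul (analyticAt_theta hτ u))
    (mul_ne_zero hz hu)

lemma analyticAt_kroneckerD (hτ : 0 < τ.im) {z u : ℂ} (hz : theta τ z ≠ 0) (hu : theta τ u ≠ 0) :
    AnalyticAt ℂ (fun v => kroneckerD τ z v) u :=
  (analyticAt_kronecker hτ hz hu).deriv

lemma hasDerivAt_E1 (hτ : 0 < τ.im) {u : ℂ} (hu : theta τ u ≠ 0) :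
    HasDerivAt (E1 τ) (-E2 τ u) u := by
  rw [E2, neg_neg]
  exact (analyticAt_E1 hτ hu).differentiableAt.hasDerivAt

lemma E1_neg (hτ : 0 < τ.im) (u : ℂ) : E1 τ (-u) = -E1 τ u := by
  rw [E1, E1, theta_neg hτ, deriv_theta_neg hτ, div_neg]

lemma E2_neg (hτ : 0 < τ.im) (u : ℂ) : E2 τ (-u) = E2 τ u := by
  have h1 : (fun s => E1 τ (-s)) = fun s => -E1 τ s := funext fun s => E1_neg hτ s
  have h2 := congrArg (fun g => deriv g u) h1
  simp only [deriv_comp_neg, deriv.fun_neg] at h2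
  exact h2

lemma E1_sub_comm (hτ : 0 < τ.im) (a b : ℂ) : E1 τ (a - b) = -E1 τ (b - a) := by
  rw [← neg_sub, E1_neg hτ]

lemma E2_sub_comm (hτ : 0 < τ.im) (a b : ℂ) : E2 τ (a - b) = E2 τ (b - a) := by
  rw [← neg_sub, E2_neg hτ]

lemma kronecker_neg_neg (hτ : 0 < τ.im) (z u : ℂ) :
    kronecker τ (-z) (-u) = -kronecker τ z u := by
  rw [kronecker, kronecker, ← neg_add, theta_neg hτ, theta_neg hτ, theta_neg hτ]
  ring

lemma kroneckerD_neg_neg (hτ : 0 < τ.im) (z u : ℂ) :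
    kroneckerD τ (-z) (-u) = kroneckerD τ z u := by
  have h1 : (fun s => kronecker τ (-z) (-s)) = fun s => -kronecker τ z s :=
    funext fun s => kronecker_neg_neg hτ z s
  have h2 := congrArg (fun g => deriv g u) h1
  simp only [deriv_comp_neg (fun s => kronecker τ (-z) s), deriv.fun_neg, neg_inj] at h2
  exact h2

/-- The genus one Fay identity. -/
lemma kronecker_mul_kronecker (hτ : 0 < τ.im) {z w u v : ℂ} (hz : theta τ z ≠ 0)
    (hw : theta τ w ≠ 0) (hzw : theta τ (z - w) ≠ 0) (hu : theta τ u ≠ 0) (hv : theta τ v ≠ 0)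
    (huv : theta τ (u + v) ≠ 0) :
    kronecker τ z u * kronecker τ w v =
      kronecker τ (z - w) u * kronecker τ w (u + v) +
        kronecker τ (w - z) v * kronecker τ z (u + v) := by
  have h := theta_three_term hτ ((z + w + u + v) / 2) ((z - w + u - v) / 2)
    ((u + v + z - w) / 2) ((u + v - z + w) / 2)
  ring_nf at h
  rw [theta_neg hτ, theta_neg hτ] at h
  rw [show w - z = -(z - w) by ring]
  simp only [kronecker]
  rw [show -(z - w) + v = -(z - w - v) by ring, theta_neg hτ, theta_neg hτ, ← add_assoc,
    ← add_assoc]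
  field_simp
  linear_combination deriv (theta τ) 0 ^ 2 * h

/-- The addition theorem of the Kronecker function in its first argument. -/
lemma kroneckerD_add (hτ : 0 < τ.im) {a b u : ℂ} (ha : theta τ a ≠ 0) (hb : theta τ b ≠ 0)
    (hab : theta τ (a + b) ≠ 0) (hu : theta τ u ≠ 0) :
    kroneckerD τ (a + b) u =
      kronecker τ (a + b) u * (E1 τ a + E1 τ b) - kronecker τ a u * kronecker τ b u := by
  have h := theta_deriv_add hτ a b u
  rw [kroneckerD_eq_theta hτ hab hu]
  simp only [kronecker, E1, add_comm u a] at h ⊢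
  generalize deriv (theta τ) 0 = t0 at *
  generalize theta τ (a + b + u) = x1 at *
  generalize deriv (theta τ) (a + b + u) = x2 at *
  generalize theta τ (a + b) = x3 at *
  generalize theta τ (b + u) = x4 at *
  generalize theta τ (a + u) = x5 at *
  generalize deriv (theta τ) a = x6 at *
  generalize deriv (theta τ) b = x7 at *
  generalize deriv (theta τ) u = x8 at *
  generalize theta τ a = x9 at *
  generalize theta τ b = x10 at *
  generalize theta τ u = x11 at *
  field_simp
  linear_combination -t0 * h

/-- The exchange relation of two Kronecker functions with the same derivative index, the degenerate
case of the relation `kronecker_exchange`. -/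
lemma kronecker_exchange_deriv (hτ : 0 < τ.im) {z w v d : ℂ} (hz : theta τ z ≠ 0)
    (hw : theta τ w ≠ 0) (hzw : theta τ (z - w) ≠ 0) (hu : theta τ (v + d) ≠ 0)
    (hv : theta τ v ≠ 0) (hd : theta τ d ≠ 0) :
    kronecker τ z v * kronecker τ w (v + d) * kronecker τ (z - w) d =
      kronecker τ z (v + d) * kronecker τ w v * (E1 τ d + E1 τ (z - w) - E1 τ (v + d) + E1 τ v)
        - kroneckerD τ z (v + d) * kronecker τ w v
        + kronecker τ z (v + d) * kroneckerD τ w v := by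
  have h := theta_deriv_add hτ d (z - w) (w + v)
  rw [kroneckerD_eq_theta hτ hz hu, kroneckerD_eq_theta hτ hw hv]
  rw [show d + (z - w) + (w + v) = z + (v + d) by ring, show z - w + (w + v) = z + v by ring,
    show w + v + d = w + (v + d) by ring, add_comm d (z - w)] at h
  simp only [kronecker, E1] at h ⊢
  generalize deriv (theta τ) 0 = t0 at *
  generalize theta τ (z + (v + d)) = x1 at *
  generalize deriv (theta τ) (z + (v + d)) = x2 at *
  generalize theta τ (z - w + d) = x3 at *
  generalize theta τ (w + (v + d)) = x4 at *
  generalize deriv (theta τ) (v + d) = x41 at *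
  generalize theta τ (v + d) = x5 at *
  generalize theta τ (z + v) = x51 at *
  generalize deriv (theta τ) (w + v) = x6 at *
  generalize theta τ (w + v) = x61 at *
  generalize deriv (theta τ) (z - w) = x7 at *
  generalize deriv (theta τ) d = x8 at *
  generalize theta τ (z - w) = x9 at *
  generalize theta τ w = x10 at *
  generalize theta τ z = x110 at *
  generalize theta τ d = x11 at *
  generalize deriv (theta τ) v = x111 at *
  generalize theta τ v = x112 at *
  field_simp
  linear_combination -t0 ^ 2 * x112 * x5 * h

/-- The exchange relation of two Kronecker functions at the differences of two pairs of points;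
`b` and `a` are the differences of the first and of the second points. -/
lemma kronecker_exchange (hτ : 0 < τ.im) {z w a b c : ℂ} (hz : theta τ z ≠ 0)
    (hw : theta τ w ≠ 0) (hzw : theta τ (z - w) ≠ 0) (ha : theta τ a ≠ 0) (hb : theta τ b ≠ 0)
    (hc : theta τ c ≠ 0) (hs : theta τ (a + b + c) ≠ 0) (hbc : theta τ (b + c) ≠ 0)
    (hca : theta τ (c + a) ≠ 0) :
    kronecker τ z (b + c) * kronecker τ w (c + a) *
        (E1 τ a + E1 τ b + E1 τ c - E1 τ (a + b + c)) =
      kronecker τ (z - w) b * kronecker τ z c * kronecker τ w (a + b + c)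
        - kronecker τ z (a + b + c) * kronecker τ w c * kronecker τ (z - w) (-a) := by
  have h := theta_deriv_add hτ a b c
  have h3 := theta_three_term hτ ((z + w + a + b + 2 * c) / 2) ((z - w + b - a) / 2)
    ((a + b + z - w) / 2) ((a + b - z + w) / 2)
  ring_nf at h3
  rw [show -w - c = -(w + c) by ring, theta_neg hτ, theta_neg hτ] at h3
  have hE : E1 τ a + E1 τ b + E1 τ c - E1 τ (a + b + c) =
      deriv (theta τ) 0 * theta τ (a + b) * theta τ (b + c) * theta τ (c + a) /
        (theta τ a * theta τ b * theta τ c * theta τ (a + b + c)) := by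
    simp only [E1]
    field_simp
    linear_combination h
  rw [hE]
  simp only [kronecker]
  rw [show z - w + -a = z - w - a by ring, theta_neg hτ, ← add_assoc, ← add_assoc, ← add_assoc,
    ← add_assoc, ← add_assoc, ← add_assoc, add_right_comm w c a]
  generalize deriv (theta τ) 0 = t0 at *
  generalize theta τ (z + b + c) = x1 at *
  generalize theta τ (w + a + c) = x2 at *
  generalize theta τ (a + b) = x3 at *
  generalize theta τ (z - w) = x4 at *
  generalize theta τ (z - w + b) = x5 at *
  generalize theta τ (w + a + b + c) = x6 at *
  generalize theta τ (z + c) = x7 at *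
  generalize theta τ (z + a + b + c) = x8 at *
  generalize theta τ (w + c) = x9 at *
  generalize theta τ (z - w - a) = x10 at *
  generalize theta τ (a + b + c) = x11 at *
  generalize theta τ (b + c) = x12 at *
  generalize theta τ (c + a) = x13 at *
  field_simp
  linear_combination t0 ^ 3 * h3

end Kronecker

/-! ### Loops -/

section Loops

variable {f g : ℝ → ℂ}

lemma IsLoop.continuous (hf : IsLoop f) : Continuous f := hf.1.continuous

lemma IsLoop.differentiable (hf : IsLoop f) : Differentiable ℝ f :=
  hf.1.differentiable (by simp)

lemma IsLoop.hasDerivAt (hf : IsLoop f) (x : ℝ) : HasDerivAt f (deriv f x) x :=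
  (hf.differentiable x).hasDerivAt

lemma isLoop_const (c : ℂ) : IsLoop fun _ => c := ⟨contDiff_const, fun _ => rfl⟩

lemma IsLoop.add (hf : IsLoop f) (hg : IsLoop g) : IsLoop fun x => f x + g x :=
  ⟨hf.1.add hg.1, hf.2.add hg.2⟩

lemma IsLoop.neg (hf : IsLoop f) : IsLoop fun x => -f x :=
  ⟨hf.1.neg, fun x => by simp only [hf.2 x]⟩

lemma IsLoop.sub (hf : IsLoop f) (hg : IsLoop g) : IsLoop fun x => f x - g x :=
  ⟨hf.1.sub hg.1, hf.2.sub hg.2⟩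

lemma IsLoop.mul (hf : IsLoop f) (hg : IsLoop g) : IsLoop fun x => f x * g x :=
  ⟨hf.1.mul hg.1, hf.2.mul hg.2⟩

lemma IsLoop.sum {ι : Type*} {s : Finset ι} {f : ι → ℝ → ℂ} (hf : ∀ i ∈ s, IsLoop (f i)) :
    IsLoop fun x => ∑ i ∈ s, f i x :=
  ⟨ContDiff.sum fun i hi => (hf i hi).1, fun x => Finset.sum_congr rfl fun i hi => (hf i hi).2 x⟩

lemma IsLoop.prod {ι : Type*} {s : Finset ι} {f : ι → ℝ → ℂ} (hf : ∀ i ∈ s, IsLoop (f i)) :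
    IsLoop fun x => ∏ i ∈ s, f i x :=
  ⟨contDiff_prod fun i hi => (hf i hi).1, fun x => Finset.prod_congr rfl fun i hi => (hf i hi).2 x⟩

lemma IsLoop.shift (hf : IsLoop f) (c : ℝ) : IsLoop fun x => f (x + c) :=
  ⟨hf.1.comp (contDiff_id.add contDiff_const), fun x => by
    simp only [← hf.2 (x + c)]; ring_nf⟩

lemma IsLoop.shift_sub (hf : IsLoop f) (c : ℝ) : IsLoop fun x => f (x - c) := by
  simpa only [sub_eq_add_neg] using hf.shift (-c)

lemma IsLoop.deriv (hf : IsLoop f) : IsLoop (deriv f) := by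
  refine ⟨(contDiff_infty_iff_deriv.1 hf.1).2, fun x => ?_⟩
  rw [← deriv_comp_add_const]
  exact congrArg (fun F => _root_.deriv F x) (funext hf.2)

lemma IsLoop.inv (hf : IsLoop f) (h : ∀ x, f x ≠ 0) : IsLoop fun x => (f x)⁻¹ :=
  ⟨hf.1.inv h, fun x => by simp only [hf.2 x]⟩

lemma IsLoop.div (hf : IsLoop f) (hg : IsLoop g) (h : ∀ x, g x ≠ 0) :
    IsLoop fun x => f x / g x :=
  by simpa only [div_eq_mul_inv] using hf.mul (hg.inv h)

lemma IsLoop.comp_analytic {G : ℂ → ℂ} (hf : IsLoop f) (h : ∀ x, AnalyticAt ℂ G (f x)) :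
    IsLoop fun x => G (f x) :=
  ⟨contDiff_iff_contDiffAt.2 fun x =>
    ((h x).contDiffAt.restrict_scalars ℝ).comp x hf.1.contDiffAt, fun x => by simp only [hf.2 x]⟩

lemma IsLoop.cexp (hf : IsLoop f) : IsLoop fun x => cexp (f x) :=
  hf.comp_analytic fun _ => analyticAt_cexp

lemma IsLoop.intervalIntegrable (hf : IsLoop f) (a b : ℝ) :
    IntervalIntegrable f MeasureTheory.volume a b := hf.continuous.intervalIntegrable a b

lemma IsLoop.isCompact_range (hf : IsLoop f) : IsCompact (Set.range f) :=
  hf.2.compact_of_continuous (by positivity) hf.continuous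

lemma IsLoop.exists_bound (hf : IsLoop f) : ∃ C, ∀ x, ‖f x‖ ≤ C := by
  obtain ⟨C, hC⟩ := hf.isCompact_range.isBounded.exists_norm_le
  exact ⟨C, fun x => hC _ ⟨x, rfl⟩⟩

lemma IsLoop.integral_shift (hf : IsLoop f) (c : ℝ) :
    ∫ x in (0 : ℝ)..(2 * Real.pi), f (x + c) = ∫ x in (0 : ℝ)..(2 * Real.pi), f x := by
  rw [intervalIntegral.integral_comp_add_right, zero_add, add_comm]
  simpa using hf.2.intervalIntegral_add_eq c 0

lemma IsLoop.integral_deriv (hf : IsLoop f) :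
    ∫ x in (0 : ℝ)..(2 * Real.pi), _root_.deriv f x = 0 := by
  rw [intervalIntegral.integral_deriv_eq_sub (fun x _ => hf.differentiable x)
    (hf.deriv.intervalIntegrable _ _)]
  have := hf.2 0
  rw [zero_add] at this
  rw [this, sub_self]

lemma IsLoop.integral_mul_deriv (hf : IsLoop f) (hg : IsLoop g) :
    ∫ x in (0 : ℝ)..(2 * Real.pi), f x * _root_.deriv g x =
      ∫ x in (0 : ℝ)..(2 * Real.pi), -(_root_.deriv f x * g x) := by
  have h := (hf.mul hg).integral_deriv
  have h1 : _root_.deriv (fun x => f x * g x) =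
      fun x => f x * _root_.deriv g x - -(_root_.deriv f x * g x) := by
    funext x
    rw [((hf.hasDerivAt x).fun_mul (hg.hasDerivAt x)).deriv]
    ring
  rw [h1, intervalIntegral.integral_sub ((hf.mul hg.deriv).intervalIntegrable _ _)
    ((hf.deriv.mul hg).neg.intervalIntegrable _ _)] at h
  exact sub_eq_zero.1 h

end Loops

/-! ### Functional derivatives of smeared local functionals -/

section FunctionalDerivative

/-- Differentiation under the integral sign along a complex parameter. -/
lemma hasDerivAt_integral_of_contDiffAt {g : ℂ → ℝ → ℂ} {g' : ℝ → ℂ} {a b : ℝ} (hab : a ≤ b)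
    (hg : ∀ x ∈ Set.Icc a b, ContDiffAt ℝ 1 (fun s : ℂ × ℝ => g s.1 s.2) (0, x))
    (hd : ∀ x ∈ Set.Icc a b, HasDerivAt (fun t => g t x) (g' x) 0) :
    HasDerivAt (fun t => ∫ x in a..b, g t x) (∫ x in a..b, g' x) 0 := by
  set f : ℂ × ℝ → ℂ := fun s => g s.1 s.2
  set U : Set (ℂ × ℝ) := {s | ContDiffAt ℝ 1 f s}
  have hU : IsOpen U := isOpen_iff_mem_nhds.2 fun s hs => ContDiffAt.eventually hs (by simp)
  obtain ⟨u, v, hu, hv, hu0, hvI, huv⟩ := generalized_tube_lemma isCompact_singleton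
    isCompact_Icc hU (s := {(0 : ℂ)}) (t := Set.Icc a b) (by
      rintro ⟨t, x⟩ ⟨ht, hx⟩
      obtain rfl : t = 0 := ht
      exact hg x hx)
  obtain ⟨δ, hδ, hδu⟩ := Metric.nhds_basis_closedBall.mem_iff.1
    (hu.mem_nhds (hu0 (Set.mem_singleton 0)))
  have hfU : ContDiffOn ℝ 1 f U := fun s hs => ContDiffAt.contDiffWithinAt hs
  have hK : Metric.closedBall (0 : ℂ) δ ×ˢ Set.Icc a b ⊆ U :=
    (Set.prod_mono hδu hvI).trans huv
  have hf' : ContinuousOn (fderiv ℝ f) (Metric.closedBall (0 : ℂ) δ ×ˢ Set.Icc a b) :=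
    (hfU.continuousOn_fderiv_of_isOpen hU le_rfl).mono hK
  obtain ⟨C, hC⟩ :=
    ((isCompact_closedBall (0 : ℂ) δ).prod isCompact_Icc).exists_bound_of_continuousOn
    hf'
  set F' : ℂ → ℝ → ℂ →L[ℝ] ℂ := fun t x => (fderiv ℝ f (t, x)).comp (.inl ℝ ℂ ℝ)
  have hF' : ∀ t ∈ Metric.closedBall (0 : ℂ) δ, ∀ x ∈ Set.Icc a b,
      HasFDerivAt (fun t => g t x) (F' t x) t := fun t ht x hx => by
    have h1 : HasFDerivAt f (fderiv ℝ f (t, x)) (t, x) :=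
      (ContDiffAt.differentiableAt (n := 1) (hK (Set.mk_mem_prod ht hx)) (by simp)).hasFDerivAt
    have h2 : HasFDerivAt (fun e : ℂ => (e, x)) (ContinuousLinearMap.inl ℝ ℂ ℝ) t :=
      hasFDerivAt_prodMk_left t x
    exact HasFDerivAt.comp (g := f) t h1 h2
  have hslice : ∀ t ∈ Metric.closedBall (0 : ℂ) δ, ContinuousOn (fun x => g t x) (Set.Icc a b) :=
    fun t ht => (hfU.continuousOn.mono hK).comp (f := fun x => (t, x)) (by fun_prop)
      fun x hx => ⟨ht, hx⟩
  have h0 : (0 : ℂ) ∈ Metric.closedBall (0 : ℂ) δ := Metric.mem_closedBall_self hδ.le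
  have hmain := intervalIntegral.hasFDerivAt_integral_of_dominated_of_fderiv_le (𝕜 := ℝ)
    (F := g) (F' := F') (x₀ := 0) (s := Metric.closedBall 0 δ) (a := a) (b := b)
    (μ := MeasureTheory.volume) (bound := fun _ => C * ‖ContinuousLinearMap.inl ℝ ℂ ℝ‖)
    (Metric.closedBall_mem_nhds 0 hδ)
    (by
      filter_upwards [Metric.closedBall_mem_nhds (0 : ℂ) hδ] with t ht
      rw [Set.uIoc_of_le hab]
      exact ((hslice t ht).mono Set.Ioc_subset_Icc_self).aestronglyMeasurable measurableSet_Ioc)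
    ((hslice 0 h0).intervalIntegrable_of_Icc hab)
    (by
      rw [Set.uIoc_of_le hab]
      refine ContinuousOn.aestronglyMeasurable ?_ measurableSet_Ioc
      refine ContinuousOn.clm_comp (ContinuousOn.comp hf' (by fun_prop) fun x hx => ?_)
        continuousOn_const
      exact ⟨h0, Set.Ioc_subset_Icc_self hx⟩)
    (Eventually.of_forall fun x hx t ht => by
      rw [Set.uIoc_of_le hab] at hx
      exact (ContinuousLinearMap.opNorm_comp_le _ _).trans
        (mul_le_mul_of_nonneg_right (hC _ ⟨ht, Set.Ioc_subset_Icc_self hx⟩) (norm_nonneg _)))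
    intervalIntegrable_const
    (Eventually.of_forall fun x hx t ht => by
      rw [Set.uIoc_of_le hab] at hx
      exact hF' t ht x (Set.Ioc_subset_Icc_self hx))
  have hint : IntervalIntegrable (F' 0) MeasureTheory.volume a b := by
    refine ContinuousOn.intervalIntegrable_of_Icc hab ?_
    exact ContinuousOn.clm_comp (ContinuousOn.comp hf' (by fun_prop) fun x hx => ⟨h0, hx⟩)
        continuousOn_const
  have heq : ∀ x ∈ Set.Icc a b, ∀ v : ℂ, F' 0 x v = v * g' x := fun x hx v => by
    have h1 := (hF' 0 h0 x hx).unique ((hd x hx).hasFDerivAt.restrictScalars ℝ)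
    rw [h1]
    simp
  rw [hasDerivAt_iff_hasFDerivAt]
  refine hasFDerivAt_of_restrictScalars ℝ hmain (ContinuousLinearMap.ext fun v => ?_)
  rw [ContinuousLinearMap.intervalIntegral_apply hint,
    intervalIntegral.integral_congr (g := fun x => v * g' x) fun x hx =>
      heq x (by rwa [Set.uIcc_of_le hab] at hx) v]
  simp

variable {N : ℕ}

/-- The Euler-Lagrange expression. `D0`, `D1`, `D2` are the partial derivatives of the density `A`
in `q_a`, `q_{a,x}`, `q_{a,xx}` at the point `x`, `Dm` is the one in `q_a(x - ε)` and `Dp` the one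
in `p_a`. -/
lemma hasFunctionalDeriv_smear {A : (Fin N → ℝ → ℂ) → (Fin N → ℝ → ℂ) → ℝ → ℂ} {ε : ℝ}
    {q p : Fin N → ℝ → ℂ} {D0 D1 D2 Dm Dp : Fin N → ℝ → ℂ} {φ : ℝ → ℂ} (hφ : IsLoop φ)
    (hD0 : ∀ a, IsLoop (D0 a)) (hD1 : ∀ a, IsLoop (D1 a)) (hD2 : ∀ a, IsLoop (D2 a))
    (hDm : ∀ a, IsLoop (Dm a)) (hDp : ∀ a, IsLoop (Dp a))
    (hA : ∀ h k : Fin N → ℝ → ℂ, (∀ a, IsLoop (h a)) → (∀ a, IsLoop (k a)) → ∀ x,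
      ContDiffAt ℝ 1 (fun s : ℂ × ℝ => A (fun a x => q a x + s.1 * h a x)
        (fun a x => p a x + s.1 * k a x) s.2) (0, x))
    (hd : ∀ h k : Fin N → ℝ → ℂ, (∀ a, IsLoop (h a)) → (∀ a, IsLoop (k a)) → ∀ x,
      HasDerivAt (fun t : ℂ => A (fun a x => q a x + t * h a x) (fun a x => p a x + t * k a x) x)
        (∑ a, (D0 a x * h a x + D1 a x * deriv (h a) x + D2 a x * deriv (deriv (h a)) x
          + Dm a x * h a (x - ε) + Dp a x * k a x)) 0) :
    HasFunctionalDeriv (smear φ A) q p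
      (fun a x => φ x * D0 a x - deriv (fun s => φ s * D1 a s) x
        + deriv (deriv fun s => φ s * D2 a s) x + φ (x + ε) * Dm a (x + ε))
      (fun a x => φ x * Dp a x) := by
  have hq : ∀ a, IsLoop fun x => φ x * D0 a x - deriv (fun s => φ s * D1 a s) x
        + deriv (deriv fun s => φ s * D2 a s) x + φ (x + ε) * Dm a (x + ε) := fun a =>
    (((hφ.mul (hD0 a)).sub (hφ.mul (hD1 a)).deriv).add (hφ.mul (hD2 a)).deriv.deriv).add
      ((hφ.mul (hDm a)).shift ε)
  refine ⟨hq, fun a => hφ.mul (hDp a), fun h k hh hk => ?_⟩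
  have h1 := hasDerivAt_integral_of_contDiffAt (a := 0) (b := 2 * Real.pi) (by positivity)
    (g := fun t x => φ x * A (fun a x => q a x + t * h a x) (fun a x => p a x + t * k a x) x)
    (fun x _ => ((hφ.1.of_le (by exact_mod_cast le_top)).comp contDiff_snd).contDiffAt.mul
      (hA h k hh hk x))
    (fun x _ => (hd h k hh hk x).const_mul (φ x))
  refine h1.congr_deriv ?_
  simp only [Finset.mul_sum]
  rw [intervalIntegral.integral_finsetSum]
  · refine Finset.sum_congr rfl fun a _ => ?_
    have e0 := (hφ.mul (hD0 a)).mul (hh a)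
    have e1 := (hφ.mul (hD1 a)).mul (hh a).deriv
    have e2 := (hφ.mul (hD2 a)).mul (hh a).deriv.deriv
    have em := (hφ.mul (hDm a)).mul ((hh a).shift_sub ε)
    have ep := (hφ.mul (hDp a)).mul (hk a)
    have i1 := (hφ.mul (hD1 a)).integral_mul_deriv (hh a)
    have i2 := (hφ.mul (hD2 a)).integral_mul_deriv (hh a).deriv
    have i3 := (hφ.mul (hD2 a)).deriv.integral_mul_deriv (hh a)
    have i4 := em.integral_shift ε
    simp only [add_sub_cancel_right] at i4
    have e1' := ((hφ.mul (hD1 a)).deriv.mul (hh a))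
    have e2' := ((hφ.mul (hD2 a)).deriv.deriv.mul (hh a))
    have em' := ((hφ.mul (hDm a)).shift ε).mul (hh a)
    rw [intervalIntegral.integral_neg] at i1 i2 i3
    trans (∫ x in (0 : ℝ)..(2 * Real.pi), φ x * D0 a x * h a x)
      + (∫ x in (0 : ℝ)..(2 * Real.pi), φ x * D1 a x * deriv (h a) x)
      + (∫ x in (0 : ℝ)..(2 * Real.pi), φ x * D2 a x * deriv (deriv (h a)) x)
      + (∫ x in (0 : ℝ)..(2 * Real.pi), φ x * Dm a x * h a (x - ε))
      + (∫ x in (0 : ℝ)..(2 * Real.pi), φ x * Dp a x * k a x)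
    · rw [← intervalIntegral.integral_add (e0.intervalIntegrable _ _) (e1.intervalIntegrable _ _),
        ← intervalIntegral.integral_add ((e0.add e1).intervalIntegrable _ _)
          (e2.intervalIntegrable _ _),
        ← intervalIntegral.integral_add (((e0.add e1).add e2).intervalIntegrable _ _)
          (em.intervalIntegrable _ _),
        ← intervalIntegral.integral_add ((((e0.add e1).add e2).add em).intervalIntegrable _ _)
          (ep.intervalIntegrable _ _)]
      congr 1
      funext x
      ring
    · rw [i1, i2, i3, ← i4, neg_neg, ← intervalIntegral.integral_neg,
        ← intervalIntegral.integral_add (e0.intervalIntegrable _ _)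
          (e1'.neg.intervalIntegrable _ _),
        ← intervalIntegral.integral_add ((e0.add e1'.neg).intervalIntegrable _ _)
          (e2'.intervalIntegrable _ _),
        ← intervalIntegral.integral_add (((e0.add e1'.neg).add e2').intervalIntegrable _ _)
          (em'.intervalIntegrable _ _),
        ← intervalIntegral.integral_add
          ((((e0.add e1'.neg).add e2').add em').intervalIntegrable _ _)
          (ep.intervalIntegrable _ _)]
      congr 1
      funext x
      ring
  · intro a _
    exact (hφ.mul ((((((hD0 a).mul (hh a)).add ((hD1 a).mul (hh a).deriv)).add
      ((hD2 a).mul (hh a).deriv.deriv)).add ((hDm a).mul ((hh a).shift_sub ε))).add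
      ((hDp a).mul (hk a)))).intervalIntegrable _ _

end FunctionalDerivative

/-! ### Limits that are uniform on the circle, with a linear rate -/

section UnifLim

/-- `f ε x = f₀ x + O(ε)` as `ε → 0`, `ε ≠ 0`, uniformly in `x`, with bounded `f₀`. -/
def UnifLim (f : ℝ → ℝ → ℂ) (f₀ : ℝ → ℂ) : Prop :=
  (∃ C, ∀ x, ‖f₀ x‖ ≤ C) ∧ ∃ C, ∀ᶠ ε : ℝ in 𝓝[≠] 0, ∀ x, ‖f ε x - f₀ x‖ ≤ C * |ε|

variable {f g : ℝ → ℝ → ℂ} {f₀ g₀ f₁ g₁ : ℝ → ℂ}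

lemma eventually_abs_le_one : ∀ᶠ ε : ℝ in 𝓝[≠] 0, |ε| ≤ 1 := by
  filter_upwards [mem_nhdsWithin_of_mem_nhds (Metric.closedBall_mem_nhds (0 : ℝ) one_pos)] with ε h
  simpa using h

lemma eventually_ne_zero' : ∀ᶠ ε : ℝ in 𝓝[≠] 0, ε ≠ 0 := eventually_mem_nhdsWithin

lemma UnifLim.congr (hf : UnifLim f f₀) (h : ∀ᶠ ε : ℝ in 𝓝[≠] 0, ∀ x, f ε x = g ε x) :
    UnifLim g f₀ := by
  obtain ⟨hb, C, hC⟩ := hf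
  refine ⟨hb, C, ?_⟩
  filter_upwards [hC, h] with ε h1 h2 x
  rw [← h2]
  exact h1 x

lemma UnifLim.congr_right (hf : UnifLim f f₀) (h : ∀ x, f₀ x = g₀ x) : UnifLim f g₀ := by
  obtain rfl : f₀ = g₀ := funext h
  exact hf

lemma UnifLim.exists_bound (hf : UnifLim f f₀) :
    ∃ C, 0 ≤ C ∧ ∀ᶠ ε : ℝ in 𝓝[≠] 0, ∀ x, ‖f ε x‖ ≤ C := by
  obtain ⟨⟨B, hB⟩, C, hC⟩ := hf
  refine ⟨B + |C|, add_nonneg ((norm_nonneg _).trans (hB 0)) (abs_nonneg _), ?_⟩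
  filter_upwards [hC, eventually_abs_le_one] with ε h1 h2 x
  have h3 : C * |ε| ≤ |C| := (mul_le_mul_of_nonneg_right (le_abs_self C) (abs_nonneg ε)).trans
    (mul_le_of_le_one_right (abs_nonneg C) h2)
  calc ‖f ε x‖ = ‖f₀ x + (f ε x - f₀ x)‖ := by rw [add_sub_cancel]
    _ ≤ _ := (norm_add_le _ _).trans (add_le_add (hB x) ((h1 x).trans h3))

lemma unifLim_of_bounded (h : ∃ C, ∀ x, ‖f₀ x‖ ≤ C) : UnifLim (fun _ => f₀) f₀ :=
  ⟨h, 0, Eventually.of_forall fun ε x => by simp⟩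

lemma IsLoop.unifLim {f₀ : ℝ → ℂ} (h : IsLoop f₀) : UnifLim (fun _ => f₀) f₀ :=
  unifLim_of_bounded h.exists_bound

lemma unifLim_const (c : ℂ) : UnifLim (fun _ _ => c) fun _ => c :=
  (isLoop_const c).unifLim

lemma unifLim_param : UnifLim (fun ε _ => (ε : ℂ)) fun _ => 0 :=
  ⟨⟨0, by simp⟩, 1, Eventually.of_forall fun ε x => by simp⟩

lemma UnifLim.add (hf : UnifLim f f₀) (hg : UnifLim g g₀) :
    UnifLim (fun ε x => f ε x + g ε x) fun x => f₀ x + g₀ x := by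
  obtain ⟨⟨B, hB⟩, C, hC⟩ := hf
  obtain ⟨⟨B', hB'⟩, C', hC'⟩ := hg
  refine ⟨⟨B + B', fun x => (norm_add_le _ _).trans (add_le_add (hB x) (hB' x))⟩, C + C', ?_⟩
  filter_upwards [hC, hC'] with ε h1 h2 x
  rw [add_mul, add_sub_add_comm]
  exact (norm_add_le _ _).trans (add_le_add (h1 x) (h2 x))

lemma UnifLim.mul (hf : UnifLim f f₀) (hg : UnifLim g g₀) :
    UnifLim (fun ε x => f ε x * g ε x) fun x => f₀ x * g₀ x := by
  obtain ⟨M, hM, hbg⟩ := hg.exists_bound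
  obtain ⟨⟨B, hB⟩, C, hC⟩ := hf
  obtain ⟨⟨B', hB'⟩, C', hC'⟩ := hg
  have hB0 : 0 ≤ B := (norm_nonneg _).trans (hB 0)
  refine ⟨⟨B * B', fun x => ?_⟩, C * M + B * C', ?_⟩
  · rw [norm_mul]
    exact mul_le_mul (hB x) (hB' x) (norm_nonneg _) hB0
  filter_upwards [hC, hC', hbg] with ε h1 h2 h3 x
  rw [show f ε x * g ε x - f₀ x * g₀ x =
    (f ε x - f₀ x) * g ε x + f₀ x * (g ε x - g₀ x) by ring]
  refine (norm_add_le _ _).trans ?_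
  rw [norm_mul, norm_mul]
  calc _ ≤ C * |ε| * M + B * (C' * |ε|) :=
        add_le_add (mul_le_mul (h1 x) (h3 x) (norm_nonneg _) ((norm_nonneg _).trans (h1 x)))
          (mul_le_mul (hB x) (h2 x) (norm_nonneg _) hB0)
    _ = _ := by ring

lemma UnifLim.const_mul (hf : UnifLim f f₀) (c : ℂ) :
    UnifLim (fun ε x => c * f ε x) fun x => c * f₀ x := (unifLim_const c).mul hf

lemma UnifLim.neg (hf : UnifLim f f₀) : UnifLim (fun ε x => -f ε x) fun x => -f₀ x := by
  simpa only [neg_one_mul] using hf.const_mul (-1)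

lemma UnifLim.sub (hf : UnifLim f f₀) (hg : UnifLim g g₀) :
    UnifLim (fun ε x => f ε x - g ε x) fun x => f₀ x - g₀ x := by
  simpa only [sub_eq_add_neg] using hf.add hg.neg

lemma UnifLim.sum {ι : Type*} {s : Finset ι} {f : ι → ℝ → ℝ → ℂ} {f₀ : ι → ℝ → ℂ}
    (h : ∀ i ∈ s, UnifLim (f i) (f₀ i)) :
    UnifLim (fun ε x => ∑ i ∈ s, f i ε x) fun x => ∑ i ∈ s, f₀ i x := by
  classical
  induction s using Finset.induction_on with
  | empty => simpa using unifLim_const 0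
  | insert a s ha ih =>
    simp only [Finset.sum_insert ha]
    exact (h a (Finset.mem_insert_self a s)).add
      (ih fun i hi => h i (Finset.mem_insert_of_mem hi))

lemma UnifLim.prod {ι : Type*} {s : Finset ι} {f : ι → ℝ → ℝ → ℂ} {f₀ : ι → ℝ → ℂ}
    (h : ∀ i ∈ s, UnifLim (f i) (f₀ i)) :
    UnifLim (fun ε x => ∏ i ∈ s, f i ε x) fun x => ∏ i ∈ s, f₀ i x := by
  classical
  induction s using Finset.induction_on with
  | empty => simpa using unifLim_const 1
  | insert a s ha ih =>
    simp only [Finset.prod_insert ha]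
    exact (h a (Finset.mem_insert_self a s)).mul
      (ih fun i hi => h i (Finset.mem_insert_of_mem hi))

lemma UnifLim.eventually_le_norm (hf : UnifLim f f₀) {c : ℝ} (hc : 0 < c)
    (h : ∀ x, c ≤ ‖f₀ x‖) : ∀ᶠ ε : ℝ in 𝓝[≠] 0, ∀ x, c / 2 ≤ ‖f ε x‖ := by
  obtain ⟨-, C, hC⟩ := hf
  have h0 : Tendsto (fun ε : ℝ => C * |ε|) (𝓝[≠] 0) (𝓝 0) :=
    ((by fun_prop : Continuous fun ε : ℝ => C * |ε|).tendsto' 0 0 (by simp)).mono_left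
      nhdsWithin_le_nhds
  filter_upwards [hC, h0.eventually_le_const (half_pos hc)] with ε h1 h2 x
  have h3 := norm_sub_norm_le (f₀ x) (f ε x)
  rw [norm_sub_rev] at h3
  linarith [h1 x, h x]

lemma UnifLim.eventually_ne (hf : UnifLim f f₀) {c : ℝ} (hc : 0 < c)
    (h : ∀ x, c ≤ ‖f₀ x‖) : ∀ᶠ ε : ℝ in 𝓝[≠] 0, ∀ x, f ε x ≠ 0 := by
  filter_upwards [hf.eventually_le_norm hc h] with ε h1 x h2
  have := h1 x
  rw [h2, norm_zero] at this
  linarith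

lemma UnifLim.inv (hf : UnifLim f f₀) {c : ℝ} (hc : 0 < c) (h : ∀ x, c ≤ ‖f₀ x‖) :
    UnifLim (fun ε x => (f ε x)⁻¹) fun x => (f₀ x)⁻¹ := by
  have h1 := hf.eventually_le_norm hc h
  obtain ⟨-, C, hC⟩ := hf
  refine ⟨⟨c⁻¹, fun x => ?_⟩, C / (c / 2 * c), ?_⟩
  · rw [norm_inv]
    exact inv_anti₀ hc (h x)
  filter_upwards [hC, h1] with ε h2 h3 x
  have h4 : 0 < ‖f ε x‖ := (half_pos hc).trans_le (h3 x)
  have h5 : 0 < ‖f₀ x‖ := hc.trans_le (h x)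
  rw [inv_sub_inv (norm_pos_iff.1 h4) (norm_pos_iff.1 h5), norm_div, norm_mul, norm_sub_rev,
    div_mul_eq_mul_div]
  exact div_le_div₀ ((norm_nonneg _).trans (h2 x)) (h2 x) (by positivity)
    (mul_le_mul (h3 x) (h x) hc.le h4.le)

lemma UnifLim.tendsto (hf : UnifLim f f₀) (x : ℝ) :
    Tendsto (fun ε => f ε x) (𝓝[≠] 0) (𝓝 (f₀ x)) := by
  obtain ⟨-, C, hC⟩ := hf
  have h0 : Tendsto (fun ε : ℝ => C * |ε|) (𝓝[≠] 0) (𝓝 0) :=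
    ((by fun_prop : Continuous fun ε : ℝ => C * |ε|).tendsto' 0 0 (by simp)).mono_left
      nhdsWithin_le_nhds
  refine tendsto_iff_norm_sub_tendsto_zero.2 (squeeze_zero' (Eventually.of_forall fun _ =>
    norm_nonneg _) ?_ h0)
  filter_upwards [hC] with ε h using h x

lemma UnifLim.tendsto_integral (hf : UnifLim f f₀)
    (hc : ∀ᶠ ε : ℝ in 𝓝[≠] 0, Continuous (f ε)) (hc₀ : Continuous f₀) (a b : ℝ) :
    Tendsto (fun ε => ∫ x in a..b, f ε x) (𝓝[≠] 0) (𝓝 (∫ x in a..b, f₀ x)) := by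
  obtain ⟨-, C, hC⟩ := hf
  have h0 : Tendsto (fun ε : ℝ => C * |ε| * |b - a|) (𝓝[≠] 0) (𝓝 0) :=
    ((by fun_prop : Continuous fun ε : ℝ => C * |ε| * |b - a|).tendsto' 0 0 (by simp)).mono_left
      nhdsWithin_le_nhds
  refine tendsto_iff_norm_sub_tendsto_zero.2 (squeeze_zero' (Eventually.of_forall fun _ =>
    norm_nonneg _) ?_ h0)
  filter_upwards [hC, hc] with ε h1 h2
  rw [← intervalIntegral.integral_sub (h2.intervalIntegrable a b) (hc₀.intervalIntegrable a b)]
  exact intervalIntegral.norm_integral_le_of_norm_le_const fun x _ => h1 x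

/-- A function with a uniform first-order expansion converges uniformly. -/
lemma UnifLim.of_slope (h0 : ∃ C, ∀ x, ‖f₀ x‖ ≤ C)
    (h : UnifLim (fun ε x => (f ε x - f₀ x) / ε) f₁) : UnifLim f f₀ := by
  have h1 := (unifLim_of_bounded h0).add (unifLim_param.mul h)
  simp only [zero_mul, add_zero] at h1
  refine h1.congr ?_
  filter_upwards [eventually_ne_zero'] with ε hε x
  have : (ε : ℂ) ≠ 0 := by exact_mod_cast hε
  field_simp
  ring

lemma UnifLim.slope_mul (hf : UnifLim f f₀) (hg : UnifLim g g₀)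
    (hf₁ : UnifLim (fun ε x => (f ε x - f₀ x) / ε) f₁)
    (hg₁ : UnifLim (fun ε x => (g ε x - g₀ x) / ε) g₁) :
    UnifLim (fun ε x => (f ε x * g ε x - f₀ x * g₀ x) / ε) fun x => f₁ x * g₀ x + f₀ x * g₁ x := by
  refine ((hf₁.mul hg).add ((unifLim_of_bounded hf.1).mul hg₁)).congr ?_
  filter_upwards [eventually_ne_zero'] with ε hε x
  have : (ε : ℂ) ≠ 0 := by exact_mod_cast hε
  field_simp
  ring

lemma UnifLim.slope_prod {ι : Type*} {s : Finset ι} {f : ι → ℝ → ℝ → ℂ} {f₁ : ι → ℝ → ℂ}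
    (h : ∀ i ∈ s, UnifLim (fun ε x => (f i ε x - 1) / ε) (f₁ i)) :
    UnifLim (fun ε x => (∏ i ∈ s, f i ε x - 1) / ε) fun x => ∑ i ∈ s, f₁ i x := by
  classical
  induction s using Finset.induction_on with
  | empty => simpa using unifLim_const 0
  | insert a s ha ih =>
    have h1 := h a (Finset.mem_insert_self a s)
    have h2 := ih fun i hi => h i (Finset.mem_insert_of_mem hi)
    have h3 := UnifLim.slope_mul (f₀ := fun _ => 1) (g₀ := fun _ => 1)
      (.of_slope ⟨1, by simp⟩ h1) (.of_slope ⟨1, by simp⟩ h2) h1 h2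
    simpa only [Finset.prod_insert ha, Finset.sum_insert ha, one_mul, mul_one] using h3

/-- The first-order Taylor formula with a remainder that is uniform on compact sets. -/
lemma exists_taylor_bound {E : Type*} [NormedAddCommGroup E] [NormedSpace ℝ E] {G : E → ℂ}
    {K : Set E} (hK : IsCompact K) (hG : ∀ a ∈ K, ContDiffAt ℝ 2 G a) :
    ∃ C δ, 0 < δ ∧ ∀ a ∈ K, ∀ v, ‖v‖ ≤ δ → ‖G (a + v) - G a - fderiv ℝ G a v‖ ≤ C * ‖v‖ ^ 2 := by
  have hloc : ∀ a ∈ K, ∃ r, 0 < r ∧ ∃ C : ℝ, 0 ≤ C ∧ ∀ b ∈ Metric.ball a r, ∀ v, ‖v‖ < r →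
      ‖G (b + v) - G b - fderiv ℝ G b v‖ ≤ C * ‖v‖ ^ 2 := fun a ha => by
    have h1 : ContDiffAt ℝ 1 (fderiv ℝ G) a := (hG a ha).fderiv_right (by norm_num)
    obtain ⟨C, t, ht, hL⟩ := h1.exists_lipschitzOnWith
    have hdiff : ∀ᶠ b in 𝓝 a, DifferentiableAt ℝ G b :=
      ((hG a ha).eventually (by simp)).mono fun b hb => hb.differentiableAt (by simp)
    obtain ⟨R, hR, hRt⟩ := Metric.mem_nhds_iff.1 (inter_mem ht hdiff)
    refine ⟨R / 2, half_pos hR, C, C.2, fun b hb v hv => ?_⟩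
    have hsub : ∀ s ∈ Metric.closedBall b ‖v‖, s ∈ Metric.ball a R := fun s hs => by
      rw [Metric.mem_closedBall] at hs
      rw [Metric.mem_ball] at hb ⊢
      linarith [dist_triangle s b a]
    have hder : ∀ s ∈ Metric.closedBall b ‖v‖,
        HasFDerivWithinAt (fun s => G s - fderiv ℝ G b s) (fderiv ℝ G s - fderiv ℝ G b)
          (Metric.closedBall b ‖v‖) s := fun s hs =>
      (((hRt (hsub s hs)).2).hasFDerivAt.sub (fderiv ℝ G b).hasFDerivAt).hasFDerivWithinAt
    have hbb : b ∈ Metric.closedBall b ‖v‖ := Metric.mem_closedBall_self (norm_nonneg v)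
    have h2 := (convex_closedBall b ‖v‖).norm_image_sub_le_of_norm_hasFDerivWithin_le
      (C := C * ‖v‖) hder (fun s hs => by
        refine (hL.norm_sub_le (hRt (hsub s hs)).1 (hRt (hsub b hbb)).1).trans
          (mul_le_mul_of_nonneg_left ?_ C.2)
        rwa [← dist_eq_norm]) hbb (y := b + v) (by simp)
    simp only [map_add, add_sub_cancel_left] at h2
    calc _ = ‖G (b + v) - (fderiv ℝ G b b + fderiv ℝ G b v) - (G b - fderiv ℝ G b b)‖ := by
          congr 1; ring
      _ ≤ _ := h2
      _ = _ := by ring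
  choose! r hr C hC hb using hloc
  obtain ⟨t, htK, htc⟩ := hK.elim_nhds_subcover (fun a => Metric.ball a (r a))
    fun a ha => Metric.ball_mem_nhds a (hr a ha)
  by_cases hne : t.Nonempty
  · obtain ⟨a₀, ha₀, hmin⟩ := t.exists_min_image r hne
    refine ⟨∑ a ∈ t, C a, r a₀ / 2, half_pos (hr a₀ (htK a₀ ha₀)), fun b hbK v hv => ?_⟩
    obtain ⟨a, ha, hba⟩ := Set.mem_iUnion₂.1 (htc hbK)
    refine (hb a (htK a ha) b hba v ?_).trans (mul_le_mul_of_nonneg_right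
      (Finset.single_le_sum (f := C) (fun i hi => hC i (htK i hi)) ha) (by positivity))
    linarith [hmin a ha, hr a₀ (htK a₀ ha₀)]
  · rw [Finset.not_nonempty_iff_eq_empty] at hne
    subst hne
    exact ⟨0, 1, one_pos, fun b hbK => by simpa using htc hbK⟩

/-- Composition of a uniform first-order expansion with an analytic function. -/
lemma UnifLim.slope_comp {G : ℂ → ℂ} {a : ℝ → ℂ} (ha : IsLoop a)
    (hG : ∀ x, AnalyticAt ℂ G (a x)) {v : ℝ → ℝ → ℂ} {v₁ : ℝ → ℂ}
    (hv : UnifLim (fun ε x => v ε x / ε) v₁) :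
    UnifLim (fun ε x => (G (a x + v ε x) - G (a x)) / ε) fun x => deriv G (a x) * v₁ x := by
  obtain ⟨C, δ, hδ, hT⟩ := exists_taylor_bound ha.isCompact_range (G := G) (by
    rintro _ ⟨x, rfl⟩
    exact ((hG x).contDiffAt.restrict_scalars ℝ))
  have hd : ∀ x, ∀ s, fderiv ℝ G (a x) s = deriv G (a x) * s := fun x s => by
    have h1 := ((hG x).differentiableAt.hasDerivAt.hasFDerivAt.restrictScalars ℝ).fderiv
    rw [h1]
    simp [mul_comm]
  have hbd : UnifLim (fun _ x => deriv G (a x)) fun x => deriv G (a x) :=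
    (ha.comp_analytic fun x => (hG x).deriv).unifLim
  have hmain := hbd.mul hv
  obtain ⟨M, hM, hvM⟩ := hv.exists_bound
  have hrem : UnifLim (fun ε x => (G (a x + v ε x) - G (a x) - deriv G (a x) * v ε x) / ε)
      fun _ => 0 := by
    refine ⟨⟨0, by simp⟩, |C| * M ^ 2, ?_⟩
    have h0 : Tendsto (fun ε : ℝ => M * |ε|) (𝓝[≠] 0) (𝓝 0) :=
      ((by fun_prop : Continuous fun ε : ℝ => M * |ε|).tendsto' 0 0 (by simp)).mono_left
        nhdsWithin_le_nhds
    filter_upwards [hvM, h0.eventually_le_const hδ, eventually_ne_zero'] with ε h1 h2 h3 x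
    have hε : 0 < |ε| := abs_pos.2 h3
    have h4 : ‖v ε x‖ ≤ M * |ε| := by
      have := h1 x
      rwa [norm_div, Complex.norm_real, Real.norm_eq_abs, div_le_iff₀ hε] at this
    have h5 := hT (a x) ⟨x, rfl⟩ (v ε x) (h4.trans h2)
    rw [hd] at h5
    rw [sub_zero, norm_div, Complex.norm_real, Real.norm_eq_abs, div_le_iff₀ hε]
    calc _ ≤ C * ‖v ε x‖ ^ 2 := h5
      _ ≤ |C| * (M * |ε|) ^ 2 := mul_le_mul (le_abs_self C)
        (pow_le_pow_left₀ (norm_nonneg _) h4 2) (by positivity) (abs_nonneg C)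
      _ = _ := by ring
  have h := hmain.add hrem
  simp only [add_zero] at h
  refine h.congr (Eventually.of_forall fun ε x => ?_)
  ring

/-- The first-order expansion in `ε` of a smooth function of `(ε, x)` that is periodic in `x`. -/
lemma unifLim_slope_of_periodic {G : ℝ × ℝ → ℂ} (hG : ContDiff ℝ ∞ G)
    (hper : ∀ ε x, G (ε, x + 2 * Real.pi) = G (ε, x)) {G₁ : ℝ → ℂ}
    (hG₁ : ∀ x, HasDerivAt (fun ε => G (ε, x)) (G₁ x) 0) :
    UnifLim (fun ε x => (G (ε, x) - G (0, x)) / ε) G₁ := by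
  have hred : ∀ x, ∃ y ∈ Set.Icc 0 (2 * Real.pi), ∀ ε, G (ε, x) = G (ε, y) := fun x => by
    have hp : Function.Periodic (fun x ε => G (ε, x)) (2 * Real.pi) := fun x =>
      funext fun ε => hper ε x
    obtain ⟨y, hy, hxy⟩ := hp.exists_mem_Ico₀ (by positivity) x
    exact ⟨y, Set.Ico_subset_Icc_self hy, fun ε => congrFun hxy ε⟩
  have hd : ∀ x ε, fderiv ℝ G (0, x) (ε, 0) = ε * G₁ x := fun x ε => by
    have h1 : HasFDerivAt G (fderiv ℝ G (0, x)) (0, x) :=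
      (hG.differentiable (by simp) (0, x)).hasFDerivAt
    have h2 : HasFDerivAt (fun e : ℝ => G (e, x))
        ((fderiv ℝ G (0, x)).comp (.inl ℝ ℝ ℝ)) 0 :=
      HasFDerivAt.comp (g := G) 0 h1 (hasFDerivAt_prodMk_left 0 x)
    have h3 := h2.unique (hG₁ x).hasFDerivAt
    simpa using congrArg (fun L => L ε) h3
  have hK : IsCompact (({0} : Set ℝ) ×ˢ Set.Icc 0 (2 * Real.pi)) :=
    isCompact_singleton.prod isCompact_Icc
  obtain ⟨C, δ, hδ, hT⟩ := exists_taylor_bound hK (G := G) fun a _ =>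
    (contDiff_infty.1 hG 2).contDiffAt
  constructor
  · have hc : Continuous fun x => fderiv ℝ G (0, x) (1, 0) :=
      ((hG.continuous_fderiv (by simp)).comp (by fun_prop)).clm_apply continuous_const
    obtain ⟨B, hB⟩ := (isCompact_Icc (a := (0 : ℝ)) (b := 2 * Real.pi)).exists_bound_of_continuousOn
      hc.continuousOn
    refine ⟨B, fun x => ?_⟩
    obtain ⟨y, hy, hxy⟩ := hred x
    have h1 : G₁ x = G₁ y := by
      have h2 := hG₁ x
      simp only [hxy] at h2
      exact h2.unique (hG₁ y)
    have h3 := hB y hy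
    rw [hd] at h3
    rw [h1]
    simpa using h3
  · refine ⟨C, ?_⟩
    have h0 : ∀ᶠ ε : ℝ in 𝓝[≠] 0, |ε| ≤ δ := by
      filter_upwards [mem_nhdsWithin_of_mem_nhds (Metric.closedBall_mem_nhds (0 : ℝ) hδ)] with ε h
      simpa using h
    filter_upwards [h0, eventually_ne_zero'] with ε h1 h2 x
    obtain ⟨y, hy, hxy⟩ := hred x
    have h3 : G₁ x = G₁ y := by
      have h2 := hG₁ x
      simp only [hxy] at h2
      exact h2.unique (hG₁ y)
    rw [hxy, hxy, h3]
    have hn : ‖((ε, 0) : ℝ × ℝ)‖ = |ε| := by simp [Prod.norm_def]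
    have h4 := hT (0, y) ⟨rfl, hy⟩ (ε, 0) (by rw [hn]; exact h1)
    rw [hd, hn, Prod.mk_add_mk, zero_add, add_zero] at h4
    have hε : 0 < |ε| := abs_pos.2 h2
    have hε' : (ε : ℂ) ≠ 0 := by exact_mod_cast h2
    rw [show (G (ε, y) - G (0, y)) / ε - G₁ y = (G (ε, y) - G (0, y) - ε * G₁ y) / ε by
      field_simp, norm_div, Complex.norm_real, Real.norm_eq_abs, div_le_iff₀ hε]
    calc _ ≤ _ := h4
      _ = _ := by ring

lemma IsLoop.unifLim_slope_shift {f : ℝ → ℂ} (hf : IsLoop f) :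
    UnifLim (fun ε x => (f (x - ε) - f x) / ε) fun x => -_root_.deriv f x := by
  have h := unifLim_slope_of_periodic (G := fun s => f (s.2 - s.1))
    (hf.1.comp (contDiff_snd.sub contDiff_fst)) (fun ε x => by
      rw [show x + 2 * Real.pi - ε = x - ε + 2 * Real.pi by ring]; exact hf.2 _)
    (G₁ := fun x => -_root_.deriv f x) (fun x => by
      have h1 : HasDerivAt f (_root_.deriv f x) (x - 0) := by simpa using hf.hasDerivAt x
      exact h1.comp_const_sub x 0)
  simpa only [sub_zero] using h

lemma IsLoop.unifLim_shift {f : ℝ → ℂ} (hf : IsLoop f) :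
    UnifLim (fun ε x => f (x - ε)) f :=
  .of_slope hf.exists_bound hf.unifLim_slope_shift

lemma UnifLim.shift (hf : UnifLim f f₀) (hf₀ : IsLoop f₀) :
    UnifLim (fun ε x => f ε (x - ε)) f₀ := by
  have h1 : UnifLim (fun ε x => f ε (x - ε) - f₀ (x - ε)) fun _ => 0 := by
    obtain ⟨-, C, hC⟩ := hf
    refine ⟨⟨0, by simp⟩, C, ?_⟩
    filter_upwards [hC] with ε h x
    simpa using h (x - ε)
  have h2 := h1.add hf₀.unifLim_shift
  simpa only [sub_add_cancel, zero_add] using h2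

/-- A nowhere vanishing loop is bounded away from zero. -/
lemma IsLoop.exists_le_norm {f : ℝ → ℂ} (hf : IsLoop f) (h : ∀ x, f x ≠ 0) :
    ∃ c, 0 < c ∧ ∀ x, c ≤ ‖f x‖ := by
  obtain ⟨C, hC⟩ := (hf.inv h).exists_bound
  have hC0 : 0 < C := (norm_pos_iff.2 (inv_ne_zero (h 0))).trans_le (hC 0)
  refine ⟨C⁻¹, inv_pos.2 hC0, fun x => ?_⟩
  have := hC x
  rw [norm_inv] at this
  exact inv_le_of_inv_le₀ (norm_pos_iff.2 (h x)) this

end UnifLim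

/-! ### Entries of tensor products -/

section Entries

variable {N : ℕ}

lemma EE_apply (i j k l a b c d : Fin N) :
    EE i j k l (a, b) (c, d) = if a = i ∧ b = k ∧ c = j ∧ d = l then 1 else 0 := by
  simp only [EE, Matrix.kroneckerMap_apply, Matrix.single_apply]
  grind

lemma in₁_mul_apply (A : Matrix (Fin N) (Fin N) ℂ) (M : Mat₂ N) (i k j l : Fin N) :
    (in₁ A * M) (i, k) (j, l) = ∑ c, A i c * M (c, k) (j, l) := by
  simp [in₁, Matrix.mul_apply, Fintype.sum_prod_type, Matrix.one_apply]

lemma mul_in₁_apply (A : Matrix (Fin N) (Fin N) ℂ) (M : Mat₂ N) (i k j l : Fin N) :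
    (M * in₁ A) (i, k) (j, l) = ∑ c, M (i, k) (c, l) * A c j := by
  simp [in₁, Matrix.mul_apply, Fintype.sum_prod_type, Matrix.one_apply]

lemma in₂_mul_apply (A : Matrix (Fin N) (Fin N) ℂ) (M : Mat₂ N) (i k j l : Fin N) :
    (in₂ A * M) (i, k) (j, l) = ∑ c, A k c * M (i, c) (j, l) := by
  simp [in₂, Matrix.mul_apply, Fintype.sum_prod_type, Matrix.one_apply]

lemma mul_in₂_apply (A : Matrix (Fin N) (Fin N) ℂ) (M : Mat₂ N) (i k j l : Fin N) :
    (M * in₂ A) (i, k) (j, l) = ∑ c, M (i, k) (j, c) * A c l := by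
  simp [in₂, Matrix.mul_apply, Fintype.sum_prod_type, Matrix.one_apply]

lemma in₁_mul_in₂ (A B : Matrix (Fin N) (Fin N) ℂ) : in₁ A * in₂ B = in₂ B * in₁ A := by
  rw [in₁, in₂, ← Matrix.mul_kronecker_mul, ← Matrix.mul_kronecker_mul, Matrix.one_mul,
    Matrix.mul_one, Matrix.one_mul, Matrix.mul_one]

lemma in₁_mul_inv {A : Matrix (Fin N) (Fin N) ℂ} (h : A.det ≠ 0) : in₁ A * in₁ A⁻¹ = 1 := by
  rw [in₁, in₁, ← Matrix.mul_kronecker_mul, Matrix.mul_nonsing_inv _ (isUnit_iff_ne_zero.2 h),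
    Matrix.one_mul, Matrix.one_kronecker_one]

lemma in₂_mul_inv {A : Matrix (Fin N) (Fin N) ℂ} (h : A.det ≠ 0) : in₂ A * in₂ A⁻¹ = 1 := by
  rw [in₂, in₂, ← Matrix.mul_kronecker_mul, Matrix.mul_nonsing_inv _ (isUnit_iff_ne_zero.2 h),
    Matrix.one_mul, Matrix.one_kronecker_one]

/-- Double sums over matrix units of diagonal type `E_ii ⊗ E_jj`. -/
lemma sum_EE_diag_apply (c : Fin N → Fin N → ℂ) (i k j l : Fin N) :
    (∑ a, ∑ b, c a b • EE a a b b) (i, k) (j, l) = if i = j ∧ k = l then c i k else 0 := by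
  simp only [Matrix.sum_apply, Matrix.smul_apply, EE_apply, smul_eq_mul]
  rw [Finset.sum_eq_single i, Finset.sum_eq_single k]
  · by_cases h : i = j ∧ k = l
    · simp [h.1, h.2]
    · rw [if_neg h, if_neg (by rintro ⟨-, -, h1, h2⟩; exact h ⟨h1.symm, h2.symm⟩), mul_zero]
  · intro b _ hb
    rw [if_neg (by rintro ⟨-, h1, -⟩; exact hb h1.symm), mul_zero]
  · simp
  · intro a _ ha
    exact Finset.sum_eq_zero fun b _ => by
      rw [if_neg (by rintro ⟨h1, -⟩; exact ha h1.symm), mul_zero]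
  · simp

/-- Double sums over matrix units, restricted to different indices. -/
lemma sum_erase_smul_apply (c : Fin N → Fin N → ℂ) (M : Fin N → Fin N → Mat₂ N)
    (s t : Fin N × Fin N) :
    (∑ a, ∑ b ∈ Finset.univ.erase a, c a b • M a b) s t =
      ∑ a, ∑ b, if a = b then 0 else c a b * M a b s t := by
  simp only [Matrix.sum_apply, Matrix.smul_apply, smul_eq_mul]
  refine Finset.sum_congr rfl fun a _ => ?_
  rw [← Finset.filter_ne Finset.univ a, Finset.sum_filter]
  exact Finset.sum_congr rfl fun b _ => by by_cases h : a = b <;> simp [h]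

/-- Collapses a double sum over matrix units to the only term that contributes. -/
lemma sum_sum_eq_apply {F : Fin N → Fin N → ℂ} (i k : Fin N)
    (h : ∀ a b, ¬(a = i ∧ b = k) → F a b = 0) : ∑ a, ∑ b, F a b = F i k := by
  rw [Finset.sum_eq_single i, Finset.sum_eq_single k]
  · exact fun b _ hb => h i b fun h' => hb h'.2
  · simp
  · exact fun a _ ha => Finset.sum_eq_zero fun b _ => h a b fun h' => ha h'.1
  · simp

lemma sum_erase_EE_diag_apply (c : Fin N → Fin N → ℂ) (i k j l : Fin N) :
    (∑ a, ∑ b ∈ Finset.univ.erase a, c a b • EE a a b b) (i, k) (j, l) =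
      if i = j ∧ k = l ∧ i ≠ k then c i k else 0 := by
  rw [sum_erase_smul_apply, sum_sum_eq_apply i k]
  · simp only [EE_apply]
    grind
  · intro a b h
    simp only [EE_apply]
    grind

lemma sum_erase_EE_swap_apply (c : Fin N → Fin N → ℂ) (i k j l : Fin N) :
    (∑ a, ∑ b ∈ Finset.univ.erase a, c a b • EE a b b a) (i, k) (j, l) =
      if i = l ∧ k = j ∧ i ≠ k then c i k else 0 := by
  rw [sum_erase_smul_apply, sum_sum_eq_apply i k]
  · simp only [EE_apply]
    grind
  · intro a b h
    simp only [EE_apply]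
    grind

lemma sum_erase_EE_col_apply (c : Fin N → Fin N → ℂ) (i k j l : Fin N) :
    (∑ a, ∑ b ∈ Finset.univ.erase a, c a b • EE a a b a) (i, k) (j, l) =
      if i = j ∧ i = l ∧ i ≠ k then c i k else 0 := by
  rw [sum_erase_smul_apply, sum_sum_eq_apply i k]
  · simp only [EE_apply]
    grind
  · intro a b h
    simp only [EE_apply]
    grind

lemma sum_EE_apply (i k j l : Fin N) :
    (∑ a : Fin N, EE a a a a) (i, k) (j, l) = if i = k ∧ i = j ∧ i = l then 1 else 0 := by
  simp only [Matrix.sum_apply, EE_apply]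
  rw [Finset.sum_eq_single i]
  · grind
  · intro b _ hb
    rw [if_neg (by rintro ⟨h1, -⟩; exact hb h1.symm)]
  · simp

end Entries

/-! ### The local identities of the Ruijsenaars-Schneider structure -/

section RSAlgebra

variable {N : ℕ} {τ ν : ℂ} {ε : ℝ} {q p : Fin N → ℝ → ℂ} {z w : ℂ} {x : ℝ}

/-- The partial derivative of `U_kl(z,x)` with respect to `q_a(x - ε)`. -/
def partialShifted (τ ν : ℂ) (ε : ℝ) (q p : Fin N → ℝ → ℂ) (z : ℂ) (x : ℝ) (a k l : Fin N) : ℂ :=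
  (if a = k then dURS τ ν ε q p z x k l else 0)
    + URS τ ν ε q p z x k l * E1 τ (shiftArg ν ε q x a l)

/-- The partial derivative of `U_kl(z,x)` with respect to `q_a(x)`. -/
def partialLocal (τ ν : ℂ) (ε : ℝ) (q p : Fin N → ℝ → ℂ) (z : ℂ) (x : ℝ) (a k l : Fin N) : ℂ :=
  if a = l then -dURS τ ν ε q p z x k l + URS τ ν ε q p z x k l *
    (-(∑ b, E1 τ (shiftArg ν ε q x b l)) - ∑ b ∈ Finset.univ.erase l, E1 τ (q l x - q b x))
  else URS τ ν ε q p z x k l * E1 τ (q l x - q a x)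

lemma in₁_mul_sPlus_apply (h : (URS τ ν ε q p z x).det ≠ 0) (i k j l : Fin N) :
    (in₁ (URS τ ν ε q p z x) * sPlus τ ν ε q p z x) (i, k) (j, l) =
      if k = l then partialShifted τ ν ε q p z x l i j else 0 := by
  rw [sPlus, mul_add, s12, ← mul_assoc, in₁_mul_inv h, one_mul, Matrix.add_apply, in₁_mul_apply]
  have h1 : (∑ a, ∑ b, dURS τ ν ε q p z x a b • EE a b a a) (i, k) (j, l) =
      if k = l ∧ l = i then dURS τ ν ε q p z x i j else 0 := by
    simp only [Matrix.sum_apply, Matrix.smul_apply, smul_eq_mul]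
    rw [sum_sum_eq_apply i j]
    · simp only [EE_apply]
      grind
    · intro a b hab
      rw [EE_apply, if_neg (by grind), mul_zero]
  rw [h1, uPlus]
  simp only [sum_EE_diag_apply]
  rw [Finset.sum_eq_single j (by intro b _ hb; simp [hb]) (by simp), partialShifted]
  split_ifs <;> simp_all

lemma in₂_mul_sMinus_apply (h : (URS τ ν ε q p w x).det ≠ 0) (i k j l : Fin N) :
    (in₂ (URS τ ν ε q p w x) * sMinus τ ν ε q p w x) (i, k) (j, l) =
      if i = j then partialShifted τ ν ε q p w x i k l else 0 := by
  rw [sMinus, mul_add, s21, ← mul_assoc, in₂_mul_inv h, one_mul, Matrix.add_apply, in₂_mul_apply]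
  have h1 : (∑ a, ∑ b, dURS τ ν ε q p w x a b • EE a a a b) (i, k) (j, l) =
      if i = j ∧ i = k then dURS τ ν ε q p w x k l else 0 := by
    simp only [Matrix.sum_apply, Matrix.smul_apply, smul_eq_mul]
    rw [sum_sum_eq_apply i l]
    · simp only [EE_apply]
      grind
    · intro a b hab
      rw [EE_apply, if_neg (by grind), mul_zero]
  rw [h1, uMinus]
  simp only [sum_EE_diag_apply]
  rw [Finset.sum_eq_single l (by intro b _ hb; simp [hb]) (by simp), partialShifted]
  split_ifs <;> simp_all

lemma mul_sPlus_apply {B : Matrix (Fin N) (Fin N) ℂ} (h : (URS τ ν ε q p z x).det ≠ 0)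
    (i k j l : Fin N) :
    (in₁ (URS τ ν ε q p z x) * in₂ B * sPlus τ ν ε q p z x) (i, k) (j, l) =
      B k l * partialShifted τ ν ε q p z x l i j := by
  rw [in₁_mul_in₂, mul_assoc, in₂_mul_apply]
  simp only [in₁_mul_sPlus_apply h]
  rw [Finset.sum_eq_single l (by intro b _ hb; simp [hb]) (by simp), if_pos rfl]

lemma mul_sMinus_apply {A : Matrix (Fin N) (Fin N) ℂ} (h : (URS τ ν ε q p w x).det ≠ 0)
    (i k j l : Fin N) :
    (in₁ A * in₂ (URS τ ν ε q p w x) * sMinus τ ν ε q p w x) (i, k) (j, l) =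
      A i j * partialShifted τ ν ε q p w x j k l := by
  rw [mul_assoc, in₁_mul_apply]
  simp only [in₂_mul_sMinus_apply h]
  rw [Finset.sum_eq_single j (by intro b _ hb; simp [hb]) (by simp), if_pos rfl]

lemma rRS_apply (u : ℂ) (i k j l : Fin N) :
    rRS τ q u x (i, k) (j, l) =
      (if i = l ∧ k = j ∧ i ≠ k then kronecker τ u (q i x - q k x) else 0)
        + (if i = k ∧ i = j ∧ i = l then E1 τ u else 0)
        - (if i = j ∧ k = l ∧ i ≠ k then E1 τ (q i x - q k x) else 0) := by
  rw [rRS, Matrix.sub_apply, Matrix.add_apply, sum_erase_EE_swap_apply, sum_erase_EE_diag_apply,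
    Matrix.smul_apply, sum_EE_apply]
  simp

lemma mul_rRS_apply (A B : Matrix (Fin N) (Fin N) ℂ) (u : ℂ) (i k j l : Fin N) :
    (in₁ A * in₂ B * rRS τ q u x) (i, k) (j, l) =
      if j = l then A i j * B k l * E1 τ u else
        A i l * B k j * kronecker τ u (q l x - q j x) - A i j * B k l * E1 τ (q j x - q l x) := by
  rw [mul_assoc, in₁_mul_apply]
  simp only [in₂_mul_apply, Finset.mul_sum]
  by_cases h : j = l
  · subst h
    rw [sum_sum_eq_apply j j]
    · simp [rRS_apply, mul_assoc]
    · intro a b hab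
      rw [rRS_apply]
      grind
  · have hsplit : ∀ a b, A i a * (B k b * rRS τ q u x (a, b) (j, l)) =
        (if a = l ∧ b = j then A i l * B k j * kronecker τ u (q l x - q j x) else 0)
          - if a = j ∧ b = l then A i j * B k l * E1 τ (q j x - q l x) else 0 := fun a b => by
      rw [rRS_apply]
      grind
    simp only [hsplit, Finset.sum_sub_distrib]
    rw [sum_sum_eq_apply l j fun a b hab => if_neg hab,
      sum_sum_eq_apply j l fun a b hab => if_neg hab, if_neg h]
    simp

lemma rRS_mul_apply (A B : Matrix (Fin N) (Fin N) ℂ) (u : ℂ) (i k j l : Fin N) :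
    (rRS τ q u x * in₁ A * in₂ B) (i, k) (j, l) =
      if i = k then E1 τ u * A i j * B k l else
        kronecker τ u (q i x - q k x) * A k j * B i l - E1 τ (q i x - q k x) * A i j * B k l := by
  rw [mul_in₂_apply]
  simp only [mul_in₁_apply, Finset.sum_mul]
  by_cases h : i = k
  · subst h
    rw [sum_sum_eq_apply i i]
    · simp [rRS_apply]
    · intro a b hab
      rw [rRS_apply]
      grind
  · have hsplit : ∀ a b, rRS τ q u x (i, k) (b, a) * A b j * B a l =
        (if a = i ∧ b = k then kronecker τ u (q i x - q k x) * A k j * B i l else 0)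
          - if a = k ∧ b = i then E1 τ (q i x - q k x) * A i j * B k l else 0 := fun a b => by
      rw [rRS_apply]
      grind
    simp only [hsplit, Finset.sum_sub_distrib]
    rw [sum_sum_eq_apply i k fun a b hab => if_neg hab,
      sum_sum_eq_apply k i fun a b hab => if_neg hab, if_neg h]
    simp

/-- The exchange relations of `U`: the coefficient of `-ε δ(x - y)` of the Ruijsenaars-Schneider
structure is the contribution of the derivatives with respect to the unshifted fields. -/
lemma exchange_apply (hτ : 0 < τ.im) (hz : theta τ z ≠ 0) (hw : theta τ w ≠ 0)
    (hzw : theta τ (z - w) ≠ 0) (hqq : ∀ i j, i ≠ j → ∀ x, theta τ (q i x - q j x) ≠ 0)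
    (hu : ∀ x i j, theta τ (shiftArg ν ε q x i j) ≠ 0)
    (hdz : (URS τ ν ε q p z x).det ≠ 0) (hdw : (URS τ ν ε q p w x).det ≠ 0) (i k j l : Fin N) :
    (in₁ (URS τ ν ε q p z x) * in₂ (URS τ ν ε q p w x) * rRS τ q (z - w) x
        - rRS τ q (z - w) (x - ε) * in₁ (URS τ ν ε q p z x) * in₂ (URS τ ν ε q p w x)
        + in₁ (URS τ ν ε q p z x) * sPlus τ ν ε q p z x * in₂ (URS τ ν ε q p w x)
        - in₂ (URS τ ν ε q p w x) * sMinus τ ν ε q p w x * in₁ (URS τ ν ε q p z x)) (i, k) (j, l) =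
      URS τ ν ε q p z x i j * partialLocal τ ν ε q p w x j k l
        - URS τ ν ε q p w x k l * partialLocal τ ν ε q p z x l i j := by
  have e1 : (in₁ (URS τ ν ε q p z x) * sPlus τ ν ε q p z x * in₂ (URS τ ν ε q p w x))
      (i, k) (j, l) = partialShifted τ ν ε q p z x k i j * URS τ ν ε q p w x k l := by
    rw [mul_in₂_apply]
    simp only [in₁_mul_sPlus_apply hdz]
    rw [Finset.sum_eq_single k (by intro b _ hb; simp [hb.symm]) (by simp), if_pos rfl]
  have e2 : (in₂ (URS τ ν ε q p w x) * sMinus τ ν ε q p w x * in₁ (URS τ ν ε q p z x))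
      (i, k) (j, l) = partialShifted τ ν ε q p w x i k l * URS τ ν ε q p z x i j := by
    rw [mul_in₁_apply]
    simp only [in₂_mul_sMinus_apply hdw]
    rw [Finset.sum_eq_single i (by intro b _ hb; simp [hb.symm]) (by simp), if_pos rfl]
  rw [Matrix.sub_apply, Matrix.add_apply, Matrix.sub_apply, mul_rRS_apply, rRS_mul_apply, e1, e2]
  simp only [partialShifted, partialLocal]
  have hU : ∀ s a b, URS τ ν ε q p s x a b =
    kronecker τ s (shiftArg ν ε q x a b) * factorRS τ ν ε q p x b := fun _ _ _ => rfl
  have hdU : ∀ s a b, dURS τ ν ε q p s x a b =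
    kroneckerD τ s (shiftArg ν ε q x a b) * factorRS τ ν ε q p x b := fun _ _ _ => rfl
  by_cases hik : i = k
  · subst hik
    by_cases hjl : j = l
    · subst hjl
      simp only [if_true, hU, hdU]
      ring
    · have hd : theta τ (q l x - q j x) ≠ 0 := hqq l j (Ne.symm hjl) x
      have e : shiftArg ν ε q x i j = shiftArg ν ε q x i l + (q l x - q j x) := by
        simp only [shiftArg]; ring
      have h := kronecker_exchange_deriv hτ hz hw hzw (e ▸ hu x i j) (hu x i l) hd
      rw [← e] at h
      simp only [if_true, if_neg hjl, if_neg (Ne.symm hjl), hU, hdU, E1_sub_comm hτ (q j x)]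
      linear_combination factorRS τ ν ε q p x j * factorRS τ ν ε q p x l * h
  · by_cases hjl : j = l
    · subst hjl
      have hd : theta τ (q i (x - ε) - q k (x - ε)) ≠ 0 := hqq i k hik (x - ε)
      have e : shiftArg ν ε q x i j = shiftArg ν ε q x k j + (q i (x - ε) - q k (x - ε)) := by
        simp only [shiftArg]; ring
      have h := kronecker_exchange_deriv hτ hz hw hzw (e ▸ hu x i j) (hu x k j) hd
      rw [← e] at h
      simp only [if_true, if_neg hik, if_neg (Ne.symm hik), hU, hdU]
      linear_combination -factorRS τ ν ε q p x j * factorRS τ ν ε q p x j * h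
    · have hd : theta τ (q i (x - ε) - q k (x - ε)) ≠ 0 := hqq i k hik (x - ε)
      have hd' : theta τ (q j x - q l x) ≠ 0 := hqq j l hjl x
      have e : shiftArg ν ε q x i l =
          (q j x - q l x) + (q i (x - ε) - q k (x - ε)) + shiftArg ν ε q x k j := by
        simp only [shiftArg]; ring
      have e' : shiftArg ν ε q x i j =
          (q i (x - ε) - q k (x - ε)) + shiftArg ν ε q x k j := by
        simp only [shiftArg]; ring
      have e'' : shiftArg ν ε q x k l = shiftArg ν ε q x k j + (q j x - q l x) := by
        simp only [shiftArg]; ring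
      have h := kronecker_exchange hτ hz hw hzw hd' hd (hu x k j) (e ▸ hu x i l) (e' ▸ hu x i j)
        (e'' ▸ hu x k l)
      rw [← e, ← e', ← e'', neg_sub] at h
      simp only [if_neg hjl, if_neg (Ne.symm hjl), if_neg hik, if_neg (Ne.symm hik), hU,
        E1_sub_comm hτ (q l x)]
      linear_combination factorRS τ ν ε q p x j * factorRS τ ν ε q p x l * h

/-- The total derivative of `U_kl(z,x)` along `q_a`. -/
def partialTotal (τ ν : ℂ) (ε : ℝ) (q p : Fin N → ℝ → ℂ) (z : ℂ) (x : ℝ) (a k l : Fin N) : ℂ :=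
  partialLocal τ ν ε q p z x a k l + partialShifted τ ν ε q p z x a k l

lemma localRS_apply (hτ : 0 < τ.im) (hz : theta τ z ≠ 0) (hw : theta τ w ≠ 0)
    (hzw : theta τ (z - w) ≠ 0) (hqq : ∀ i j, i ≠ j → ∀ x, theta τ (q i x - q j x) ≠ 0)
    (hu : ∀ x i j, theta τ (shiftArg ν ε q x i j) ≠ 0)
    (hdz : (URS τ ν ε q p z x).det ≠ 0) (hdw : (URS τ ν ε q p w x).det ≠ 0) (i k j l : Fin N) :
    localRS τ ν ε q p z w x (i, k) (j, l) =
      URS τ ν ε q p z x i j * partialTotal τ ν ε q p w x j k l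
        - URS τ ν ε q p w x k l * partialTotal τ ν ε q p z x l i j := by
  have h1 := exchange_apply (p := p) hτ hz hw hzw hqq hu hdz hdw i k j l
  have h2 := mul_sMinus_apply (A := URS τ ν ε q p z x) hdw i k j l
  have h3 := mul_sPlus_apply (B := URS τ ν ε q p w x) hdz i k j l
  rw [in₁_mul_in₂] at h3
  simp only [localRS, comm, ← mul_assoc, partialTotal, Matrix.add_apply, Matrix.sub_apply]
    at h1 h2 h3 ⊢
  linear_combination h1 + h2 - h3

end RSAlgebra

/-! ### The Poisson brackets of the Ruijsenaars-Schneider field theory -/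

section RSBracket

variable {N : ℕ} {τ ν : ℂ} {ε : ℝ} {q p : Fin N → ℝ → ℂ} {z w : ℂ}

/-- Nondegeneracy of the Ruijsenaars-Schneider matrix at the step `ε`: all denominators are nonzero
and the matrix is invertible. -/
structure IsRegularStep (τ ν : ℂ) (ε : ℝ) (q p : Fin N → ℝ → ℂ) (z w : ℂ) : Prop where
  theta_step : theta τ (ν * ε) ≠ 0
  theta_shiftArg : ∀ x i j, theta τ (shiftArg ν ε q x i j) ≠ 0
  det_left : ∀ x, (URS τ ν ε q p z x).det ≠ 0
  det_right : ∀ x, (URS τ ν ε q p w x).det ≠ 0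

lemma factorRS_eq (x : ℝ) (j : Fin N) :
    factorRS τ ν ε q p x j = (∏ a, theta τ (-shiftArg ν ε q x a j)) /
      (theta τ (ν * ε) * ∏ a ∈ Finset.univ.erase j, theta τ (q j x - q a x)) *
      cexp (-ε * p j x) := by
  have h : ∀ a, q j x - q a (x - ε) + ν * ε = -shiftArg ν ε q x a j := fun a => by
    rw [shiftArg]; ring
  simp only [factorRS, h]

lemma isLoop_shiftArg (hq : ∀ i, IsLoop (q i)) (i j : Fin N) :
    IsLoop fun x => shiftArg ν ε q x i j :=
  (((hq i).shift_sub ε).sub (hq j)).sub (isLoop_const _)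

lemma isLoop_factorRS (hτ : 0 < τ.im) (hq : ∀ i, IsLoop (q i)) (hp : ∀ i, IsLoop (p i))
    (hqq : ∀ i j, i ≠ j → ∀ x, theta τ (q i x - q j x) ≠ 0) (hε : theta τ (ν * ε) ≠ 0)
    (j : Fin N) : IsLoop fun x => factorRS τ ν ε q p x j := by
  simp only [factorRS_eq]
  refine IsLoop.mul (IsLoop.div ?_ ?_ fun x => ?_) ?_
  · exact .prod fun a _ => (isLoop_shiftArg hq a j).neg.comp_analytic fun x => analyticAt_theta hτ _
  · exact (isLoop_const _).mul
      (.prod fun a _ => ((hq j).sub (hq a)).comp_analytic fun x => analyticAt_theta hτ _)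
  · exact mul_ne_zero hε (Finset.prod_ne_zero_iff.2 fun a ha =>
      hqq j a (Finset.ne_of_mem_erase ha).symm x)
  · exact ((isLoop_const _).mul (hp j)).cexp

lemma isLoop_URS (hτ : 0 < τ.im) (hq : ∀ i, IsLoop (q i)) (hp : ∀ i, IsLoop (p i))
    (hqq : ∀ i j, i ≠ j → ∀ x, theta τ (q i x - q j x) ≠ 0) (hε : theta τ (ν * ε) ≠ 0)
    (hu : ∀ x i j, theta τ (shiftArg ν ε q x i j) ≠ 0) (hz : theta τ z ≠ 0) (i j : Fin N) :
    IsLoop fun x => URS τ ν ε q p z x i j :=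
  ((isLoop_shiftArg hq i j).comp_analytic (G := fun v => kronecker τ z v) fun x =>
    analyticAt_kronecker hτ hz (hu x i j)).mul (isLoop_factorRS hτ hq hp hqq hε j)

lemma isLoop_dURS (hτ : 0 < τ.im) (hq : ∀ i, IsLoop (q i)) (hp : ∀ i, IsLoop (p i))
    (hqq : ∀ i j, i ≠ j → ∀ x, theta τ (q i x - q j x) ≠ 0) (hε : theta τ (ν * ε) ≠ 0)
    (hu : ∀ x i j, theta τ (shiftArg ν ε q x i j) ≠ 0) (hz : theta τ z ≠ 0) (i j : Fin N) :
    IsLoop fun x => dURS τ ν ε q p z x i j :=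
  ((isLoop_shiftArg hq i j).comp_analytic (G := fun v => kroneckerD τ z v) fun x =>
    analyticAt_kroneckerD hτ hz (hu x i j)).mul (isLoop_factorRS hτ hq hp hqq hε j)

lemma isLoop_E1_shiftArg (hτ : 0 < τ.im) (hq : ∀ i, IsLoop (q i))
    (hu : ∀ x i j, theta τ (shiftArg ν ε q x i j) ≠ 0) (i j : Fin N) :
    IsLoop fun x => E1 τ (shiftArg ν ε q x i j) :=
  (isLoop_shiftArg hq i j).comp_analytic fun x => analyticAt_E1 hτ (hu x i j)

lemma isLoop_E1_sub (hτ : 0 < τ.im) (hq : ∀ i, IsLoop (q i))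
    (hqq : ∀ i j, i ≠ j → ∀ x, theta τ (q i x - q j x) ≠ 0) {i j : Fin N} (hij : i ≠ j) :
    IsLoop fun x => E1 τ (q i x - q j x) :=
  ((hq i).sub (hq j)).comp_analytic fun x => analyticAt_E1 hτ (hqq i j hij x)

lemma isLoop_partialShifted (hτ : 0 < τ.im) (hq : ∀ i, IsLoop (q i)) (hp : ∀ i, IsLoop (p i))
    (hqq : ∀ i j, i ≠ j → ∀ x, theta τ (q i x - q j x) ≠ 0) (hε : theta τ (ν * ε) ≠ 0)
    (hu : ∀ x i j, theta τ (shiftArg ν ε q x i j) ≠ 0) (hz : theta τ z ≠ 0) (a i j : Fin N) :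
    IsLoop fun x => partialShifted τ ν ε q p z x a i j := by
  refine IsLoop.add ?_
    ((isLoop_URS hτ hq hp hqq hε hu hz i j).mul (isLoop_E1_shiftArg hτ hq hu a j))
  by_cases h : a = i
  · simpa only [if_pos h] using isLoop_dURS hτ hq hp hqq hε hu hz i j
  · simpa only [if_neg h] using isLoop_const 0

lemma isLoop_partialLocal (hτ : 0 < τ.im) (hq : ∀ i, IsLoop (q i)) (hp : ∀ i, IsLoop (p i))
    (hqq : ∀ i j, i ≠ j → ∀ x, theta τ (q i x - q j x) ≠ 0) (hε : theta τ (ν * ε) ≠ 0)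
    (hu : ∀ x i j, theta τ (shiftArg ν ε q x i j) ≠ 0) (hz : theta τ z ≠ 0) (a i j : Fin N) :
    IsLoop fun x => partialLocal τ ν ε q p z x a i j := by
  have hU := isLoop_URS hτ hq hp hqq hε hu hz i j
  by_cases h : a = j
  · simp only [partialLocal, if_pos h]
    exact (isLoop_dURS hτ hq hp hqq hε hu hz i j).neg.add (hU.mul
      ((IsLoop.sum fun b _ => isLoop_E1_shiftArg hτ hq hu b j).neg.sub
        (.sum fun b hb => isLoop_E1_sub hτ hq hqq (Finset.ne_of_mem_erase hb).symm)))
  · simp only [partialLocal, if_neg h]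
    exact hU.mul (isLoop_E1_sub hτ hq hqq (Ne.symm h))

/-- The logarithmic derivative of a product of theta functions along a line. -/
lemma hasDerivAt_prod_theta (hτ : 0 < τ.im) {ι : Type*} (s : Finset ι) (v d : ι → ℂ)
    (h : ∀ a ∈ s, theta τ (v a) ≠ 0) :
    HasDerivAt (fun t : ℂ => ∏ a ∈ s, theta τ (v a + t * d a))
      ((∏ a ∈ s, theta τ (v a)) * ∑ a ∈ s, E1 τ (v a) * d a) 0 := by
  classical
  induction s using Finset.induction_on with
  | empty => simpa using hasDerivAt_const (0 : ℂ) (1 : ℂ)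
  | insert b s hb ih =>
    have hline : HasDerivAt (fun t : ℂ => v b + t * d b) (d b) 0 := by
      simpa using ((hasDerivAt_id (0 : ℂ)).mul_const (d b)).const_add (v b)
    have h1 : HasDerivAt (fun t : ℂ => theta τ (v b + t * d b)) (deriv (theta τ) (v b) * d b) 0 :=
      HasDerivAt.comp (h₂ := theta τ) 0 (by simpa using hasDerivAt_theta hτ (v b)) hline
    have h2 := h1.fun_mul (ih fun a ha => h a (Finset.mem_insert_of_mem ha))
    simp only [Finset.prod_insert hb, Finset.sum_insert hb]
    refine h2.congr_deriv ?_
    have hb0 := h b (Finset.mem_insert_self b s)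
    simp only [zero_mul, add_zero, E1]
    field_simp

lemma contDiffAt_theta_comp (hτ : 0 < τ.im) {E : Type*} [NormedAddCommGroup E] [NormedSpace ℝ E]
    {f : E → ℂ} {s : E} (hf : ContDiffAt ℝ 1 f s) : ContDiffAt ℝ 1 (fun s => theta τ (f s)) s :=
  ((analyticAt_theta hτ (f s)).contDiffAt.restrict_scalars ℝ).comp s hf

lemma contDiffAt_fun_div {E : Type*} [NormedAddCommGroup E] [NormedSpace ℝ E]
    {f g : E → ℂ} {s : E} (hf : ContDiffAt ℝ 1 f s) (hg : ContDiffAt ℝ 1 g s) (h : g s ≠ 0) :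
    ContDiffAt ℝ 1 (fun s => f s / g s) s := by
  exact (hf.mul (hg.inv h)).congr_of_eventuallyEq (.of_forall fun s => div_eq_mul_inv _ _)

/-- Variations of loops are smooth jointly in the point and the parameter of the variation. -/
lemma contDiffAt_variation {f h : ℝ → ℂ} (hf : IsLoop f) (hh : IsLoop h) (c : ℝ) (s : ℂ × ℝ) :
    ContDiffAt ℝ 1 (fun s : ℂ × ℝ => f (s.2 - c) + s.1 * h (s.2 - c)) s := by
  have h1 : ∀ {f : ℝ → ℂ}, IsLoop f → ContDiff ℝ 1 f := fun hf => contDiff_infty.1 hf.1 1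
  have h2 : ContDiff ℝ 1 fun s : ℂ × ℝ => s.2 - c := contDiff_snd.sub contDiff_const
  exact (((h1 hf).comp h2).add (contDiff_fst.mul ((h1 hh).comp h2))).contDiffAt

lemma contDiffAt_variation' {f h : ℝ → ℂ} (hf : IsLoop f) (hh : IsLoop h) (s : ℂ × ℝ) :
    ContDiffAt ℝ 1 (fun s : ℂ × ℝ => f s.2 + s.1 * h s.2) s := by
  simpa using contDiffAt_variation hf hh 0 s

lemma contDiffAt_URS_variation (hτ : 0 < τ.im) (hq : ∀ i, IsLoop (q i)) (hp : ∀ i, IsLoop (p i))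
    (hqq : ∀ i j, i ≠ j → ∀ x, theta τ (q i x - q j x) ≠ 0) (hε : theta τ (ν * ε) ≠ 0)
    (hu : ∀ x i j, theta τ (shiftArg ν ε q x i j) ≠ 0) (hz : theta τ z ≠ 0)
    {h k : Fin N → ℝ → ℂ} (hh : ∀ i, IsLoop (h i)) (hk : ∀ i, IsLoop (k i)) (i j : Fin N) (x : ℝ) :
    ContDiffAt ℝ 1 (fun s : ℂ × ℝ => URS τ ν ε (fun a x => q a x + s.1 * h a x)
      (fun a x => p a x + s.1 * k a x) z s.2 i j) (0, x) := by
  have hs : ∀ a b, ContDiffAt ℝ 1 (fun s : ℂ × ℝ =>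
      shiftArg ν ε (fun a x => q a x + s.1 * h a x) s.2 a b) (0, x) := fun a b =>
    ((contDiffAt_variation (hq a) (hh a) ε _).sub (contDiffAt_variation' (hq b) (hh b) _)).sub
      contDiffAt_const
  have hs0 : ∀ a b, shiftArg ν ε (fun a x => q a x + 0 * h a x) x a b = shiftArg ν ε q x a b :=
    fun a b => by simp [shiftArg]
  simp only [URS, Matrix.of_apply, factorRS_eq, kronecker]
  refine ContDiffAt.mul (contDiffAt_fun_div ?_ ?_ ?_)
    (ContDiffAt.mul (contDiffAt_fun_div ?_ ?_ ?_) ?_)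
  · exact contDiffAt_const.mul (contDiffAt_theta_comp hτ (contDiffAt_const.add (hs i j)))
  · exact contDiffAt_const.mul (contDiffAt_theta_comp hτ (hs i j))
  · rw [hs0]
    exact mul_ne_zero hz (hu x i j)
  · exact contDiffAt_prod fun a _ => contDiffAt_theta_comp hτ (hs a j).neg
  · exact contDiffAt_const.mul (contDiffAt_prod fun a _ => contDiffAt_theta_comp hτ
      ((contDiffAt_variation' (hq j) (hh j) _).sub (contDiffAt_variation' (hq a) (hh a) _)))
  · refine mul_ne_zero hε (Finset.prod_ne_zero_iff.2 fun a ha => ?_)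
    simpa using hqq j a (Finset.ne_of_mem_erase ha).symm x
  · exact (contDiffAt_const.mul (contDiffAt_variation' (hp j) (hk j) _)).cexp

lemma hasDerivAt_URS_variation (hτ : 0 < τ.im)
    (hqq : ∀ i j, i ≠ j → ∀ x, theta τ (q i x - q j x) ≠ 0) (hε : theta τ (ν * ε) ≠ 0)
    (hu : ∀ x i j, theta τ (shiftArg ν ε q x i j) ≠ 0) (hz : theta τ z ≠ 0)
    (h k : Fin N → ℝ → ℂ) (i j : Fin N) (x : ℝ) :
    HasDerivAt (fun t : ℂ => URS τ ν ε (fun a x => q a x + t * h a x)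
      (fun a x => p a x + t * k a x) z x i j)
      (∑ a, (partialLocal τ ν ε q p z x a i j * h a x + 0 * deriv (h a) x
        + 0 * deriv (deriv (h a)) x + partialShifted τ ν ε q p z x a i j * h a (x - ε)
        + (if a = j then -ε * URS τ ν ε q p z x i j else 0) * k a x)) 0 := by
  have hsum : ∑ a, (partialLocal τ ν ε q p z x a i j * h a x
        + partialShifted τ ν ε q p z x a i j * h a (x - ε)
        + (if a = j then -ε * URS τ ν ε q p z x i j else 0) * k a x) =
      dURS τ ν ε q p z x i j * (h i (x - ε) - h j x) + URS τ ν ε q p z x i j *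
        (∑ a, E1 τ (-shiftArg ν ε q x a j) * (h j x - h a (x - ε))
          - ∑ a ∈ Finset.univ.erase j, E1 τ (q j x - q a x) * (h j x - h a x) - ε * k j x) := by
    have hL : ∑ a, partialLocal τ ν ε q p z x a i j * h a x =
        (-dURS τ ν ε q p z x i j + URS τ ν ε q p z x i j *
          (-(∑ b, E1 τ (shiftArg ν ε q x b j)) - ∑ b ∈ Finset.univ.erase j, E1 τ (q j x - q b x)))
          * h j x
        + ∑ a ∈ Finset.univ.erase j, URS τ ν ε q p z x i j * (E1 τ (q j x - q a x) * h a x) := by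
      rw [← Finset.add_sum_erase _ _ (Finset.mem_univ j), partialLocal, if_pos rfl]
      congr 1
      refine Finset.sum_congr rfl fun a ha => ?_
      rw [partialLocal, if_neg (Finset.ne_of_mem_erase ha), mul_assoc]
    simp only [Finset.sum_add_distrib, hL, partialShifted, add_mul, ite_mul, zero_mul,
      Finset.sum_ite_eq', Finset.mem_univ, if_true, E1_neg hτ, mul_sub,
      Finset.sum_sub_distrib, ← Finset.mul_sum, ← Finset.sum_mul, neg_mul, Finset.sum_neg_distrib,
      mul_assoc]
    ring
  simp only [zero_mul, add_zero]
  rw [hsum]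
  have hs : ∀ (t : ℂ) a b, shiftArg ν ε (fun a x => q a x + t * h a x) x a b =
      shiftArg ν ε q x a b + t * (h a (x - ε) - h b x) := fun t a b => by
    simp only [shiftArg]; ring
  have hs' : ∀ (t : ℂ) a b, -(shiftArg ν ε q x a b + t * (h a (x - ε) - h b x)) =
      -shiftArg ν ε q x a b + t * (h b x - h a (x - ε)) := fun t a b => by ring
  have hd : ∀ (t : ℂ) a b, q a x + t * h a x - (q b x + t * h b x) =
      (q a x - q b x) + t * (h a x - h b x) := fun t a b => by ring
  simp only [URS, dURS, Matrix.of_apply, factorRS_eq, hs, hs', hd]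
  have hline : HasDerivAt (fun t : ℂ => shiftArg ν ε q x i j + t * (h i (x - ε) - h j x))
      (h i (x - ε) - h j x) 0 := by
    simpa using ((hasDerivAt_id (0 : ℂ)).mul_const (h i (x - ε) - h j x)).const_add
      (shiftArg ν ε q x i j)
  have h1 : HasDerivAt (fun t : ℂ => kronecker τ z
      (shiftArg ν ε q x i j + t * (h i (x - ε) - h j x)))
      (kroneckerD τ z (shiftArg ν ε q x i j) * (h i (x - ε) - h j x)) 0 :=
    HasDerivAt.comp (h₂ := fun v => kronecker τ z v) 0
      (by simpa using hasDerivAt_kronecker' hτ hz (hu x i j)) hline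
  have hnum := hasDerivAt_prod_theta hτ Finset.univ (fun a => -shiftArg ν ε q x a j)
    (fun a => h j x - h a (x - ε)) fun a _ => by
      rw [theta_neg hτ]; exact neg_ne_zero.2 (hu x a j)
  have hqj : ∀ a ∈ Finset.univ.erase j, theta τ (q j x - q a x) ≠ 0 := fun a ha =>
    hqq j a (Finset.ne_of_mem_erase ha).symm x
  have hden := (hasDerivAt_prod_theta hτ (Finset.univ.erase j) (fun a => q j x - q a x)
    (fun a => h j x - h a x) hqj).const_mul (theta τ (ν * ε))
  have hden0 : theta τ (ν * ε) * ∏ a ∈ Finset.univ.erase j, theta τ (q j x - q a x) ≠ 0 :=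
    mul_ne_zero hε (Finset.prod_ne_zero_iff.2 hqj)
  have hexp : HasDerivAt (fun t : ℂ => cexp (-ε * (p j x + t * k j x)))
      (cexp (-ε * p j x) * (-ε * k j x)) 0 := by
    have hl : HasDerivAt (fun t : ℂ => -ε * (p j x + t * k j x)) (-ε * k j x) 0 := by
      simpa using (((hasDerivAt_id (0 : ℂ)).mul_const (k j x)).const_add (p j x)).const_mul
        (-(ε : ℂ))
    simpa using hl.cexp
  have hall := h1.fun_mul ((hnum.fun_div hden (by simpa using hden0)).fun_mul hexp)
  refine hall.congr_deriv ?_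
  simp only [zero_mul, add_zero]
  generalize kronecker τ z (shiftArg ν ε q x i j) = y1 at *
  generalize kroneckerD τ z (shiftArg ν ε q x i j) = y2 at *
  generalize ∏ a, theta τ (-shiftArg ν ε q x a j) = y3 at *
  generalize ∏ a ∈ Finset.univ.erase j, theta τ (q j x - q a x) = y4 at *
  generalize ∑ a, E1 τ (-shiftArg ν ε q x a j) * (h j x - h a (x - ε)) = y5 at *
  generalize ∑ a ∈ Finset.univ.erase j, E1 τ (q j x - q a x) * (h j x - h a x) = y6 at *
  generalize cexp (-ε * p j x) = y7 at *
  generalize theta τ (ν * ε) = y8 at *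
  obtain ⟨h8, h4⟩ := mul_ne_zero_iff.1 hden0
  field_simp
  ring

lemma hasFunctionalDeriv_URS (hτ : 0 < τ.im) (hq : ∀ i, IsLoop (q i)) (hp : ∀ i, IsLoop (p i))
    (hqq : ∀ i j, i ≠ j → ∀ x, theta τ (q i x - q j x) ≠ 0) (hε : theta τ (ν * ε) ≠ 0)
    (hu : ∀ x i j, theta τ (shiftArg ν ε q x i j) ≠ 0) (hz : theta τ z ≠ 0) {φ : ℝ → ℂ}
    (hφ : IsLoop φ) (i j : Fin N) :
    HasFunctionalDeriv (smear φ fun Q P x => URS τ ν ε Q P z x i j) q p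
      (fun a x => φ x * partialLocal τ ν ε q p z x a i j
        + φ (x + ε) * partialShifted τ ν ε q p z (x + ε) a i j)
      (fun a x => φ x * if a = j then -ε * URS τ ν ε q p z x i j else 0) := by
  have h := hasFunctionalDeriv_smear (ε := ε) (q := q) (p := p)
    (A := fun Q P x => URS τ ν ε Q P z x i j)
    (D0 := fun a x => partialLocal τ ν ε q p z x a i j) (D1 := fun _ _ => 0) (D2 := fun _ _ => 0)
    (Dm := fun a x => partialShifted τ ν ε q p z x a i j)
    (Dp := fun a x => if a = j then -ε * URS τ ν ε q p z x i j else 0) hφ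
    (fun a => isLoop_partialLocal hτ hq hp hqq hε hu hz a i j) (fun _ => isLoop_const 0)
    (fun _ => isLoop_const 0) (fun a => isLoop_partialShifted hτ hq hp hqq hε hu hz a i j)
    (fun a => by
      by_cases h : a = j
      · simpa only [if_pos h] using (isLoop_const _).mul (isLoop_URS hτ hq hp hqq hε hu hz i j)
      · simpa only [if_neg h] using isLoop_const 0)
    (fun h k hh hk x => contDiffAt_URS_variation hτ hq hp hqq hε hu hz hh hk i j x)
    (fun h k _ _ x => hasDerivAt_URS_variation hτ hqq hε hu hz h k i j x)
  simpa using h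

lemma rhsRS_apply (hτ : 0 < τ.im) (hz : theta τ z ≠ 0) (hw : theta τ w ≠ 0)
    (hzw : theta τ (z - w) ≠ 0) (hqq : ∀ i j, i ≠ j → ∀ x, theta τ (q i x - q j x) ≠ 0)
    (hreg : IsRegularStep τ ν ε q p z w) (ψ : ℝ → ℝ → ℂ) (i k j l : Fin N) :
    rhsRS τ ν ε q p z w ψ (i, k) (j, l) =
      -ε * (∫ x in (0 : ℝ)..(2 * Real.pi), ψ x x *
          (URS τ ν ε q p z x i j * partialLocal τ ν ε q p w x j k l
            - URS τ ν ε q p w x k l * partialLocal τ ν ε q p z x l i j))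
      + -ε * (∫ x in (0 : ℝ)..(2 * Real.pi), ψ x (x + ε) *
          (URS τ ν ε q p z x i j * partialShifted τ ν ε q p w (x + ε) j k l))
      + ε * ∫ x in (0 : ℝ)..(2 * Real.pi), ψ x (x - ε) *
          (URS τ ν ε q p w (x - ε) k l * partialShifted τ ν ε q p z x l i j) := by
  have h1 := fun x => exchange_apply hτ hz hw hzw hqq hreg.theta_shiftArg (hreg.det_left x)
    (hreg.det_right x) i k j l
  have h2 := fun x y => mul_sMinus_apply (A := URS τ ν ε q p z x) (hreg.det_right y) i k j l
  have h3 := fun x y => mul_sPlus_apply (B := URS τ ν ε q p w y) (hreg.det_left x) i k j l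
  simp only [rhsRS, Matrix.add_apply, Matrix.smul_apply, pairDelta, Matrix.of_apply, smul_eq_mul,
    add_zero, ← sub_eq_add_neg, h2, h3]
  simp only [Matrix.add_apply, Matrix.sub_apply] at h1
  simp only [Matrix.add_apply, Matrix.sub_apply, h1]

lemma hasPoissonBracket_URS (hτ : 0 < τ.im) (hq : ∀ i, IsLoop (q i)) (hp : ∀ i, IsLoop (p i))
    (hz : theta τ z ≠ 0) (hw : theta τ w ≠ 0) (hzw : theta τ (z - w) ≠ 0)
    (hqq : ∀ i j, i ≠ j → ∀ x, theta τ (q i x - q j x) ≠ 0)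
    (hreg : IsRegularStep τ ν ε q p z w) {φ χ : ℝ → ℂ} (hφ : IsLoop φ) (hχ : IsLoop χ)
    (i j k l : Fin N) :
    HasPoissonBracket (smear φ fun Q P x => URS τ ν ε Q P z x i j)
      (smear χ fun Q P x => URS τ ν ε Q P w x k l) q p
      (rhsRS τ ν ε q p z w (fun x y => φ x * χ y) (i, k) (j, l)) := by
  have hUz := isLoop_URS hτ hq hp hqq hreg.theta_step hreg.theta_shiftArg hz i j
  have hUw := isLoop_URS hτ hq hp hqq hreg.theta_step hreg.theta_shiftArg hw k l
  have hLz := isLoop_partialLocal hτ hq hp hqq hreg.theta_step hreg.theta_shiftArg hz l i j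
  have hLw := isLoop_partialLocal hτ hq hp hqq hreg.theta_step hreg.theta_shiftArg hw j k l
  have hSz := isLoop_partialShifted hτ hq hp hqq hreg.theta_step hreg.theta_shiftArg hz l i j
  have hSw := isLoop_partialShifted hτ hq hp hqq hreg.theta_step hreg.theta_shiftArg hw j k l
  refine ⟨_, _, _, _, hasFunctionalDeriv_URS hτ hq hp hqq hreg.theta_step hreg.theta_shiftArg hz hφ
    i j, hasFunctionalDeriv_URS hτ hq hp hqq hreg.theta_step hreg.theta_shiftArg hw hχ k l, ?_⟩
  rw [rhsRS_apply hτ hz hw hzw hqq hreg]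
  have hshift := (((hφ.mul (hχ.shift_sub ε)).mul ((hUw.shift_sub ε).mul hSz))).integral_shift ε
  simp only [add_sub_cancel_right] at hshift
  have a1 := (hφ.mul hχ).mul ((hUz.mul hLw).sub (hUw.mul hLz))
  have a2 := (hφ.mul (hχ.shift ε)).mul (hUz.mul (hSw.shift ε))
  have a3 := ((hφ.shift ε).mul hχ).mul (hUw.mul (hSz.shift ε))
  rw [← hshift, ← intervalIntegral.integral_const_mul, ← intervalIntegral.integral_const_mul,
    ← intervalIntegral.integral_const_mul,
    ← intervalIntegral.integral_add (((isLoop_const _).mul a1).intervalIntegrable _ _)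
      (((isLoop_const _).mul a2).intervalIntegrable _ _),
    ← intervalIntegral.integral_add
      ((((isLoop_const _).mul a1).add ((isLoop_const _).mul a2)).intervalIntegrable _ _)
      (((isLoop_const _).mul a3).intervalIntegrable _ _)]
  have b1 := fun a =>
    (isLoop_partialLocal hτ hq hp hqq hreg.theta_step hreg.theta_shiftArg hz a i j)
  have b2 := fun a =>
    (isLoop_partialLocal hτ hq hp hqq hreg.theta_step hreg.theta_shiftArg hw a k l)
  have b3 := fun a =>
    (isLoop_partialShifted hτ hq hp hqq hreg.theta_step hreg.theta_shiftArg hz a i j)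
  have b4 := fun a =>
    (isLoop_partialShifted hτ hq hp hqq hreg.theta_step hreg.theta_shiftArg hw a k l)
  have b5 : ∀ {b : Fin N} {U : ℝ → ℂ}, IsLoop U → ∀ a, IsLoop fun x =>
      if a = b then -ε * U x else 0 := fun {b U} hU a => by
    by_cases h : a = b
    · simpa only [if_pos h] using (isLoop_const _).mul hU
    · simpa only [if_neg h] using isLoop_const 0
  rw [← intervalIntegral.integral_finsetSum fun a _ =>
    (((hφ.mul (b5 hUz a)).mul ((hχ.mul (b2 a)).add ((hχ.shift ε).mul ((b4 a).shift ε)))).sub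
      (((hφ.mul (b1 a)).add ((hφ.shift ε).mul ((b3 a).shift ε))).mul
        (hχ.mul (b5 hUw a)))).intervalIntegrable _ _]
  congr 1
  funext x
  simp only [mul_ite, mul_zero, ite_mul, zero_mul, Finset.sum_sub_distrib, Finset.sum_ite_eq',
    Finset.mem_univ, if_true]
  ring

end RSBracket

/-! ### Expansions of the Ruijsenaars-Schneider matrix -/

section Expansion

variable {N : ℕ} {τ ν : ℂ} {q p : Fin N → ℝ → ℂ} {z w : ℂ}

/-- A point of the phase space at which all functions of the field theories are defined. -/
structure IsNondegenerate (τ ν : ℂ) (q p : Fin N → ℝ → ℂ) : Prop where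
  im_pos : 0 < τ.im
  deriv_theta : deriv (theta τ) 0 ≠ 0
  coupling : ν ≠ 0
  loop_q : ∀ i, IsLoop (q i)
  loop_p : ∀ i, IsLoop (p i)
  theta_sub : ∀ i j, i ≠ j → ∀ x, theta τ (q i x - q j x) ≠ 0
  alphaSq_ne : ∀ i x, alphaSq ν q i x ≠ 0

/-- The entire function `ϑ(v) / v`. -/
def thetaQuot (τ : ℂ) : ℂ → ℂ := dslope (theta τ) 0

lemma theta_eq_mul_thetaQuot (hτ : 0 < τ.im) (v : ℂ) : theta τ v = v * thetaQuot τ v := by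
  have h := sub_smul_dslope (theta τ) 0 v
  rw [sub_zero, theta_zero hτ, sub_zero, smul_eq_mul] at h
  exact h.symm

lemma thetaQuot_zero : thetaQuot τ 0 = deriv (theta τ) 0 := dslope_same _ _

lemma differentiable_thetaQuot (hτ : 0 < τ.im) : Differentiable ℂ (thetaQuot τ) := by
  rw [← differentiableOn_univ, thetaQuot, Complex.differentiableOn_dslope univ_mem]
  exact (differentiable_theta hτ).differentiableOn

lemma analyticAt_thetaQuot (hτ : 0 < τ.im) (v : ℂ) : AnalyticAt ℂ (thetaQuot τ) v :=
  (differentiable_thetaQuot hτ).analyticAt v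

lemma thetaQuot_neg (hτ : 0 < τ.im) (v : ℂ) : thetaQuot τ (-v) = thetaQuot τ v := by
  rcases eq_or_ne v 0 with rfl | hv
  · rw [neg_zero]
  · have h1 := theta_eq_mul_thetaQuot hτ v
    have h2 := theta_eq_mul_thetaQuot hτ (-v)
    rw [theta_neg hτ, h1] at h2
    exact mul_left_cancel₀ hv (by linear_combination h2)

lemma deriv_thetaQuot_zero (hτ : 0 < τ.im) : deriv (thetaQuot τ) 0 = 0 := by
  have h1 : (fun v => thetaQuot τ (-v)) = thetaQuot τ := funext (thetaQuot_neg hτ)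
  have h2 := deriv_comp_neg (thetaQuot τ) 0
  rw [h1, neg_zero] at h2
  linear_combination h2 / 2

/-- The product of the off-diagonal theta quotients and the exponential in `U`. -/
def regularFactor (τ ν : ℂ) (q p : Fin N → ℝ → ℂ) (j : Fin N) (ε x : ℝ) : ℂ :=
  (∏ a ∈ Finset.univ.erase j, theta τ (-shiftArg ν ε q x a j) / theta τ (q j x - q a x)) *
    cexp (-ε * p j x)

/-- `ϑ'(0) ε / ϑ(νε)`, continued analytically to `ε = 0`, times the regular factor. -/
def diagFactor (τ ν : ℂ) (q p : Fin N → ℝ → ℂ) (j : Fin N) (ε x : ℝ) : ℂ :=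
  deriv (theta τ) 0 / (ν * thetaQuot τ (ν * ε)) * regularFactor τ ν q p j ε x

/-- `-ν` times the limit of `ε` times the derivative of `U_kl(z,x)` along `q_a(x - ε)`. -/
def limitShifted (τ : ℂ) (q : Fin N → ℝ → ℂ) (z : ℂ) (x : ℝ) (a k l : Fin N) : ℂ :=
  if k = l then if a = l then E1 τ z else E1 τ (q a x - q l x)
  else if a = l then kronecker τ z (q k x - q l x) else 0

/-- `ν` times the limit of the derivative of `U_kl(z,x)` along `q_a`; the derivative of the entry
of the Calogero-Moser matrix in `q_a` at fixed `p` and fixed `α`. -/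
def limitTotal (τ ν : ℂ) (q : Fin N → ℝ → ℂ) (z : ℂ) (x : ℝ) (a k l : Fin N) : ℂ :=
  if a = l then
    if k = l then ∑ b ∈ Finset.univ.erase l, alphaSq ν q b x * E2 τ (q l x - q b x)
    else -(kroneckerD τ z (q k x - q l x) * alphaSq ν q l x)
  else if k = l then -(alphaSq ν q a x * E2 τ (q l x - q a x))
  else if a = k then kroneckerD τ z (q k x - q l x) * alphaSq ν q l x else 0

/-- `ν²` times the limit of `ε` times the local term of the Ruijsenaars-Schneider structure. -/
def limitLocal (τ ν : ℂ) (q : Fin N → ℝ → ℂ) (z w : ℂ) (x : ℝ) (i k j l : Fin N) : ℂ :=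
  (if k = l then limitTotal τ ν q z x l i j else 0)
    - if i = j then limitTotal τ ν q w x j k l else 0

namespace IsNondegenerate

lemma isLoop_alphaSq (H : IsNondegenerate τ ν q p) (i : Fin N) : IsLoop (alphaSq ν q i) :=
  (H.loop_q i).deriv.add (isLoop_const ν)

lemma isLoop_sub (H : IsNondegenerate τ ν q p) (i j : Fin N) : IsLoop fun x => q i x - q j x :=
  (H.loop_q i).sub (H.loop_q j)

lemma isLoop_alphaLogD (H : IsNondegenerate τ ν q p) (i : Fin N) : IsLoop (alphaLogD ν q i) :=
  (H.isLoop_alphaSq i).deriv.div ((isLoop_const 2).mul (H.isLoop_alphaSq i)) fun x =>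
    mul_ne_zero two_ne_zero (H.alphaSq_ne i x)

lemma isLoop_E1_sub (H : IsNondegenerate τ ν q p) {i j : Fin N} (hij : i ≠ j) :
    IsLoop fun x => E1 τ (q i x - q j x) :=
  (H.isLoop_sub i j).comp_analytic fun x => analyticAt_E1 H.im_pos (H.theta_sub i j hij x)

lemma isLoop_E2_sub (H : IsNondegenerate τ ν q p) {i j : Fin N} (hij : i ≠ j) :
    IsLoop fun x => E2 τ (q i x - q j x) :=
  (H.isLoop_sub i j).comp_analytic fun x => analyticAt_E2 H.im_pos (H.theta_sub i j hij x)

lemma isLoop_kronecker (H : IsNondegenerate τ ν q p) (hz : theta τ z ≠ 0) {i j : Fin N}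
    (hij : i ≠ j) : IsLoop fun x => kronecker τ z (q i x - q j x) :=
  (H.isLoop_sub i j).comp_analytic (G := fun v => kronecker τ z v) fun x =>
    analyticAt_kronecker H.im_pos hz (H.theta_sub i j hij x)

lemma isLoop_kroneckerD (H : IsNondegenerate τ ν q p) (hz : theta τ z ≠ 0) {i j : Fin N}
    (hij : i ≠ j) : IsLoop fun x => kroneckerD τ z (q i x - q j x) :=
  (H.isLoop_sub i j).comp_analytic (G := fun v => kroneckerD τ z v) fun x =>
    analyticAt_kroneckerD H.im_pos hz (H.theta_sub i j hij x)

lemma isLoop_momentumCM (H : IsNondegenerate τ ν q p) (i : Fin N) :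
    IsLoop (momentumCM τ ν q p i) :=
  ((H.loop_p i).sub (.sum fun m hm => (H.isLoop_alphaSq m).mul
    (H.isLoop_E1_sub (Finset.ne_of_mem_erase hm).symm))).add (H.isLoop_alphaLogD i)

lemma unifLim_shiftArg_self (H : IsNondegenerate τ ν q p) (i : Fin N) :
    UnifLim (fun ε x => shiftArg ν ε q x i i / ε) fun x => -alphaSq ν q i x := by
  have h := (H.loop_q i).unifLim_slope_shift.sub (unifLim_const ν)
  refine (h.congr ?_).congr_right fun x => by rw [alphaSq]; ring
  filter_upwards [eventually_ne_zero'] with ε hε x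
  have : (ε : ℂ) ≠ 0 := by exact_mod_cast hε
  rw [shiftArg]
  field_simp

lemma unifLim_neg_shiftArg_self (H : IsNondegenerate τ ν q p) (i : Fin N) :
    UnifLim (fun ε x => -shiftArg ν ε q x i i / ε) (alphaSq ν q i) := by
  simpa only [neg_neg, neg_div] using (H.unifLim_shiftArg_self i).neg

lemma shiftArg_eq_add (ν : ℂ) (ε : ℝ) (q : Fin N → ℝ → ℂ) (x : ℝ) (i j : Fin N) :
    shiftArg ν ε q x i j = (q i x - q j x) + shiftArg ν ε q x i i := by
  simp only [shiftArg]; ring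

lemma neg_shiftArg_eq_add (ν : ℂ) (ε : ℝ) (q : Fin N → ℝ → ℂ) (x : ℝ) (i j : Fin N) :
    -shiftArg ν ε q x i j = (q j x - q i x) + -shiftArg ν ε q x i i := by
  simp only [shiftArg]; ring

/-- First-order expansions of analytic functions at the shifted differences of the fields. -/
lemma slope_shiftArg (H : IsNondegenerate τ ν q p) {G : ℂ → ℂ} {i j : Fin N}
    (hG : ∀ x, AnalyticAt ℂ G (q i x - q j x)) :
    UnifLim (fun ε x => (G (shiftArg ν ε q x i j) - G (q i x - q j x)) / ε)
      fun x => deriv G (q i x - q j x) * -alphaSq ν q i x := by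
  have h := UnifLim.slope_comp (H.isLoop_sub i j) hG (H.unifLim_shiftArg_self i)
  simpa only [← shiftArg_eq_add] using h

lemma unifLim_shiftArg (H : IsNondegenerate τ ν q p) {G : ℂ → ℂ} {i j : Fin N}
    (hG : ∀ x, AnalyticAt ℂ G (q i x - q j x)) :
    UnifLim (fun ε x => G (shiftArg ν ε q x i j)) fun x => G (q i x - q j x) :=
  .of_slope ((H.isLoop_sub i j).comp_analytic hG).exists_bound (H.slope_shiftArg hG)

/-- First-order expansions of analytic functions at the small shifted differences. -/
lemma slope_shiftArg_self (H : IsNondegenerate τ ν q p) {G : ℂ → ℂ} (c : ℂ)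
    (hG : AnalyticAt ℂ G c) (i : Fin N) :
    UnifLim (fun ε x => (G (c + shiftArg ν ε q x i i) - G c) / ε)
      fun x => deriv G c * -alphaSq ν q i x :=
  UnifLim.slope_comp (isLoop_const c) (fun _ => hG) (H.unifLim_shiftArg_self i)

lemma comp_shiftArg_self (H : IsNondegenerate τ ν q p) {G : ℂ → ℂ} (c : ℂ)
    (hG : AnalyticAt ℂ G c) (i : Fin N) :
    UnifLim (fun ε x => G (c + shiftArg ν ε q x i i)) fun _ => G c :=
  .of_slope ⟨‖G c‖, fun _ => le_rfl⟩ (H.slope_shiftArg_self c hG i)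

lemma slope_step {G : ℂ → ℂ} (hG : AnalyticAt ℂ G 0) (ν : ℂ) :
    UnifLim (fun ε _ => (G (ν * ε) - G 0) / ε) fun _ => deriv G 0 * ν := by
  have hv : UnifLim (fun ε _ => ν * ε / (ε : ℂ)) fun _ => ν := (unifLim_const ν).congr (by
    filter_upwards [eventually_ne_zero'] with ε hε x
    have : (ε : ℂ) ≠ 0 := by exact_mod_cast hε
    field_simp)
  simpa only [zero_add] using UnifLim.slope_comp (isLoop_const 0) (fun _ => hG) hv

lemma theta_step_eventually (H : IsNondegenerate τ ν q p) :
    ∀ᶠ ε : ℝ in 𝓝[≠] 0, theta τ (ν * ε) ≠ 0 := by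
  have h : UnifLim (fun ε _ => thetaQuot τ (ν * ε)) fun _ => thetaQuot τ 0 :=
    .of_slope ⟨_, fun _ => le_rfl⟩ (slope_step (analyticAt_thetaQuot H.im_pos 0) ν)
  have h0 : 0 < ‖thetaQuot τ 0‖ := norm_pos_iff.2 (thetaQuot_zero ▸ H.deriv_theta)
  filter_upwards [h.eventually_ne h0 fun _ => le_rfl, eventually_ne_zero'] with ε h1 h2
  rw [theta_eq_mul_thetaQuot H.im_pos]
  exact mul_ne_zero (mul_ne_zero H.coupling (by exact_mod_cast h2)) (h1 0)

lemma theta_shiftArg_self_eventually (H : IsNondegenerate τ ν q p) (i : Fin N) :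
    ∀ᶠ ε : ℝ in 𝓝[≠] 0, ∀ x, theta τ (shiftArg ν ε q x i i) ≠ 0 := by
  have h := H.comp_shiftArg_self 0 (analyticAt_thetaQuot H.im_pos 0) i
  have h0 : 0 < ‖thetaQuot τ 0‖ := norm_pos_iff.2 (thetaQuot_zero ▸ H.deriv_theta)
  obtain ⟨c, hc, hcα⟩ := (H.isLoop_alphaSq i).neg.exists_le_norm fun x =>
    neg_ne_zero.2 (H.alphaSq_ne i x)
  filter_upwards [h.eventually_ne h0 fun _ => le_rfl,
    (H.unifLim_shiftArg_self i).eventually_ne hc hcα] with ε h1 h2 x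
  have h3 := h1 x
  rw [zero_add] at h3
  rw [theta_eq_mul_thetaQuot H.im_pos]
  exact mul_ne_zero (fun h => h2 x (by rw [h, zero_div])) h3

lemma theta_shiftArg_eventually (H : IsNondegenerate τ ν q p) :
    ∀ᶠ ε : ℝ in 𝓝[≠] 0, ∀ x i j, theta τ (shiftArg ν ε q x i j) ≠ 0 := by
  have h : ∀ i j, ∀ᶠ ε : ℝ in 𝓝[≠] 0, ∀ x, theta τ (shiftArg ν ε q x i j) ≠ 0 := fun i j => by
    rcases eq_or_ne i j with rfl | hij
    · exact H.theta_shiftArg_self_eventually i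
    · obtain ⟨c, hc, hcθ⟩ := ((H.isLoop_sub i j).comp_analytic fun x =>
        analyticAt_theta H.im_pos _).exists_le_norm (H.theta_sub i j hij)
      exact (H.unifLim_shiftArg fun x => analyticAt_theta H.im_pos _).eventually_ne hc hcθ
  filter_upwards [eventually_all.2 fun i => eventually_all.2 (h i)] with ε hε x i j
  exact hε i j x

lemma slope_regularFactor (H : IsNondegenerate τ ν q p) (j : Fin N) :
    UnifLim (fun ε x => (regularFactor τ ν q p j ε x - 1) / ε) fun x =>
      (∑ a ∈ Finset.univ.erase j, alphaSq ν q a x * E1 τ (q j x - q a x)) - p j x := by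
  have h1 : UnifLim (fun ε x => (∏ a ∈ Finset.univ.erase j,
      theta τ (-shiftArg ν ε q x a j) / theta τ (q j x - q a x) - 1) / ε)
      fun x => ∑ a ∈ Finset.univ.erase j, alphaSq ν q a x * E1 τ (q j x - q a x) := by
    refine UnifLim.slope_prod fun a ha => ?_
    have haj := (Finset.ne_of_mem_erase ha).symm
    have h2 := UnifLim.slope_comp (H.isLoop_sub j a) (G := theta τ)
      (fun x => analyticAt_theta H.im_pos _) (H.unifLim_neg_shiftArg_self a)
    have h3 : IsLoop fun x => (theta τ (q j x - q a x))⁻¹ :=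
      ((H.isLoop_sub j a).comp_analytic fun x => analyticAt_theta H.im_pos _).inv
        (H.theta_sub j a haj)
    refine ((h2.mul h3.unifLim).congr (.of_forall fun ε x => ?_)).congr_right fun x => ?_
    · have := H.theta_sub j a haj x
      rw [← neg_shiftArg_eq_add]
      field_simp
    · rw [E1]; ring
  have h4 : UnifLim (fun ε x => (cexp (-ε * p j x) - 1) / ε) fun x => -p j x := by
    have hv : UnifLim (fun ε x => -ε * p j x / (ε : ℂ)) fun x => -p j x :=
      (H.loop_p j).neg.unifLim.congr (by
        filter_upwards [eventually_ne_zero'] with ε hε x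
        have : (ε : ℂ) ≠ 0 := by exact_mod_cast hε
        field_simp)
    have h5 := UnifLim.slope_comp (isLoop_const 0) (G := cexp) (fun _ => analyticAt_cexp) hv
    simpa using h5
  have h5 := UnifLim.slope_mul (f₀ := fun _ => 1) (g₀ := fun _ => 1)
    (.of_slope ⟨1, by simp⟩ h1) (.of_slope ⟨1, by simp⟩ h4) h1 h4
  simpa only [regularFactor, mul_one, one_mul, ← sub_eq_add_neg] using h5

lemma unifLim_regularFactor (H : IsNondegenerate τ ν q p) (j : Fin N) :
    UnifLim (regularFactor τ ν q p j) fun _ => 1 :=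
  .of_slope ⟨1, by simp⟩ (H.slope_regularFactor j)

lemma factorRS_eq_regularFactor (ε x : ℝ) (j : Fin N) :
    factorRS τ ν ε q p x j =
      theta τ (-shiftArg ν ε q x j j) / theta τ (ν * ε) * regularFactor τ ν q p j ε x := by
  rw [factorRS_eq, regularFactor, Finset.prod_div_distrib,
    ← Finset.mul_prod_erase _ _ (Finset.mem_univ j)]
  ring

/-- There is no first-order contribution of `ϑ'(0) ε / ϑ(νε)`, since `ϑ` is odd. -/
lemma slope_diagFactor (H : IsNondegenerate τ ν q p) (j : Fin N) :
    UnifLim (fun ε x => (diagFactor τ ν q p j ε x - 1 / ν) / ε) fun x => 1 / ν *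
      ((∑ a ∈ Finset.univ.erase j, alphaSq ν q a x * E1 τ (q j x - q a x)) - p j x) := by
  have h0 : thetaQuot τ 0 ≠ 0 := thetaQuot_zero ▸ H.deriv_theta
  have hG0 : ν * thetaQuot τ 0 ≠ 0 := mul_ne_zero H.coupling h0
  have hG : AnalyticAt ℂ (fun v => deriv (theta τ) 0 / (ν * thetaQuot τ v)) 0 :=
    analyticAt_const.div (analyticAt_const.mul (analyticAt_thetaQuot H.im_pos 0)) hG0
  have hd : deriv (fun v => deriv (theta τ) 0 / (ν * thetaQuot τ v)) 0 = 0 := by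
    have h1 := ((differentiable_thetaQuot H.im_pos) 0).hasDerivAt
    rw [deriv_thetaQuot_zero H.im_pos] at h1
    have h2 := (hasDerivAt_const (0 : ℂ) (deriv (theta τ) 0)).fun_div (h1.const_mul ν) hG0
    simpa using h2.deriv
  have h1 := slope_step hG ν
  have hval : deriv (theta τ) 0 / (ν * thetaQuot τ 0) = 1 / ν := by
    have := H.coupling
    have := H.deriv_theta
    rw [thetaQuot_zero]
    field_simp
  simp only [hd, zero_mul, hval] at h1
  have h2 := UnifLim.slope_mul (f₀ := fun _ => 1 / ν) (g₀ := fun _ => 1)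
    (.of_slope ⟨_, fun _ => le_rfl⟩ h1) (H.unifLim_regularFactor j) h1 (H.slope_regularFactor j)
  simpa only [diagFactor, zero_mul, zero_add, mul_one] using h2

lemma unifLim_diagFactor (H : IsNondegenerate τ ν q p) (j : Fin N) :
    UnifLim (diagFactor τ ν q p j) fun _ => 1 / ν :=
  .of_slope ⟨_, fun _ => le_rfl⟩ (H.slope_diagFactor j)

lemma factorRS_div_theta (H : IsNondegenerate τ ν q p) {ε x : ℝ} {j : Fin N} (hε : ε ≠ 0)
    (hu : theta τ (shiftArg ν ε q x j j) ≠ 0) :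
    ε * (deriv (theta τ) 0 / theta τ (shiftArg ν ε q x j j) * factorRS τ ν ε q p x j) =
      -diagFactor τ ν q p j ε x := by
  have h1 : (ε : ℂ) ≠ 0 := by exact_mod_cast hε
  rw [factorRS_eq_regularFactor, diagFactor, theta_neg H.im_pos,
    theta_eq_mul_thetaQuot H.im_pos (ν * ε)]
  have := H.coupling
  field_simp

lemma unifLim_factorRS (H : IsNondegenerate τ ν q p) (j : Fin N) :
    UnifLim (fun ε x => factorRS τ ν ε q p x j) fun x => alphaSq ν q j x / ν := by
  have h1 := H.unifLim_diagFactor j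
  have h2 := (H.comp_shiftArg_self 0 (analyticAt_thetaQuot H.im_pos 0) j).const_mul
    (deriv (theta τ) 0)⁻¹
  have h3 := ((h1.mul h2).mul (H.unifLim_neg_shiftArg_self j))
  refine (h3.congr ?_).congr_right fun x => ?_
  · filter_upwards [eventually_ne_zero'] with ε hε x
    have h4 : (ε : ℂ) ≠ 0 := by exact_mod_cast hε
    have := H.coupling
    have := H.deriv_theta
    rw [factorRS_eq_regularFactor, diagFactor, theta_neg H.im_pos,
      theta_eq_mul_thetaQuot H.im_pos (ν * ε),
      theta_eq_mul_thetaQuot H.im_pos (shiftArg _ _ _ _ _ _)]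
    rw [zero_add]
    field_simp
  · have := H.deriv_theta
    rw [thetaQuot_zero]
    field_simp

lemma unifLim_URS_offDiag (H : IsNondegenerate τ ν q p) (hz : theta τ z ≠ 0) {i j : Fin N}
    (hij : i ≠ j) : UnifLim (fun ε x => URS τ ν ε q p z x i j)
      fun x => kronecker τ z (q i x - q j x) * (alphaSq ν q j x / ν) :=
  (H.unifLim_shiftArg (G := fun v => kronecker τ z v) fun x =>
    analyticAt_kronecker H.im_pos hz (H.theta_sub i j hij x)).mul (H.unifLim_factorRS j)

lemma unifLim_dURS_offDiag (H : IsNondegenerate τ ν q p) (hz : theta τ z ≠ 0) {i j : Fin N}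
    (hij : i ≠ j) : UnifLim (fun ε x => dURS τ ν ε q p z x i j)
      fun x => kroneckerD τ z (q i x - q j x) * (alphaSq ν q j x / ν) :=
  (H.unifLim_shiftArg (G := fun v => kroneckerD τ z v) fun x =>
    analyticAt_kroneckerD H.im_pos hz (H.theta_sub i j hij x)).mul (H.unifLim_factorRS j)

lemma mul_URS_diag (H : IsNondegenerate τ ν q p) {ε x : ℝ} {i : Fin N}
    (hε : ε ≠ 0) (hu : theta τ (shiftArg ν ε q x i i) ≠ 0) :
    ε * URS τ ν ε q p z x i i =
      -(diagFactor τ ν q p i ε x * (theta τ (z + shiftArg ν ε q x i i) / theta τ z)) := by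
  have h := H.factorRS_div_theta hε hu
  rw [URS, Matrix.of_apply, kronecker]
  linear_combination (theta τ (z + shiftArg ν ε q x i i) / theta τ z) * h

/-- The expansion of the matrix `U`. -/
lemma unifLim_URS (H : IsNondegenerate τ ν q p) (hz : theta τ z ≠ 0) (i j : Fin N) :
    UnifLim (fun ε x => URS τ ν ε q p z x i j + (if i = j then 1 else 0) / (ν * ε))
      fun x => UCM τ ν q (momentumCM τ ν q p) z x i j / ν := by
  rcases eq_or_ne i j with rfl | hij
  · have h1 := H.slope_shiftArg_self z (analyticAt_theta H.im_pos z) i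
    have h2 : UnifLim (fun ε x => (theta τ (z + shiftArg ν ε q x i i) / theta τ z - 1) / ε)
        fun x => -(alphaSq ν q i x * E1 τ z) := by
      refine ((h1.const_mul (theta τ z)⁻¹).congr (.of_forall fun ε x => ?_)).congr_right
        fun x => ?_
      · field_simp
      · rw [E1]; ring
    have h3 := (UnifLim.slope_mul (f₀ := fun _ => 1 / ν) (g₀ := fun _ => 1)
      (H.unifLim_diagFactor i) (.of_slope ⟨1, by simp⟩ h2) (H.slope_diagFactor i) h2).neg
    refine (h3.congr ?_).congr_right fun x => ?_
    · filter_upwards [eventually_ne_zero', H.theta_shiftArg_self_eventually i] with ε hε hu x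
      have h4 : (ε : ℂ) ≠ 0 := by exact_mod_cast hε
      have h5 := H.mul_URS_diag (z := z) hε (hu x)
      have := H.coupling
      rw [if_pos rfl, ← neg_eq_iff_eq_neg.2 h5]
      field_simp
      ring
    · simp only [UCM, Matrix.of_apply, if_true, momentumCM]
      ring
  · simp only [if_neg hij, zero_div, add_zero, UCM, Matrix.of_apply]
    refine (H.unifLim_URS_offDiag hz hij).congr_right fun x => ?_
    ring

lemma unifLim_mul_URS (H : IsNondegenerate τ ν q p) (hz : theta τ z ≠ 0) (i j : Fin N) :
    UnifLim (fun ε x => ε * URS τ ν ε q p z x i j) fun _ => -(if i = j then 1 else 0) / ν := by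
  have h := (unifLim_param.mul (H.unifLim_URS hz i j)).sub
    (unifLim_const ((if i = j then 1 else 0) / ν))
  refine (h.congr ?_).congr_right fun x => by ring
  filter_upwards [eventually_ne_zero'] with ε hε x
  have h4 : (ε : ℂ) ≠ 0 := by exact_mod_cast hε
  have := H.coupling
  field_simp
  ring

lemma det_URS_eventually (H : IsNondegenerate τ ν q p) (hz : theta τ z ≠ 0) :
    ∀ᶠ ε : ℝ in 𝓝[≠] 0, ∀ x, (URS τ ν ε q p z x).det ≠ 0 := by
  have h : UnifLim (fun ε x => ((-ν * ε) • URS τ ν ε q p z x).det) fun _ =>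
      (1 : Matrix (Fin N) (Fin N) ℂ).det := by
    simp only [Matrix.det_apply']
    refine UnifLim.sum fun s _ => UnifLim.const_mul (UnifLim.prod fun i _ => ?_) _
    refine (((H.unifLim_mul_URS hz (s i) i).const_mul (-ν)).congr (.of_forall fun ε x => ?_)
      ).congr_right fun x => ?_
    · rw [Matrix.smul_apply, smul_eq_mul, mul_assoc]
    · have := H.coupling
      rw [Matrix.one_apply]
      field_simp
  rw [Matrix.det_one] at h
  filter_upwards [h.eventually_ne one_pos fun _ => by simp] with ε hε x h0
  refine hε x ?_
  rw [Matrix.det_smul, h0, mul_zero]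

lemma isRegularStep_eventually (H : IsNondegenerate τ ν q p) (hz : theta τ z ≠ 0)
    (hw : theta τ w ≠ 0) : ∀ᶠ ε : ℝ in 𝓝[≠] 0, IsRegularStep τ ν ε q p z w := by
  filter_upwards [H.theta_step_eventually, H.theta_shiftArg_eventually, H.det_URS_eventually hz,
    H.det_URS_eventually hw] with ε h1 h2 h3 h4
  exact ⟨h1, h2, h3, h4⟩

/-- The poles at `ε = 0` of the derivative and of the logarithmic derivative of the Kronecker
function cancel on the diagonal. -/
lemma mul_partialShifted_diag (H : IsNondegenerate τ ν q p) (hz : theta τ z ≠ 0) {ε x : ℝ}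
    {i : Fin N} (hε : ε ≠ 0) (hu : theta τ (shiftArg ν ε q x i i) ≠ 0) :
    ε * partialShifted τ ν ε q p z x i i i =
      -(diagFactor τ ν q p i ε x *
        (deriv (theta τ) (z + shiftArg ν ε q x i i) / theta τ z)) := by
  have h := H.factorRS_div_theta hε hu
  rw [partialShifted, if_pos rfl, URS, dURS, Matrix.of_apply, Matrix.of_apply, kronecker, E1,
    kroneckerD_eq_theta H.im_pos hz hu]
  rw [← neg_mul, ← h]
  field_simp
  ring

lemma unifLim_E1_shiftArg (H : IsNondegenerate τ ν q p) {a l : Fin N} (hal : a ≠ l) :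
    UnifLim (fun ε x => E1 τ (shiftArg ν ε q x a l)) fun x => E1 τ (q a x - q l x) :=
  H.unifLim_shiftArg fun x => analyticAt_E1 H.im_pos (H.theta_sub a l hal x)

lemma unifLim_mul_E1_shiftArg_self (H : IsNondegenerate τ ν q p) (i : Fin N) :
    UnifLim (fun ε x => ε * E1 τ (shiftArg ν ε q x i i)) fun x => -(alphaSq ν q i x)⁻¹ := by
  obtain ⟨c, hc, hcα⟩ := (H.isLoop_alphaSq i).neg.exists_le_norm fun x =>
    neg_ne_zero.2 (H.alphaSq_ne i x)
  have h0 : thetaQuot τ 0 ≠ 0 := thetaQuot_zero ▸ H.deriv_theta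
  have h1 := (H.unifLim_shiftArg_self i).inv hc hcα
  have h2 := H.comp_shiftArg_self 0 (G := fun v => deriv (theta τ) v / thetaQuot τ v)
    ((analyticAt_theta H.im_pos 0).deriv.div (analyticAt_thetaQuot H.im_pos 0) h0) i
  refine ((h1.mul h2).congr ?_).congr_right fun x => ?_
  · filter_upwards [eventually_ne_zero', H.theta_shiftArg_self_eventually i] with ε hε hu x
    have h4 : (ε : ℂ) ≠ 0 := by exact_mod_cast hε
    have h5 := hu x
    rw [zero_add, E1]
    rw [theta_eq_mul_thetaQuot H.im_pos] at h5 ⊢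
    obtain ⟨h6, h7⟩ := mul_ne_zero_iff.1 h5
    field_simp
  · have := H.deriv_theta
    rw [thetaQuot_zero, div_self this, mul_one, inv_neg]

lemma unifLim_mul_partialShifted (H : IsNondegenerate τ ν q p) (hz : theta τ z ≠ 0)
    (a k l : Fin N) : UnifLim (fun ε x => ε * partialShifted τ ν ε q p z x a k l)
      fun x => -limitShifted τ q z x a k l / ν := by
  rcases eq_or_ne k l with rfl | hkl
  · rcases eq_or_ne a k with rfl | hak
    · have h1 := H.comp_shiftArg_self z (analyticAt_theta H.im_pos z).deriv a
      refine (((H.unifLim_diagFactor a).mul (h1.const_mul (theta τ z)⁻¹)).neg.congr ?_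
        ).congr_right fun x => ?_
      · filter_upwards [eventually_ne_zero', H.theta_shiftArg_self_eventually a] with ε hε hu x
        rw [H.mul_partialShifted_diag hz hε (hu x)]
        ring
      · rw [limitShifted, if_pos rfl, if_pos rfl, E1]
        ring
    · refine (((H.unifLim_mul_URS hz k k).mul (H.unifLim_E1_shiftArg hak)).congr
        (.of_forall fun ε x => ?_)).congr_right fun x => ?_
      · rw [partialShifted, if_neg hak]
        ring
      · rw [limitShifted, if_pos rfl, if_neg hak, if_pos rfl]
        ring
  · have hU := H.unifLim_URS_offDiag hz hkl
    rcases eq_or_ne a l with rfl | hal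
    · refine ((hU.mul (H.unifLim_mul_E1_shiftArg_self a)).congr (.of_forall fun ε x => ?_)
        ).congr_right fun x => ?_
      · rw [partialShifted, if_neg (Ne.symm hkl)]
        ring
      · have := H.alphaSq_ne a x
        rw [limitShifted, if_neg hkl, if_pos rfl]
        field_simp
    · rcases eq_or_ne a k with rfl | hak
      · refine ((unifLim_param.mul ((H.unifLim_dURS_offDiag hz hkl).add
          (hU.mul (H.unifLim_E1_shiftArg hal)))).congr (.of_forall fun ε x => ?_)
          ).congr_right fun x => ?_
        · rw [partialShifted, if_pos rfl]
        · rw [limitShifted, if_neg hkl, if_neg hal]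
          ring
      · refine ((unifLim_param.mul (hU.mul (H.unifLim_E1_shiftArg hal))).congr
          (.of_forall fun ε x => ?_)).congr_right fun x => ?_
        · rw [partialShifted, if_neg hak, zero_add]
        · rw [limitShifted, if_neg hkl, if_neg hal]
          ring

lemma slope_E1_shiftArg (H : IsNondegenerate τ ν q p) {a l : Fin N} (hal : a ≠ l) :
    UnifLim (fun ε x => (E1 τ (shiftArg ν ε q x a l) + E1 τ (q l x - q a x)) / ε)
      fun x => alphaSq ν q a x * E2 τ (q l x - q a x) := by
  refine ((H.slope_shiftArg fun x => analyticAt_E1 H.im_pos (H.theta_sub a l hal x)).congr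
    (.of_forall fun ε x => ?_)).congr_right fun x => ?_
  · rw [E1_sub_comm H.im_pos (q a x), sub_neg_eq_add]
  · rw [E2_sub_comm H.im_pos, E2]
    ring

lemma unifLim_partialTotal (H : IsNondegenerate τ ν q p) (hz : theta τ z ≠ 0) (a k l : Fin N) :
    UnifLim (fun ε x => partialTotal τ ν ε q p z x a k l)
      fun x => limitTotal τ ν q z x a k l / ν := by
  rcases eq_or_ne a l with rfl | hal
  · have hsum : UnifLim (fun ε x => ∑ b ∈ Finset.univ.erase a,
        (E1 τ (shiftArg ν ε q x b a) + E1 τ (q a x - q b x)) / ε) _ :=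
      UnifLim.sum fun b hb => H.slope_E1_shiftArg (Finset.ne_of_mem_erase hb)
    have heq : ∀ ε x, partialTotal τ ν ε q p z x a k a =
        (if a = k then 0 else -dURS τ ν ε q p z x k a) - URS τ ν ε q p z x k a *
          ∑ b ∈ Finset.univ.erase a, (E1 τ (shiftArg ν ε q x b a) + E1 τ (q a x - q b x)) :=
      fun ε x => by
        rw [partialTotal, partialLocal, partialShifted, if_pos rfl,
          ← Finset.add_sum_erase _ _ (Finset.mem_univ a), Finset.sum_add_distrib]
        split_ifs <;> ring
    rcases eq_or_ne k a with rfl | hka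
    · refine (((H.unifLim_mul_URS hz k k).mul hsum).neg.congr ?_).congr_right fun x => ?_
      · filter_upwards [eventually_ne_zero'] with ε hε x
        have h4 : (ε : ℂ) ≠ 0 := by exact_mod_cast hε
        rw [heq, if_pos rfl, ← Finset.sum_div]
        field_simp
        ring
      · simp only [limitTotal, if_true]
        ring
    · refine (((H.unifLim_dURS_offDiag hz hka).neg.sub ((unifLim_param.mul
        ((H.unifLim_URS_offDiag hz hka).mul hsum)))).congr ?_).congr_right fun x => ?_
      · filter_upwards [eventually_ne_zero'] with ε hε x
        have h4 : (ε : ℂ) ≠ 0 := by exact_mod_cast hε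
        rw [heq, if_neg (Ne.symm hka), ← Finset.sum_div]
        field_simp
      · rw [limitTotal, if_pos rfl, if_neg hka]
        ring
  · have heq : ∀ ε x, partialTotal τ ν ε q p z x a k l =
        (if a = k then dURS τ ν ε q p z x k l else 0) + URS τ ν ε q p z x k l *
          (E1 τ (shiftArg ν ε q x a l) + E1 τ (q l x - q a x)) := fun ε x => by
      rw [partialTotal, partialLocal, partialShifted, if_neg hal]
      ring
    have hE := H.slope_E1_shiftArg hal
    rcases eq_or_ne k l with rfl | hkl
    · refine (((H.unifLim_mul_URS hz k k).mul hE).congr ?_).congr_right fun x => ?_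
      · filter_upwards [eventually_ne_zero'] with ε hε x
        have h4 : (ε : ℂ) ≠ 0 := by exact_mod_cast hε
        rw [heq, if_neg hal]
        field_simp
        ring
      · simp only [limitTotal, if_true, if_neg hal]
        ring
    · have h2 := unifLim_param.mul ((H.unifLim_URS_offDiag hz hkl).mul hE)
      rcases eq_or_ne a k with rfl | hak
      · refine (((H.unifLim_dURS_offDiag hz hkl).add h2).congr ?_).congr_right fun x => ?_
        · filter_upwards [eventually_ne_zero'] with ε hε x
          have h4 : (ε : ℂ) ≠ 0 := by exact_mod_cast hε
          rw [heq, if_pos rfl]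
          field_simp
        · rw [limitTotal, if_neg hal, if_neg hkl, if_pos rfl]
          ring
      · refine (h2.congr ?_).congr_right fun x => ?_
        · filter_upwards [eventually_ne_zero'] with ε hε x
          have h4 : (ε : ℂ) ≠ 0 := by exact_mod_cast hε
          rw [heq, if_neg hak]
          field_simp
          ring
        · rw [limitTotal, if_neg hal, if_neg hkl, if_neg hak]
          ring

lemma unifLim_localRS (H : IsNondegenerate τ ν q p) (hz : theta τ z ≠ 0) (hw : theta τ w ≠ 0)
    (hzw : theta τ (z - w) ≠ 0) (i k j l : Fin N) :
    UnifLim (fun ε x => ε * localRS τ ν ε q p z w x (i, k) (j, l))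
      fun x => limitLocal τ ν q z w x i k j l / ν ^ 2 := by
  refine ((((H.unifLim_mul_URS hz i j).mul (H.unifLim_partialTotal hw j k l)).sub
    ((H.unifLim_mul_URS hw k l).mul (H.unifLim_partialTotal hz l i j))).congr ?_
    ).congr_right fun x => ?_
  · filter_upwards [H.isRegularStep_eventually hz hw] with ε hε x
    rw [localRS_apply H.im_pos hz hw hzw H.theta_sub hε.theta_shiftArg (hε.det_left x)
      (hε.det_right x)]
    ring
  · rw [limitLocal]
    split_ifs <;> ring

end IsNondegenerate

end Expansion

/-! ### The classical r-matrix of the Calogero-Moser field theory -/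

section CMAlgebra

variable {N : ℕ} {τ ν : ℂ} {q p P : Fin N → ℝ → ℂ} {z w : ℂ} {x : ℝ}

lemma rCM_apply (i k j l : Fin N) : rCM τ q z w x (i, k) (j, l) =
    (if i = k ∧ i = j ∧ i = l then E1 τ (z - w) + E1 τ w else 0)
      + (if i = l ∧ k = j ∧ i ≠ k then kronecker τ (z - w) (q i x - q k x) else 0)
      - if i = j ∧ i = l ∧ i ≠ k then kronecker τ (-w) (q i x - q k x) else 0 := by
  rw [rCM, Matrix.sub_apply, Matrix.add_apply, Matrix.smul_apply, sum_EE_apply,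
    sum_erase_EE_swap_apply, sum_erase_EE_col_apply]
  simp

lemma flip₁₂_apply (M : Mat₂ N) (i k j l : Fin N) :
    flip₁₂ M (i, k) (j, l) = M (k, i) (l, j) := rfl

lemma kronecker_neg_left (hτ : 0 < τ.im) (z u v : ℂ) :
    kronecker τ (-z) (u - v) = -kronecker τ z (v - u) := by
  rw [← neg_sub v u, kronecker_neg_neg hτ]

lemma kronecker_sub_comm (hτ : 0 < τ.im) (z w u v : ℂ) :
    kronecker τ (z - w) (u - v) = -kronecker τ (w - z) (v - u) := by
  rw [← neg_sub w z, kronecker_neg_left hτ]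

lemma kroneckerD_neg_left (hτ : 0 < τ.im) (z u v : ℂ) :
    kroneckerD τ (-z) (u - v) = kroneckerD τ z (v - u) := by
  rw [← neg_sub v u, kroneckerD_neg_neg hτ]

/-- The symmetric part of the r-matrix in terms of the limits of the derivatives of `U`. -/
lemma rCM_add_flip_apply (hτ : 0 < τ.im) (i k j l : Fin N) :
    (rCM τ q z w x + flip₁₂ (rCM τ q w z x)) (i, k) (j, l) =
      (if i = j then limitShifted τ q w x j k l else 0)
        + if k = l then limitShifted τ q z x l i j else 0 := by
  rw [Matrix.add_apply, flip₁₂_apply, rCM_apply, rCM_apply]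
  have h1 : ∀ u v, kronecker τ (-w) (u - v) = -kronecker τ w (v - u) := kronecker_neg_left hτ w
  have h2 : ∀ u v, kronecker τ (-z) (u - v) = -kronecker τ z (v - u) := kronecker_neg_left hτ z
  have h3 := kronecker_sub_comm hτ w z (q k x) (q i x)
  have h4 := E1_sub_comm hτ w z
  have h5 := E1_sub_comm hτ (q k x) (q i x)
  simp only [limitShifted, h1, h2]
  grind

variable (τ ν q z x) in
/-- The factor in the entries of `r₁₂` at `E_ij ⊗ E_ji`. -/
def rCMSwap (w : ℂ) (i k : Fin N) : ℂ :=
  if i = k then E1 τ (z - w) + E1 τ w else kronecker τ (z - w) (q i x - q k x)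

lemma rCM_apply' (hτ : 0 < τ.im) (i k j l : Fin N) : rCM τ q z w x (i, k) (j, l) =
    (if i = l ∧ k = j then rCMSwap τ q z x w i k else 0)
      + if i = j ∧ i = l ∧ i ≠ k then kronecker τ w (q k x - q i x) else 0 := by
  have h1 : ∀ u v, kronecker τ (-w) (u - v) = -kronecker τ w (v - u) := kronecker_neg_left hτ w
  rw [rCM_apply, rCMSwap, h1]
  grind

lemma in₁_mul_rCM_apply (hτ : 0 < τ.im) (A : Matrix (Fin N) (Fin N) ℂ) (i k j l : Fin N) :
    (in₁ A * rCM τ q z w x) (i, k) (j, l) =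
      (if k = j then A i l * rCMSwap τ q z x w l k else 0)
        + if j = l ∧ l ≠ k then A i j * kronecker τ w (q k x - q l x) else 0 := by
  rw [in₁_mul_apply]
  simp only [rCM_apply' hτ, mul_add, Finset.sum_add_distrib]
  rw [Finset.sum_eq_single l (by grind) (by simp), Finset.sum_eq_single j (by grind) (by simp)]
  grind

lemma rCM_mul_in₁_apply (hτ : 0 < τ.im) (A : Matrix (Fin N) (Fin N) ℂ) (i k j l : Fin N) :
    (rCM τ q z w x * in₁ A) (i, k) (j, l) =
      if i = l then rCMSwap τ q z x w i k * A k j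
        + (if i ≠ k then kronecker τ w (q k x - q i x) * A i j else 0) else 0 := by
  rw [mul_in₁_apply]
  simp only [rCM_apply' hτ, add_mul, Finset.sum_add_distrib]
  rw [Finset.sum_eq_single k (by grind) (by simp), Finset.sum_eq_single i (by grind) (by simp)]
  grind

lemma flip₁₂_mul (A B : Mat₂ N) : flip₁₂ (A * B) = flip₁₂ A * flip₁₂ B := by
  ext ⟨i, k⟩ ⟨j, l⟩
  rw [flip₁₂_apply, Matrix.mul_apply, Matrix.mul_apply]
  exact (Equiv.sum_comp (Equiv.prodComm (Fin N) (Fin N))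
    fun c => A (k, i) c * B c (l, j)).symm

lemma flip₁₂_in₁ (A : Matrix (Fin N) (Fin N) ℂ) : flip₁₂ (in₁ A) = in₂ A := by
  ext ⟨i, k⟩ ⟨j, l⟩
  simp [flip₁₂_apply, in₁, in₂, mul_comm]

lemma in₂_mul_flip_rCM_apply (hτ : 0 < τ.im) (A : Matrix (Fin N) (Fin N) ℂ) (i k j l : Fin N) :
    (in₂ A * flip₁₂ (rCM τ q w z x)) (i, k) (j, l) =
      (if i = l then A k j * rCMSwap τ q w x z j i else 0)
        + if l = j ∧ j ≠ i then A k l * kronecker τ z (q i x - q j x) else 0 := by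
  rw [← flip₁₂_in₁, ← flip₁₂_mul, flip₁₂_apply, in₁_mul_rCM_apply hτ]

lemma flip_rCM_mul_in₂_apply (hτ : 0 < τ.im) (A : Matrix (Fin N) (Fin N) ℂ) (i k j l : Fin N) :
    (flip₁₂ (rCM τ q w z x) * in₂ A) (i, k) (j, l) =
      if k = j then rCMSwap τ q w x z k i * A i l
        + (if k ≠ i then kronecker τ z (q i x - q k x) * A k l else 0) else 0 := by
  rw [← flip₁₂_in₁, ← flip₁₂_mul, flip₁₂_apply, rCM_mul_in₁_apply hτ]

/-- Derivative of a function of a difference of two fields. -/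
lemma hasDerivAt_comp_sub {G : ℂ → ℂ} {g : ℂ} {q : Fin N → ℝ → ℂ} (hq : ∀ i, IsLoop (q i))
    (i j : Fin N) (x : ℝ) (hG : HasDerivAt G g (q i x - q j x)) :
    HasDerivAt (fun s => G (q i s - q j s)) (g * (alphaSq ν q i x - alphaSq ν q j x)) x := by
  have h := HasDerivAt.comp (h₂ := G) x hG (((hq i).hasDerivAt x).sub ((hq j).hasDerivAt x))
  refine h.congr_deriv ?_
  simp only [alphaSq]
  ring

lemma dx_rCM_apply (H : IsNondegenerate τ ν q p) (hw : theta τ w ≠ 0)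
    (hzw : theta τ (z - w) ≠ 0) (i k j l : Fin N) :
    dx (rCM τ q z w) x (i, k) (j, l) = (alphaSq ν q i x - alphaSq ν q k x) *
      ((if i = l ∧ k = j ∧ i ≠ k then kroneckerD τ (z - w) (q i x - q k x) else 0)
        - if i = j ∧ i = l ∧ i ≠ k then kroneckerD τ w (q k x - q i x) else 0) := by
  have hw' : theta τ (-w) ≠ 0 := by rw [theta_neg H.im_pos]; exact neg_ne_zero.2 hw
  simp only [dx, Matrix.of_apply, rCM_apply]
  refine HasDerivAt.deriv ?_
  rcases eq_or_ne i k with rfl | hik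
  · simpa using hasDerivAt_const x (if i = j ∧ i = l then E1 τ (z - w) + E1 τ w else 0)
  · have h1 := hasDerivAt_comp_sub (ν := ν) H.loop_q i k x
      (hasDerivAt_kronecker' H.im_pos hzw (H.theta_sub i k hik x))
    have h2 := hasDerivAt_comp_sub (ν := ν) H.loop_q i k x
      (hasDerivAt_kronecker' H.im_pos hw' (H.theta_sub i k hik x))
    rw [kroneckerD_neg_left H.im_pos] at h2
    have h3 : HasDerivAt (fun s => if i = l ∧ k = j ∧ i ≠ k then
        kronecker τ (z - w) (q i s - q k s) else 0) (if i = l ∧ k = j ∧ i ≠ k then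
        kroneckerD τ (z - w) (q i x - q k x) * (alphaSq ν q i x - alphaSq ν q k x) else 0) x := by
      split_ifs
      · exact h1
      · exact hasDerivAt_const _ _
    have h4 : HasDerivAt (fun s => if i = j ∧ i = l ∧ i ≠ k then
        kronecker τ (-w) (q i s - q k s) else 0) (if i = j ∧ i = l ∧ i ≠ k then
        kroneckerD τ w (q k x - q i x) * (alphaSq ν q i x - alphaSq ν q k x) else 0) x := by
      split_ifs
      · exact h2
      · exact hasDerivAt_const _ _
    refine (((hasDerivAt_const x (if i = k ∧ i = j ∧ i = l then E1 τ (z - w) + E1 τ w else 0)).add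
      h3).sub h4).congr_deriv ?_
    grind

/-- The entries of `∑ (α_j² - α_i²) (f(w,q_ji) E_ii ⊗ E_ji + E₂(q_ji) E_ii ⊗ E_jj)`. -/
def extraTerm (τ ν : ℂ) (q : Fin N → ℝ → ℂ) (w : ℂ) (x : ℝ) (i k j l : Fin N) : ℂ :=
  (alphaSq ν q k x - alphaSq ν q i x) *
    ((if i = j ∧ i = l ∧ i ≠ k then kroneckerD τ w (q k x - q i x) else 0)
      + if i = j ∧ k = l ∧ i ≠ k then E2 τ (q k x - q i x) else 0)

lemma extra_apply (i k j l : Fin N) :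
    (∑ i, ∑ j ∈ Finset.univ.erase i, (alphaSq ν q j x - alphaSq ν q i x) •
      (kroneckerD τ w (q j x - q i x) • EE i i j i + E2 τ (q j x - q i x) • EE i i j j))
      (i, k) (j, l) = extraTerm τ ν q w x i k j l := by
  simp only [smul_add, smul_smul, Finset.sum_add_distrib]
  rw [Matrix.add_apply, sum_erase_EE_col_apply, sum_erase_EE_diag_apply, extraTerm]
  grind

/-- The local term of the Maillet structure. All entries follow from the Fay identity and its
degeneration `kroneckerD_add`. -/
lemma localMaillet_apply (H : IsNondegenerate τ ν q p) (hz : theta τ z ≠ 0) (hw : theta τ w ≠ 0)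
    (hzw : theta τ (z - w) ≠ 0) (i k j l : Fin N) :
    localMaillet (UCM τ ν q P) (rCM τ q) z w x x (i, k) (j, l) =
      -extraTerm τ ν q w x i k j l - limitLocal τ ν q z w x i k j l := by
  have hτ := H.im_pos
  have hwz : theta τ (w - z) ≠ 0 := by rw [theta_sub_comm hτ]; exact neg_ne_zero.2 hzw
  have hθ : ∀ {a b : Fin N}, a ≠ b → theta τ (q a x - q b x) ≠ 0 := fun h => H.theta_sub _ _ h x
  -- the addition theorem for `z = (z - w) + w`, `w = (w - z) + z` and `z - w = z + (-w)`
  have F1 : ∀ {a b : Fin N}, a ≠ b → kroneckerD τ z (q a x - q b x) =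
      kronecker τ z (q a x - q b x) * (E1 τ (z - w) + E1 τ w)
        + kronecker τ (w - z) (q b x - q a x) * kronecker τ w (q a x - q b x) := fun {a b} hab => by
    have h := kroneckerD_add hτ hzw hw (by rwa [sub_add_cancel]) (hθ hab)
    rw [sub_add_cancel, kronecker_sub_comm hτ z w] at h
    linear_combination h
  have F2 : ∀ {a b : Fin N}, a ≠ b → kroneckerD τ w (q a x - q b x) =
      kronecker τ w (q a x - q b x) * (E1 τ (w - z) + E1 τ z)
        + kronecker τ (z - w) (q b x - q a x) * kronecker τ z (q a x - q b x) := fun {a b} hab => by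
    have h := kroneckerD_add hτ hwz hz (by rwa [sub_add_cancel]) (hθ hab)
    rw [sub_add_cancel, kronecker_sub_comm hτ w z] at h
    linear_combination h
  have F3 : ∀ {a b : Fin N}, a ≠ b → kroneckerD τ (z - w) (q a x - q b x) =
      kronecker τ (z - w) (q a x - q b x) * (E1 τ z - E1 τ w)
        + kronecker τ z (q a x - q b x) * kronecker τ w (q b x - q a x) := fun {a b} hab => by
    have h := kroneckerD_add hτ hz (b := -w) (by rw [theta_neg hτ]; exact neg_ne_zero.2 hw)
      (by rwa [← sub_eq_add_neg]) (hθ hab)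
    rw [← sub_eq_add_neg, E1_neg hτ, kronecker_neg_left hτ w] at h
    linear_combination h
  have F4 : ∀ {a b c : Fin N}, a ≠ b → b ≠ c → a ≠ c →
      kronecker τ z (q a x - q b x) * kronecker τ w (q b x - q c x) =
        kronecker τ (z - w) (q a x - q b x) * kronecker τ w (q a x - q c x) +
          kronecker τ (w - z) (q b x - q c x) * kronecker τ z (q a x - q c x) :=
    fun {a b c} hab hbc hac => by
      have h := kronecker_mul_kronecker hτ hz hw hzw (hθ hab) (hθ hbc)
        (by rw [sub_add_sub_cancel]; exact hθ hac)
      rwa [sub_add_sub_cancel] at h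
  have S : ∀ a b : Fin N, kronecker τ (w - z) (q a x - q b x) =
      -kronecker τ (z - w) (q b x - q a x) := fun a b => kronecker_sub_comm hτ w z _ _
  have S1 : E1 τ (w - z) = -E1 τ (z - w) := E1_sub_comm hτ w z
  have S2 : ∀ a b : Fin N, E2 τ (q a x - q b x) = E2 τ (q b x - q a x) := fun a b =>
    E2_sub_comm hτ _ _
  rw [localMaillet, Matrix.sub_apply, Matrix.add_apply, Matrix.neg_apply, dx_rCM_apply H hw hzw,
    comm, comm, Matrix.sub_apply, Matrix.sub_apply, in₁_mul_rCM_apply hτ, rCM_mul_in₁_apply hτ,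
    in₂_mul_flip_rCM_apply hτ, flip_rCM_mul_in₂_apply hτ]
  simp only [limitLocal, limitTotal, extraTerm, rCMSwap, UCM, Matrix.of_apply]
  by_cases hik : i = k
  · subst hik
    by_cases hjl : j = l
    · subst hjl
      by_cases hij : i = j
      · subst hij
        simp
        ring
      · have hji := Ne.symm hij
        simp [hij, hji]
        ring
    · have hlj := Ne.symm hjl
      by_cases hij : i = j
      · subst hij
        simp [hjl, hlj, S1]
        have h := F2 hjl
        rw [S1] at h
        linear_combination (-alphaSq ν q l x) * h
      · have hji := Ne.symm hij
        by_cases hil : i = l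
        · subst hil
          simp [hij, hji, S]
          have h := F1 hij
          rw [S] at h
          linear_combination (alphaSq ν q j x) * h
        · have hli := Ne.symm hil
          simp [hij, hji, hil, hli, hjl, hlj]
  · have hki := Ne.symm hik
    by_cases hjl : j = l
    · subst hjl
      by_cases hij : i = j
      · subst hij
        simp [hik, hki, S1]
        have h := F2 hki
        rw [S1] at h
        linear_combination (alphaSq ν q i x) * h
      · have hji := Ne.symm hij
        by_cases hkj : k = j
        · subst hkj
          simp [hik, hki, S]
          have h := F1 hik
          rw [S] at h
          linear_combination (-alphaSq ν q k x) * h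
        · have hjk := Ne.symm hkj
          simp [hij, hji, hik, hkj, hjk]
          ring
    · have hlj := Ne.symm hjl
      by_cases hij : i = j
      · subst hij
        by_cases hkl : k = l
        · subst hkl
          simp [hik, hki, S2 k i]
          ring
        · have hlk := Ne.symm hkl
          simp [hik, hki, hjl, hlj, hkl, hlk]
      · have hji := Ne.symm hij
        by_cases hil : i = l
        · subst hil
          by_cases hkj : k = j
          · subst hkj
            simp [hik, hki, S]
            have h := F3 hik
            linear_combination (alphaSq ν q k x - alphaSq ν q i x) * h
          · have hjk := Ne.symm hkj
            simp [hij, hji, hik, hki, hkj, S]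
            have h := kronecker_mul_kronecker hτ hw hz hwz (hθ hki) (hθ hij)
              (by rw [sub_add_sub_cancel]; exact hθ hkj)
            rw [sub_add_sub_cancel, S] at h
            linear_combination (-alphaSq ν q j x) * h
        · have hli := Ne.symm hil
          by_cases hkj : k = j
          · subst hkj
            have hlk := hlj
            simp [hik, hki, hil, hjl, hlj, S]
            have h := F4 hik hjl hil
            rw [S] at h
            linear_combination (alphaSq ν q l x) * h
          · have hjk := Ne.symm hkj
            by_cases hkl : k = l
            · subst hkl
              simp [hik, hki, hij, hji, hkj, hjk]
            · have hlk := Ne.symm hkl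
              simp [hik, hil, hij, hji, hkj, hkl, hlk, hjl, hlj]

end CMAlgebra

/-! ### The Poisson brackets of the Calogero-Moser field theory -/

section CMBracket

variable {N : ℕ} {τ ν : ℂ} {q p P : Fin N → ℝ → ℂ} {z w : ℂ} {φ χ : ℝ → ℂ}

lemma HasFunctionalDeriv.congr {F : (Fin N → ℝ → ℂ) → (Fin N → ℝ → ℂ) → ℂ}
    {gq gp gq' gp' : Fin N → ℝ → ℂ} (h : HasFunctionalDeriv F q p gq gp)
    (hq : ∀ a x, gq a x = gq' a x) (hp : ∀ a x, gp a x = gp' a x) :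
    HasFunctionalDeriv F q p gq' gp' := by
  obtain rfl : gq = gq' := funext fun a => funext (hq a)
  obtain rfl : gp = gp' := funext fun a => funext (hp a)
  exact h

lemma isLoop_ite {c : Prop} [Decidable c] {f g : ℝ → ℂ} (hf : c → IsLoop f) (hg : ¬c → IsLoop g) :
    IsLoop fun x => if c then f x else g x := by
  by_cases h : c
  · simpa only [if_pos h] using hf h
  · simpa only [if_neg h] using hg h

/-- The form in which integrations by parts are used: `k` is the periodic function whose derivative
the two integrands differ by. -/
lemma integral_congr_of_hasDerivAt {f g k : ℝ → ℂ} (hf : IsLoop f) (hg : IsLoop g) (hk : IsLoop k)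
    (h : ∀ x, HasDerivAt k (f x - g x) x) :
    ∫ x in (0 : ℝ)..(2 * Real.pi), f x = ∫ x in (0 : ℝ)..(2 * Real.pi), g x := by
  have h1 := hk.integral_deriv
  rw [funext fun x => (h x).deriv, intervalIntegral.integral_sub (hf.intervalIntegrable _ _)
    (hg.intervalIntegrable _ _)] at h1
  exact sub_eq_zero.1 h1

lemma alphaSq_variation (hq : ∀ i, IsLoop (q i)) {h : Fin N → ℝ → ℂ} (hh : ∀ i, IsLoop (h i))
    (t : ℂ) (i : Fin N) : alphaSq ν (fun a x => q a x + t * h a x) i =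
      fun x => alphaSq ν q i x + t * deriv (h i) x := by
  funext x
  have h1 := ((hq i).hasDerivAt x).fun_add (((hh i).hasDerivAt x).const_mul t)
  rw [alphaSq, h1.deriv, alphaSq]
  ring

lemma alphaLogD_variation (H : IsNondegenerate τ ν q p) {h : Fin N → ℝ → ℂ}
    (hh : ∀ i, IsLoop (h i)) (t : ℂ) (i : Fin N) (x : ℝ) :
    alphaLogD ν (fun a x => q a x + t * h a x) i x =
      (deriv (alphaSq ν q i) x + t * deriv (deriv (h i)) x) /
        (2 * (alphaSq ν q i x + t * deriv (h i) x)) := by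
  have h1 := ((H.isLoop_alphaSq i).hasDerivAt x).fun_add (((hh i).deriv.hasDerivAt x).const_mul t)
  rw [alphaLogD, alphaSq_variation H.loop_q hh, h1.deriv]

/-- The derivative of `α_{i,x} / α_i` in `q_{i,xx}`. -/
def alphaLogCoeff (ν : ℂ) (q : Fin N → ℝ → ℂ) (i : Fin N) (x : ℝ) : ℂ := (2 * alphaSq ν q i x)⁻¹

lemma isLoop_alphaLogCoeff (H : IsNondegenerate τ ν q p) (i : Fin N) :
    IsLoop (alphaLogCoeff ν q i) :=
  ((isLoop_const 2).mul (H.isLoop_alphaSq i)).inv fun x =>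
    mul_ne_zero two_ne_zero (H.alphaSq_ne i x)

lemma deriv_alphaLogCoeff (H : IsNondegenerate τ ν q p) (i : Fin N) (x : ℝ) :
    deriv (alphaLogCoeff ν q i) x =
      -deriv (alphaSq ν q i) x / (2 * alphaSq ν q i x ^ 2) := by
  have h := H.alphaSq_ne i x
  have h1 := (((H.isLoop_alphaSq i).hasDerivAt x).const_mul 2).fun_inv (mul_ne_zero two_ne_zero h)
  refine h1.deriv.trans ?_
  field_simp

lemma hasDerivAt_line (a b : ℂ) : HasDerivAt (fun t : ℂ => a + t * b) b 0 := by
  simpa using ((hasDerivAt_id (0 : ℂ)).mul_const b).const_add a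

lemma hasDerivAt_alphaSq_variation (hq : ∀ i, IsLoop (q i)) {h : Fin N → ℝ → ℂ}
    (hh : ∀ i, IsLoop (h i)) (i : Fin N) (x : ℝ) :
    HasDerivAt (fun t : ℂ => alphaSq ν (fun a x => q a x + t * h a x) i x)
      (deriv (h i) x) 0 := by
  simp only [alphaSq_variation hq hh]
  exact hasDerivAt_line _ _

lemma hasDerivAt_alphaLogD_variation (H : IsNondegenerate τ ν q p) {h : Fin N → ℝ → ℂ}
    (hh : ∀ i, IsLoop (h i)) (i : Fin N) (x : ℝ) :
    HasDerivAt (fun t : ℂ => alphaLogD ν (fun a x => q a x + t * h a x) i x)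
      (deriv (alphaLogCoeff ν q i) x * deriv (h i) x
        + alphaLogCoeff ν q i x * deriv (deriv (h i)) x) 0 := by
  simp only [alphaLogD_variation H hh]
  have hne := H.alphaSq_ne i x
  have h1 := (hasDerivAt_line (deriv (alphaSq ν q i) x) (deriv (deriv (h i)) x)).fun_div
    ((hasDerivAt_line (alphaSq ν q i x) (deriv (h i) x)).const_mul 2) (by simpa using hne)
  refine h1.congr_deriv ?_
  rw [deriv_alphaLogCoeff H, alphaLogCoeff]
  simp only [zero_mul, add_zero]
  field_simp
  ring

lemma contDiffAt_alphaSq_variation (H : IsNondegenerate τ ν q p) {h : Fin N → ℝ → ℂ}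
    (hh : ∀ i, IsLoop (h i)) (i : Fin N) (s : ℂ × ℝ) :
    ContDiffAt ℝ 1 (fun s : ℂ × ℝ => alphaSq ν (fun a x => q a x + s.1 * h a x) i s.2) s := by
  simp only [alphaSq_variation H.loop_q hh]
  exact contDiffAt_variation' (H.isLoop_alphaSq i) (hh i).deriv s

lemma contDiffAt_alphaLogD_variation (H : IsNondegenerate τ ν q p) {h : Fin N → ℝ → ℂ}
    (hh : ∀ i, IsLoop (h i)) (i : Fin N) (x : ℝ) :
    ContDiffAt ℝ 1 (fun s : ℂ × ℝ => alphaLogD ν (fun a x => q a x + s.1 * h a x) i s.2)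
      (0, x) := by
  simp only [alphaLogD_variation H hh]
  exact contDiffAt_fun_div (contDiffAt_variation' (H.isLoop_alphaSq i).deriv (hh i).deriv.deriv _)
    (contDiffAt_const.mul (contDiffAt_variation' (H.isLoop_alphaSq i) (hh i).deriv _))
    (by simpa using H.alphaSq_ne i x)

lemma contDiffAt_sub_variation (H : IsNondegenerate τ ν q p) {h : Fin N → ℝ → ℂ}
    (hh : ∀ i, IsLoop (h i)) {G : ℂ → ℂ} {i j : Fin N} {x : ℝ}
    (hG : AnalyticAt ℂ G (q i x - q j x)) :
    ContDiffAt ℝ 1 (fun s : ℂ × ℝ => G ((q i s.2 + s.1 * h i s.2) - (q j s.2 + s.1 * h j s.2)))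
      (0, x) :=
  ContDiffAt.comp (g := G) (0, x) ((by simpa using hG : AnalyticAt ℂ G
      (q i x + 0 * h i x - (q j x + 0 * h j x))).contDiffAt.restrict_scalars ℝ)
    ((contDiffAt_variation' (H.loop_q i) (hh i) _).sub
      (contDiffAt_variation' (H.loop_q j) (hh j) _))

lemma hasDerivAt_sub_variation (q h : Fin N → ℝ → ℂ) {G : ℂ → ℂ} {g : ℂ} {i j : Fin N} {x : ℝ}
    (hG : HasDerivAt G g (q i x - q j x)) :
    HasDerivAt (fun t : ℂ => G ((q i x + t * h i x) - (q j x + t * h j x)))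
      (g * (h i x - h j x)) 0 :=
  HasDerivAt.comp (h₂ := G) 0 (by simpa using hG)
    ((hasDerivAt_line (q i x) (h i x)).fun_sub (hasDerivAt_line (q j x) (h j x)))

/-- The functional derivative in `q_a`, at fixed `P`, of the entry `U_kl` of the Calogero-Moser
matrix, smeared with `φ`. On the diagonal the terms with `φ` itself cancel. -/
def gradUCM (τ ν : ℂ) (q : Fin N → ℝ → ℂ) (z : ℂ) (φ : ℝ → ℂ) (k l a : Fin N) (x : ℝ) : ℂ :=
  if k = l then
    if a = k then -(E1 τ z * deriv φ x) - deriv (fun s => deriv φ s * alphaLogCoeff ν q k s) x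
    else 0
  else if a = k then φ x * (kroneckerD τ z (q k x - q l x) * alphaSq ν q l x)
  else if a = l then -(φ x * (kroneckerD τ z (q k x - q l x) * alphaSq ν q k x)
    + deriv φ x * kronecker τ z (q k x - q l x))
  else 0

lemma deriv_fun_mul (hφ : IsLoop φ) (hχ : IsLoop χ) :
    deriv (fun x => φ x * χ x) = fun x => deriv φ x * χ x + φ x * deriv χ x :=
  funext fun x => ((hφ.hasDerivAt x).fun_mul (hχ.hasDerivAt x)).deriv

lemma deriv_deriv_mul (hφ : IsLoop φ) (hχ : IsLoop χ) (x : ℝ) :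
    deriv (deriv fun s => φ s * χ s) x =
      deriv (fun s => deriv φ s * χ s) x + deriv (fun s => φ s * deriv χ s) x := by
  rw [deriv_fun_mul hφ hχ]
  exact (((hφ.deriv.mul hχ).hasDerivAt x).fun_add ((hφ.mul hχ.deriv).hasDerivAt x)).deriv

lemma hasFunctionalDeriv_UCM (H : IsNondegenerate τ ν q p) (hP : ∀ i, IsLoop (P i))
    (hz : theta τ z ≠ 0) (hφ : IsLoop φ) (k l : Fin N) :
    HasFunctionalDeriv (smear φ fun Q P x => UCM τ ν Q P z x k l) q P
      (gradUCM τ ν q z φ k l) (fun a x => if k = l ∧ a = k then φ x else 0) := by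
  have h0 : ∀ _ : Fin N, IsLoop fun _ : ℝ => (0 : ℂ) := fun _ => isLoop_const 0
  have hγ := isLoop_alphaLogCoeff H k
  rcases eq_or_ne k l with rfl | hkl
  · have h := hasFunctionalDeriv_smear (ε := 0) (q := q) (p := P)
      (A := fun Q P x => UCM τ ν Q P z x k k) (D0 := fun _ _ => 0)
      (D1 := fun a x => if a = k then E1 τ z - deriv (alphaLogCoeff ν q k) x else 0)
      (D2 := fun a x => if a = k then -alphaLogCoeff ν q k x else 0) (Dm := fun _ _ => 0)
      (Dp := fun a _ => if a = k then 1 else 0) hφ h0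
      (fun a => isLoop_ite (fun _ => (isLoop_const _).sub hγ.deriv) fun _ => isLoop_const 0)
      (fun a => isLoop_ite (fun _ => hγ.neg) fun _ => isLoop_const 0) h0
      (fun a => isLoop_ite (fun _ => isLoop_const 1) fun _ => isLoop_const 0)
      (fun h m hh hm x => by
        simp only [UCM, Matrix.of_apply, if_true]
        exact ((contDiffAt_variation' (hP k) (hm k) _).add
          ((contDiffAt_alphaSq_variation H hh k _).mul contDiffAt_const)).sub
            (contDiffAt_alphaLogD_variation H hh k x))
      (fun h m hh hm x => by
        simp only [UCM, Matrix.of_apply, if_true]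
        refine (((hasDerivAt_line (P k x) (m k x)).fun_add
          ((hasDerivAt_alphaSq_variation H.loop_q hh k x).mul_const (E1 τ z))).fun_sub
            (hasDerivAt_alphaLogD_variation H hh k x)).congr_deriv ?_
        simp only [zero_mul, ite_mul, add_zero, zero_add, Finset.sum_add_distrib,
          Finset.sum_ite_eq', Finset.mem_univ, if_true]
        ring)
    refine h.congr (fun a x => ?_) fun a x => by simp
    rcases eq_or_ne a k with rfl | hak
    · simp only [gradUCM, if_true, mul_zero, add_zero]
      have e1 : (fun s => φ s * (E1 τ z - deriv (alphaLogCoeff ν q a) s)) =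
          fun s => E1 τ z * φ s - φ s * deriv (alphaLogCoeff ν q a) s := by funext s; ring
      have e2 : (fun s => φ s * -alphaLogCoeff ν q a s) =
          fun s => (-φ s) * alphaLogCoeff ν q a s := by funext s; ring
      have e3 : (fun s => deriv (fun x => -φ x) s * alphaLogCoeff ν q a s) =
          fun s => -(deriv φ s * alphaLogCoeff ν q a s) := by
        funext s; rw [deriv.fun_neg]; ring
      have e4 : (fun s => -φ s * deriv (alphaLogCoeff ν q a) s) =
          fun s => -(φ s * deriv (alphaLogCoeff ν q a) s) := by funext s; ring
      have e5 := (((hφ.hasDerivAt x).const_mul (E1 τ z)).fun_sub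
        ((hφ.mul hγ.deriv).hasDerivAt x)).deriv
      rw [e1, e5, e2, deriv_deriv_mul hφ.neg hγ, e3, e4, deriv.fun_neg, deriv.fun_neg]
      ring
    · simp [gradUCM, hak]
  · have hK := H.isLoop_kronecker hz hkl
    have hf := (H.isLoop_kroneckerD hz hkl).mul (H.isLoop_alphaSq l)
    have h := hasFunctionalDeriv_smear (ε := 0) (q := q) (p := P)
      (A := fun Q P x => UCM τ ν Q P z x k l)
      (D0 := fun a x => (if a = k then kroneckerD τ z (q k x - q l x) * alphaSq ν q l x else 0)
        - if a = l then kroneckerD τ z (q k x - q l x) * alphaSq ν q l x else 0)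
      (D1 := fun a x => if a = l then kronecker τ z (q k x - q l x) else 0)
      (D2 := fun _ _ => 0) (Dm := fun _ _ => 0) (Dp := fun _ _ => 0) hφ
      (fun a => (isLoop_ite (fun _ => hf) fun _ => isLoop_const 0).sub
        (isLoop_ite (fun _ => hf) fun _ => isLoop_const 0))
      (fun a => isLoop_ite (fun _ => hK) fun _ => isLoop_const 0) h0 h0 h0
      (fun h m hh hm x => by
        simp only [UCM, Matrix.of_apply, if_neg hkl]
        exact (contDiffAt_sub_variation H hh (G := fun v => kronecker τ z v)
          (analyticAt_kronecker H.im_pos hz (H.theta_sub k l hkl x))).mul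
            (contDiffAt_alphaSq_variation H hh l _))
      (fun h m hh hm x => by
        simp only [UCM, Matrix.of_apply, if_neg hkl]
        refine ((hasDerivAt_sub_variation q h (hasDerivAt_kronecker' H.im_pos hz
          (H.theta_sub k l hkl x))).fun_mul
            (hasDerivAt_alphaSq_variation H.loop_q hh l x)).congr_deriv ?_
        simp only [zero_mul, ite_mul, sub_mul, add_zero, Finset.sum_add_distrib,
          Finset.sum_sub_distrib, Finset.sum_ite_eq', Finset.mem_univ, if_true]
        ring)
    refine h.congr (fun a x => ?_) fun a x => by simp [hkl]
    rcases eq_or_ne a l with rfl | hal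
    · have hd := ((hφ.hasDerivAt x).fun_mul (hasDerivAt_comp_sub (ν := ν) H.loop_q k a x
        (hasDerivAt_kronecker' H.im_pos hz (H.theta_sub k a hkl x)))).deriv
      simp only [gradUCM, if_neg hkl, if_neg hkl.symm, if_true, mul_zero, add_zero, deriv_const',
        hd]
      ring
    · simp [gradUCM, hkl, hal]

/-- The functional derivative in `q_a`, at fixed `p`, of the momentum `P_i` smeared with `φ`. -/
def gradMomentum (τ ν : ℂ) (q : Fin N → ℝ → ℂ) (φ : ℝ → ℂ) (i a : Fin N) (x : ℝ) : ℂ :=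
  if a = i then φ x * (∑ m ∈ Finset.univ.erase i, alphaSq ν q m x * E2 τ (q i x - q m x))
    + deriv (fun s => deriv φ s * alphaLogCoeff ν q i s) x
  else deriv φ x * E1 τ (q i x - q a x) - φ x * (alphaSq ν q i x * E2 τ (q i x - q a x))

lemma hasFunctionalDeriv_momentumCM (H : IsNondegenerate τ ν q p) (hφ : IsLoop φ) (i : Fin N) :
    HasFunctionalDeriv (smear φ fun Q P => momentumCM τ ν Q P i) q p
      (gradMomentum τ ν q φ i) (fun a x => if a = i then φ x else 0) := by
  have hγ := isLoop_alphaLogCoeff H i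
  have hne : ∀ {m}, m ∈ Finset.univ.erase i → i ≠ m := fun hm => (Finset.ne_of_mem_erase hm).symm
  have h := hasFunctionalDeriv_smear (ε := 0) (q := q) (p := p)
    (A := fun Q P => momentumCM τ ν Q P i)
    (D0 := fun a x => if a = i then
      ∑ m ∈ Finset.univ.erase i, alphaSq ν q m x * E2 τ (q i x - q m x)
      else -(alphaSq ν q a x * E2 τ (q i x - q a x)))
    (D1 := fun a x => if a = i then deriv (alphaLogCoeff ν q i) x else -E1 τ (q i x - q a x))
    (D2 := fun a x => if a = i then alphaLogCoeff ν q i x else 0) (Dm := fun _ _ => 0)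
    (Dp := fun a _ => if a = i then 1 else 0) hφ
    (fun a => isLoop_ite (fun _ => .sum fun m hm => (H.isLoop_alphaSq m).mul
      (H.isLoop_E2_sub (hne hm)))
      fun h => ((H.isLoop_alphaSq a).mul (H.isLoop_E2_sub (Ne.symm h))).neg)
    (fun a => isLoop_ite (fun _ => hγ.deriv) fun h => (H.isLoop_E1_sub (Ne.symm h)).neg)
    (fun a => isLoop_ite (fun _ => hγ) fun _ => isLoop_const 0) (fun _ => isLoop_const 0)
    (fun a => isLoop_ite (fun _ => isLoop_const 1) fun _ => isLoop_const 0)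
    (fun h m hh hm x => by
      simp only [momentumCM]
      exact ((contDiffAt_variation' (H.loop_p i) (hm i) _).sub (ContDiffAt.sum fun m hm =>
        (contDiffAt_alphaSq_variation H hh m _).mul (contDiffAt_sub_variation H hh
          (analyticAt_E1 H.im_pos (H.theta_sub i m (hne hm) x))))).add
            (contDiffAt_alphaLogD_variation H hh i x))
    (fun h m hh hm x => by
      simp only [momentumCM]
      refine (((hasDerivAt_line (p i x) (m i x)).fun_sub (HasDerivAt.fun_sum fun m hm =>
        (hasDerivAt_alphaSq_variation H.loop_q hh m x).fun_mul (hasDerivAt_sub_variation q h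
          (hasDerivAt_E1 H.im_pos (H.theta_sub i m (hne hm) x))))).fun_add
            (hasDerivAt_alphaLogD_variation H hh i x)).congr_deriv ?_
      rw [← Finset.add_sum_erase _ _ (Finset.mem_univ i)]
      have e : ∀ a ∈ Finset.univ.erase i,
          ((if a = i then ∑ m ∈ Finset.univ.erase i, alphaSq ν q m x * E2 τ (q i x - q m x)
            else -(alphaSq ν q a x * E2 τ (q i x - q a x))) * h a x
          + (if a = i then deriv (alphaLogCoeff ν q i) x else -E1 τ (q i x - q a x)) *
            deriv (h a) x
          + (if a = i then alphaLogCoeff ν q i x else 0) * deriv (deriv (h a)) x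
          + 0 * h a (x - 0) + (if a = i then 1 else 0) * m a x) =
          -(deriv (h a) x * E1 τ (q i x - q a x)
            + alphaSq ν q a x * (-E2 τ (q i x - q a x) * (h i x - h a x)))
          - alphaSq ν q a x * E2 τ (q i x - q a x) * h i x := fun a ha => by
        simp only [if_neg (Finset.ne_of_mem_erase ha)]
        ring
      rw [Finset.sum_congr rfl e, Finset.sum_sub_distrib, Finset.sum_neg_distrib,
        ← Finset.sum_mul]
      simp only [zero_mul, add_zero, if_true]
      ring)
  refine h.congr (fun a x => ?_) fun a x => by simp
  rcases eq_or_ne a i with rfl | hai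
  · simp only [gradMomentum, if_true, mul_zero, add_zero, deriv_deriv_mul hφ hγ]
    ring
  · have hd := ((hφ.hasDerivAt x).fun_mul (hasDerivAt_comp_sub (ν := ν) H.loop_q i a x
      (hasDerivAt_E1 H.im_pos (H.theta_sub i a hai.symm x))).fun_neg).deriv
    simp only [gradMomentum, if_neg hai, mul_zero, add_zero, deriv_const', hd]
    ring

lemma hasFunctionalDeriv_position (q p : Fin N → ℝ → ℂ) (hq : ∀ i, IsLoop (q i)) (hχ : IsLoop χ)
    (j : Fin N) : HasFunctionalDeriv (smear χ fun Q _ => Q j) q p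
      (fun a x => if a = j then χ x else 0) (fun _ _ => 0) := by
  have h0 : ∀ _ : Fin N, IsLoop fun _ : ℝ => (0 : ℂ) := fun _ => isLoop_const 0
  have h := hasFunctionalDeriv_smear (ε := 0) (q := q) (p := p) (A := fun Q _ => Q j)
    (D0 := fun a _ => if a = j then 1 else 0) (D1 := fun _ _ => 0) (D2 := fun _ _ => 0)
    (Dm := fun _ _ => 0) (Dp := fun _ _ => 0) hχ
    (fun a => isLoop_ite (fun _ => isLoop_const 1) fun _ => isLoop_const 0) h0 h0 h0 h0
    (fun h m hh _ x => contDiffAt_variation' (hq j) (hh j) _)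
    (fun h m _ _ x => by simpa using hasDerivAt_line (q j x) (h j x))
  exact h.congr (fun a x => by simp) fun a x => by simp

lemma hasPoissonBracket_momentumCM (H : IsNondegenerate τ ν q p) (hφ : IsLoop φ) (hχ : IsLoop χ)
    (i j : Fin N) :
    HasPoissonBracket (smear φ fun Q P => momentumCM τ ν Q P i)
      (smear χ fun Q P => momentumCM τ ν Q P j) q p 0 := by
  have h1 := hasFunctionalDeriv_momentumCM H hφ i
  have h2 := hasFunctionalDeriv_momentumCM H hχ j
  refine ⟨_, _, _, _, h1, h2, ?_⟩
  have hl1 : ∀ a, IsLoop fun x => (if a = i then φ x else 0) * gradMomentum τ ν q χ j a x :=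
    fun a => (h1.2.1 a).mul (h2.1 a)
  have hl2 : ∀ a, IsLoop fun x => gradMomentum τ ν q φ i a x * (if a = j then χ x else 0) :=
    fun a => (h1.1 a).mul (h2.2.1 a)
  rw [← intervalIntegral.integral_finsetSum fun a _ =>
    ((hl1 a).sub (hl2 a)).intervalIntegrable _ _]
  simp only [Finset.sum_sub_distrib, ite_mul, mul_ite, zero_mul, mul_zero, Finset.sum_ite_eq',
    Finset.mem_univ, if_true]
  have hA : IsLoop fun x => φ x * gradMomentum τ ν q χ j i x := hφ.mul (h2.1 i)
  have hB : IsLoop fun x => gradMomentum τ ν q φ i j x * χ x := (h1.1 j).mul hχ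
  rw [intervalIntegral.integral_sub (hA.intervalIntegrable _ _) (hB.intervalIntegrable _ _),
    eq_comm, sub_eq_zero]
  rcases eq_or_ne i j with rfl | hij
  · have hγ := isLoop_alphaLogCoeff H i
    refine integral_congr_of_hasDerivAt hA hB ((hφ.mul (hχ.deriv.mul hγ)).sub
      ((hφ.deriv.mul hγ).mul hχ)) fun x => ?_
    refine (((hφ.hasDerivAt x).fun_mul ((hχ.deriv.mul hγ).hasDerivAt x)).fun_sub
      (((hφ.deriv.mul hγ).hasDerivAt x).fun_mul (hχ.hasDerivAt x))).congr_deriv ?_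
    simp only [gradMomentum, if_true]
    ring
  · refine integral_congr_of_hasDerivAt hA hB ((hφ.mul hχ).mul (H.isLoop_E1_sub hij.symm))
      fun x => ?_
    refine (((hφ.hasDerivAt x).fun_mul (hχ.hasDerivAt x)).fun_mul (hasDerivAt_comp_sub (ν := ν)
      H.loop_q j i x (hasDerivAt_E1 H.im_pos (H.theta_sub j i hij.symm x)))).congr_deriv ?_
    simp only [gradMomentum, if_neg hij, if_neg hij.symm]
    rw [E1_sub_comm H.im_pos (q i x), E2_sub_comm H.im_pos (q i x)]
    ring

lemma hasPoissonBracket_momentumCM_position (H : IsNondegenerate τ ν q p) (hφ : IsLoop φ)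
    (hχ : IsLoop χ) (i j : Fin N) :
    HasPoissonBracket (smear φ fun Q P => momentumCM τ ν Q P i) (smear χ fun Q _ => Q j) q p
      (if i = j then ∫ x in (0 : ℝ)..(2 * Real.pi), φ x * χ x else 0) := by
  refine ⟨_, _, _, _, hasFunctionalDeriv_momentumCM H hφ i,
    hasFunctionalDeriv_position q p H.loop_q hχ j, ?_⟩
  have h : ∀ a : Fin N, (∫ x in (0 : ℝ)..(2 * Real.pi), ((if a = i then φ x else 0) *
      (if a = j then χ x else 0) - gradMomentum τ ν q φ i a x * 0)) =
      if a = i then if i = j then ∫ x in (0 : ℝ)..(2 * Real.pi), φ x * χ x else 0 else 0 :=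
    fun a => by
      rcases eq_or_ne a i with rfl | hai
      · rcases eq_or_ne a j with rfl | haj
        · simp
        · simp [haj]
      · simp [hai]
  rw [Finset.sum_congr rfl fun a _ => h a]
  simp

end CMBracket

/-! ### The Maillet structure -/

section Maillet

variable {N : ℕ} {τ ν : ℂ} {q p P : Fin N → ℝ → ℂ} {z w : ℂ} {φ χ : ℝ → ℂ} {ψ : ℝ → ℝ → ℂ}

lemma IsLoop.isTest₂_mul (hφ : IsLoop φ) (hχ : IsLoop χ) : IsTest₂ fun x y => φ x * χ y :=
  ⟨(hφ.1.comp contDiff_fst).mul (hχ.1.comp contDiff_snd), fun x y => by simp only [hφ.2 x],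
    fun x y => by simp only [hχ.2 y]⟩

/-- `∂₁ψ(x, x)`. -/
def partialFst (ψ : ℝ → ℝ → ℂ) (x : ℝ) : ℂ := deriv (fun s => ψ s x) x

/-- `∂₂ψ(x, x)`. -/
def partialSnd (ψ : ℝ → ℝ → ℂ) (x : ℝ) : ℂ := deriv (fun s => ψ x s) x

lemma IsTest₂.swap (h : IsTest₂ ψ) : IsTest₂ fun x y => ψ y x :=
  ⟨h.1.comp (contDiff_snd.prodMk contDiff_fst), fun x y => h.2.2 y x, fun x y => h.2.1 y x⟩

lemma IsTest₂.isLoop_diag (h : IsTest₂ ψ) : IsLoop fun x => ψ x x :=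
  ⟨h.1.comp (contDiff_id.prodMk contDiff_id), fun x =>
    (h.2.1 x _).trans (h.2.2 x x)⟩

lemma IsTest₂.hasDerivAt_fst (h : IsTest₂ ψ) (x y : ℝ) :
    HasDerivAt (fun s => ψ s y) (fderiv ℝ (fun s : ℝ × ℝ => ψ s.1 s.2) (x, y) (1, 0)) x :=
  HasFDerivAt.comp_hasDerivAt (l := fun s : ℝ × ℝ => ψ s.1 s.2) (f := fun s => (s, y)) x
    ((h.1.differentiable (by simp)) (x, y)).hasFDerivAt
    ((hasDerivAt_id x).prodMk (hasDerivAt_const x y))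

lemma IsTest₂.partialFst_eq (h : IsTest₂ ψ) (x : ℝ) :
    partialFst ψ x = fderiv ℝ (fun s : ℝ × ℝ => ψ s.1 s.2) (x, x) (1, 0) :=
  (h.hasDerivAt_fst x x).deriv

lemma IsTest₂.isLoop_partialFst (h : IsTest₂ ψ) : IsLoop (partialFst ψ) := by
  refine ⟨?_, fun x => ?_⟩
  · rw [funext h.partialFst_eq]
    exact ((h.1.fderiv_right (m := ∞) (by simp)).comp (contDiff_id.prodMk contDiff_id)).clm_apply
      contDiff_const
  · simp only [partialFst, h.2.2]
    rw [← deriv_comp_add_const]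
    simp only [h.2.1]

lemma IsTest₂.isLoop_partialSnd (h : IsTest₂ ψ) : IsLoop (partialSnd ψ) :=
  h.swap.isLoop_partialFst

lemma IsTest₂.hasDerivAt_partialFst (h : IsTest₂ ψ) (x : ℝ) :
    HasDerivAt (fun s => ψ s x) (partialFst ψ x) x :=
  (h.hasDerivAt_fst x x).differentiableAt.hasDerivAt

lemma IsTest₂.hasDerivAt_partialSnd (h : IsTest₂ ψ) (x : ℝ) :
    HasDerivAt (fun s => ψ x s) (partialSnd ψ x) x :=
  h.swap.hasDerivAt_partialFst x

lemma IsTest₂.hasDerivAt_diag (h : IsTest₂ ψ) (x : ℝ) :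
    HasDerivAt (fun s => ψ s s) (partialFst ψ x + partialSnd ψ x) x := by
  have h1 := ((h.1.differentiable (by simp)) (x, x)).hasFDerivAt
  have h2 := HasFDerivAt.comp_hasDerivAt (l := fun s : ℝ × ℝ => ψ s.1 s.2) (f := fun s => (s, s)) x
    h1 ((hasDerivAt_id x).prodMk (hasDerivAt_id x))
  have h3 := HasFDerivAt.comp_hasDerivAt (l := fun s : ℝ × ℝ => ψ s.1 s.2) (f := fun s => (x, s)) x
    h1 ((hasDerivAt_const x x).prodMk (hasDerivAt_id x))
  refine h2.congr_deriv ?_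
  rw [h.partialFst_eq, (h.hasDerivAt_partialSnd x).unique h3, ← map_add]
  simp

lemma isLoop_limitShifted (H : IsNondegenerate τ ν q p) (hz : theta τ z ≠ 0) (a k l : Fin N) :
    IsLoop fun x => limitShifted τ q z x a k l :=
  isLoop_ite (fun _ => isLoop_ite (fun _ => isLoop_const _) fun h => H.isLoop_E1_sub h) fun h =>
    isLoop_ite (fun _ => H.isLoop_kronecker hz h) fun _ => isLoop_const 0

lemma isLoop_limitTotal (H : IsNondegenerate τ ν q p) (hz : theta τ z ≠ 0) (a k l : Fin N) :
    IsLoop fun x => limitTotal τ ν q z x a k l :=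
  isLoop_ite (fun _ => isLoop_ite
      (fun _ => .sum fun b hb => (H.isLoop_alphaSq b).mul
        (H.isLoop_E2_sub (Finset.ne_of_mem_erase hb).symm))
      fun h => ((H.isLoop_kroneckerD hz h).mul (H.isLoop_alphaSq l)).neg)
    fun h => isLoop_ite
      (fun _ => ((H.isLoop_alphaSq a).mul (H.isLoop_E2_sub (Ne.symm h))).neg)
      fun h => isLoop_ite (fun _ => (H.isLoop_kroneckerD hz h).mul (H.isLoop_alphaSq l))
        fun _ => isLoop_const 0

lemma isLoop_limitLocal (H : IsNondegenerate τ ν q p) (hz : theta τ z ≠ 0) (hw : theta τ w ≠ 0)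
    (i k j l : Fin N) : IsLoop fun x => limitLocal τ ν q z w x i k j l :=
  (isLoop_ite (fun _ => isLoop_limitTotal H hz l i j) fun _ => isLoop_const 0).sub
    (isLoop_ite (fun _ => isLoop_limitTotal H hw j k l) fun _ => isLoop_const 0)

/-- The nonsymmetric term `∑ (α_j² - α_i²) (…)` of the local part is the derivative of the
contribution of `δ(x - y + ε)` to the coefficient of `δ'(x - y)`. -/
lemma hasDerivAt_limitShifted (H : IsNondegenerate τ ν q p) (hw : theta τ w ≠ 0) (i k l : Fin N)
    (x : ℝ) : HasDerivAt (fun s => limitShifted τ q w s i k l) (extraTerm τ ν q w x i k i l) x := by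
  have h0 := hasDerivAt_const (𝕜 := ℝ) x (0 : ℂ)
  rcases eq_or_ne i l with rfl | hil
  · rcases eq_or_ne k i with rfl | hki
    · simpa [limitShifted, extraTerm] using hasDerivAt_const (𝕜 := ℝ) x (E1 τ w)
    · have e : extraTerm τ ν q w x i k i i =
          kroneckerD τ w (q k x - q i x) * (alphaSq ν q k x - alphaSq ν q i x) := by
        simp [extraTerm, hki, hki.symm]
        ring
      rw [e]
      simpa [limitShifted, hki] using hasDerivAt_comp_sub (ν := ν) H.loop_q k i x
        (hasDerivAt_kronecker' H.im_pos hw (H.theta_sub k i hki x))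
  · rcases eq_or_ne k l with rfl | hkl
    · have e : extraTerm τ ν q w x i k i k =
          -E2 τ (q i x - q k x) * (alphaSq ν q i x - alphaSq ν q k x) := by
        rw [E2_sub_comm H.im_pos (q i x)]
        simp [extraTerm, hil]
        ring
      rw [e]
      simpa only [limitShifted, if_true, if_neg hil] using hasDerivAt_comp_sub (ν := ν) H.loop_q
        i k x (hasDerivAt_E1 H.im_pos (H.theta_sub i k hil x))
    · simpa [limitShifted, extraTerm, hil, hkl] using h0

lemma isLoop_extraTerm (H : IsNondegenerate τ ν q p) (hw : theta τ w ≠ 0) (i k j l : Fin N) :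
    IsLoop fun x => extraTerm τ ν q w x i k j l :=
  ((H.isLoop_alphaSq k).sub (H.isLoop_alphaSq i)).mul
    ((isLoop_ite (fun h => H.isLoop_kroneckerD hw (Ne.symm h.2.2)) fun _ => isLoop_const 0).add
      (isLoop_ite (fun h => H.isLoop_E2_sub (Ne.symm h.2.2)) fun _ => isLoop_const 0))

/-- The Maillet structure after an integration by parts: a term `∂₁ψ` from each entry with `i = j`
and a term `∂₂ψ` from each entry with `k = l`. -/
lemma rhsMaillet_apply (H : IsNondegenerate τ ν q p) (hz : theta τ z ≠ 0) (hw : theta τ w ≠ 0)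
    (hzw : theta τ (z - w) ≠ 0) (hψ : IsTest₂ ψ) (i k j l : Fin N) :
    rhsMaillet (UCM τ ν q P) (rCM τ q) z w ψ (i, k) (j, l) =
      ∫ x in (0 : ℝ)..(2 * Real.pi), (-(ψ x x * limitLocal τ ν q z w x i k j l)
        + (if i = j then partialFst ψ x * limitShifted τ q w x j k l else 0)
        - if k = l then partialSnd ψ x * limitShifted τ q z x l i j else 0) := by
  have hS := isLoop_limitShifted H hw j k l
  have hT := isLoop_limitShifted H hz l i j
  have hL := isLoop_limitLocal H hz hw i k j l
  have hX := isLoop_extraTerm H hw i k j l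
  have hd := hψ.isLoop_diag
  have h1 := hψ.isLoop_partialFst
  have h2 := hψ.isLoop_partialSnd
  simp only [rhsMaillet, Matrix.sub_apply, pairDelta, pairDelta', Matrix.of_apply, add_zero,
    localMaillet_apply H hz hw hzw, rCM_add_flip_apply H.im_pos, sub_neg_eq_add]
  have hderiv : ∀ y, deriv (fun x => ψ x y * ((if i = j then limitShifted τ q w x j k l else 0)
      + if k = l then limitShifted τ q z x l i j else 0)) y =
      partialFst ψ y * ((if i = j then limitShifted τ q w y j k l else 0)
        + if k = l then limitShifted τ q z y l i j else 0)
      + ψ y y * ((if i = j then extraTerm τ ν q w y i k j l else 0)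
        + if k = l then deriv (fun s => limitShifted τ q z s l i j) y else 0) := fun y => by
    refine HasDerivAt.deriv ((hψ.hasDerivAt_partialFst y).fun_mul (HasDerivAt.fun_add ?_ ?_))
    · split_ifs with hij
      · subst hij
        exact hasDerivAt_limitShifted H hw i k l y
      · exact hasDerivAt_const _ _
    · split_ifs
      · exact hT.hasDerivAt y
      · exact hasDerivAt_const _ _
  simp only [hderiv]
  have l1 : IsLoop fun x => if i = j then limitShifted τ q w x j k l else 0 :=
    isLoop_ite (fun _ => hS) fun _ => isLoop_const 0
  have l2 : IsLoop fun x => if k = l then limitShifted τ q z x l i j else 0 :=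
    isLoop_ite (fun _ => hT) fun _ => isLoop_const 0
  have l3 : IsLoop fun x => if i = j then extraTerm τ ν q w x i k j l else 0 :=
    isLoop_ite (fun _ => hX) fun _ => isLoop_const 0
  have l4 : IsLoop fun x => if k = l then deriv (fun s => limitShifted τ q z s l i j) x else 0 :=
    isLoop_ite (fun _ => hT.deriv) fun _ => isLoop_const 0
  have m1 := hd.mul (hX.neg.sub hL)
  have m2 := (h1.mul (l1.add l2)).add (hd.mul (l3.add l4))
  rw [← intervalIntegral.integral_add (m1.intervalIntegrable _ _) (m2.intervalIntegrable _ _)]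
  have m3 : IsLoop fun x => -(ψ x x * limitLocal τ ν q z w x i k j l)
        + (if i = j then partialFst ψ x * limitShifted τ q w x j k l else 0)
        - if k = l then partialSnd ψ x * limitShifted τ q z x l i j else 0 :=
    ((hd.mul hL).neg.add (isLoop_ite (fun _ => h1.mul hS) fun _ => isLoop_const 0)).sub
      (isLoop_ite (fun _ => h2.mul hT) fun _ => isLoop_const 0)
  refine integral_congr_of_hasDerivAt (m1.add m2) m3
    (isLoop_ite (c := k = l) (fun _ => hd.mul hT) fun _ => isLoop_const 0) fun x => ?_
  have hX0 : i ≠ j → extraTerm τ ν q w x i k j l = 0 := fun h => by simp [extraTerm, h]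
  have hk := (hψ.hasDerivAt_diag x).fun_mul (hT.hasDerivAt x)
  by_cases hkl : k = l
  · simp only [if_pos hkl]
    refine hk.congr_deriv ?_
    by_cases hij : i = j
    · simp only [if_pos hij]
      ring
    · simp only [if_neg hij, hX0 hij]
      ring
  · simp only [if_neg hkl]
    refine (hasDerivAt_const x (0 : ℂ)).congr_deriv ?_
    by_cases hij : i = j
    · simp only [if_pos hij]
      ring
    · simp only [if_neg hij, hX0 hij]
      ring

lemma isLoop_gradUCM (H : IsNondegenerate τ ν q p) (hz : theta τ z ≠ 0) (hφ : IsLoop φ)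
    (k l a : Fin N) : IsLoop (gradUCM τ ν q z φ k l a) :=
  (hasFunctionalDeriv_UCM H H.loop_p hz hφ k l).1 a

/-- Integration by parts in the pairing of an off-diagonal entry with a variation. -/
lemma integral_mul_gradUCM (H : IsNondegenerate τ ν q p) (hz : theta τ z ≠ 0) (hφ : IsLoop φ)
    (hχ : IsLoop χ) {k l : Fin N} (hkl : k ≠ l) (a : Fin N) :
    ∫ x in (0 : ℝ)..(2 * Real.pi), φ x * gradUCM τ ν q z χ k l a x =
      ∫ x in (0 : ℝ)..(2 * Real.pi), (φ x * χ x * limitTotal τ ν q z x a k l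
        + deriv φ x * χ x * limitShifted τ q z x a k l) := by
  refine integral_congr_of_hasDerivAt (hφ.mul (isLoop_gradUCM H hz hχ k l a))
    (((hφ.mul hχ).mul (isLoop_limitTotal H hz a k l)).add
      ((hφ.deriv.mul hχ).mul (isLoop_limitShifted H hz a k l)))
    (isLoop_ite (c := a = l) (fun _ => ((hφ.mul hχ).mul (H.isLoop_kronecker hz hkl)).neg)
      fun _ => isLoop_const 0) fun x => ?_
  by_cases hal : a = l
  · subst hal
    simp only [if_true]
    refine (((hφ.hasDerivAt x).fun_mul (hχ.hasDerivAt x)).fun_mul (hasDerivAt_comp_sub (ν := ν)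
      H.loop_q k a x (hasDerivAt_kronecker' H.im_pos hz
        (H.theta_sub k a hkl x)))).fun_neg.congr_deriv ?_
    simp only [gradUCM, limitTotal, limitShifted, if_neg hkl, if_neg hkl.symm, if_true]
    ring
  · simp only [if_neg hal]
    refine (hasDerivAt_const x (0 : ℂ)).congr_deriv ?_
    simp only [gradUCM, limitTotal, limitShifted, if_neg hkl, if_neg hal]
    split_ifs <;> ring

lemma integral_gradUCM_eq_rhsMaillet (H : IsNondegenerate τ ν q p) (hz : theta τ z ≠ 0)
    (hw : theta τ w ≠ 0) (hzw : theta τ (z - w) ≠ 0) (hφ : IsLoop φ) (hχ : IsLoop χ)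
    (i k j l : Fin N) :
    (if i = j then ∫ x in (0 : ℝ)..(2 * Real.pi), φ x * gradUCM τ ν q w χ k l i x else 0)
      - (if k = l then ∫ x in (0 : ℝ)..(2 * Real.pi), χ x * gradUCM τ ν q z φ i j k x else 0) =
      rhsMaillet (UCM τ ν q P) (rCM τ q) z w (fun x y => φ x * χ y) (i, k) (j, l) := by
  rw [rhsMaillet_apply H hz hw hzw (hφ.isTest₂_mul hχ)]
  have e1 : partialFst (fun x y => φ x * χ y) = fun x => deriv φ x * χ x := funext fun x => by
    rw [partialFst, deriv_mul_const_field]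
  have e2 : partialSnd (fun x y => φ x * χ y) = fun x => φ x * deriv χ x := funext fun x => by
    rw [partialSnd, deriv_const_mul_field]
  simp only [e1, e2]
  by_cases hij : i = j
  · subst hij
    by_cases hkl : k = l
    · subst hkl
      simp only [if_true]
      have g1 := hφ.mul (isLoop_gradUCM H hw hχ k k i)
      have g2 := hχ.mul (isLoop_gradUCM H hz hφ i i k)
      rw [← intervalIntegral.integral_sub (g1.intervalIntegrable _ _) (g2.intervalIntegrable _ _)]
      have g3 := (((hφ.mul hχ).mul (isLoop_limitLocal H hz hw i k i k)).neg.add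
        ((hφ.deriv.mul hχ).mul (isLoop_limitShifted H hw i k k))).sub
        ((hφ.mul hχ.deriv).mul (isLoop_limitShifted H hz k i i))
      by_cases hik : i = k
      · subst hik
        have hγ := isLoop_alphaLogCoeff H i
        refine integral_congr_of_hasDerivAt (g1.sub g2) g3
          (((isLoop_const (E1 τ z - E1 τ w)).mul (hφ.mul hχ)).add
            ((hχ.mul (hφ.deriv.mul hγ)).sub (hφ.mul (hχ.deriv.mul hγ)))) fun x => ?_
        refine ((((hφ.hasDerivAt x).fun_mul (hχ.hasDerivAt x)).const_mul _).fun_add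
          (((hχ.hasDerivAt x).fun_mul ((hφ.deriv.mul hγ).hasDerivAt x)).fun_sub
            ((hφ.hasDerivAt x).fun_mul ((hχ.deriv.mul hγ).hasDerivAt x)))).congr_deriv ?_
        simp only [gradUCM, limitLocal, limitTotal, limitShifted, if_true]
        ring
      · have hki := Ne.symm hik
        refine integral_congr_of_hasDerivAt (g1.sub g2) g3
          ((hφ.mul hχ).mul (H.isLoop_E1_sub hik)).neg fun x => ?_
        refine (((hφ.hasDerivAt x).fun_mul (hχ.hasDerivAt x)).fun_mul (hasDerivAt_comp_sub (ν := ν)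
          H.loop_q i k x (hasDerivAt_E1 H.im_pos
            (H.theta_sub i k hik x)))).fun_neg.congr_deriv ?_
        simp only [gradUCM, limitLocal, limitTotal, limitShifted, if_true, if_neg hik, if_neg hki]
        rw [E1_sub_comm H.im_pos (q k x), E2_sub_comm H.im_pos (q k x)]
        ring
    · simp only [limitLocal, if_true, if_neg hkl, sub_zero, zero_sub]
      rw [integral_mul_gradUCM H hw hφ hχ hkl]
      congr 1
      funext x
      ring
  · by_cases hkl : k = l
    · subst hkl
      simp only [limitLocal, if_true, if_neg hij, sub_zero, zero_sub]
      rw [integral_mul_gradUCM H hz hχ hφ hij, ← intervalIntegral.integral_neg]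
      congr 1
      funext x
      ring
    · simp [limitLocal, hij, hkl]

lemma hasPoissonBracket_UCM (H : IsNondegenerate τ ν q p) (hP : ∀ i, IsLoop (P i))
    (hz : theta τ z ≠ 0) (hw : theta τ w ≠ 0) (hzw : theta τ (z - w) ≠ 0) (hφ : IsLoop φ)
    (hχ : IsLoop χ) (i j k l : Fin N) :
    HasPoissonBracket (smear φ fun Q P x => UCM τ ν Q P z x i j)
      (smear χ fun Q P x => UCM τ ν Q P w x k l) q P
      (rhsMaillet (UCM τ ν q P) (rCM τ q) z w (fun x y => φ x * χ y) (i, k) (j, l)) := by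
  have h1 := hasFunctionalDeriv_UCM H hP hz hφ i j
  have h2 := hasFunctionalDeriv_UCM H hP hw hχ k l
  refine ⟨_, _, _, _, h1, h2, ?_⟩
  rw [← integral_gradUCM_eq_rhsMaillet H hz hw hzw hφ hχ]
  simp only [intervalIntegral.integral_sub (((h1.2.1 _).mul (h2.1 _)).intervalIntegrable _ _)
    (((h1.1 _).mul (h2.2.1 _)).intervalIntegrable _ _), Finset.sum_sub_distrib]
  congr 1
  · by_cases hij : i = j
    · rw [Finset.sum_eq_single i (fun a _ ha => by simp [ha]) (by simp)]
      simp [hij]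
    · simp [hij]
  · by_cases hkl : k = l
    · rw [Finset.sum_eq_single k (fun a _ ha => by simp [ha]) (by simp)]
      simp [hkl, mul_comm]
    · simp [hkl]

end Maillet

/-! ### The limit of the Ruijsenaars-Schneider structure -/

section Limit

variable {N : ℕ} {τ ν : ℂ} {q p : Fin N → ℝ → ℂ} {z w : ℂ} {φ χ : ℝ → ℂ} {ψ : ℝ → ℝ → ℂ}

lemma isLoop_UCM (H : IsNondegenerate τ ν q p) (hz : theta τ z ≠ 0) (i j : Fin N) :
    IsLoop fun x => UCM τ ν q (momentumCM τ ν q p) z x i j :=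
  isLoop_ite (fun _ => ((H.isLoop_momentumCM i).add ((H.isLoop_alphaSq i).mul
      (isLoop_const (E1 τ z)))).sub (H.isLoop_alphaLogD i))
    fun h => (H.isLoop_kronecker hz h).mul (H.isLoop_alphaSq j)

lemma exists_bound_URS (H : IsNondegenerate τ ν q p) (hz : theta τ z ≠ 0) :
    ∃ C : ℝ, ∀ᶠ ε : ℝ in 𝓝[≠] 0, ∀ x i j,
      ‖URS τ ν ε q p z x i j -
        (-(if i = j then 1 else 0) / (ν * ε) + UCM τ ν q (momentumCM τ ν q p) z x i j / ν)‖
          ≤ C * |ε| := by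
  choose C hC using fun i j => (H.unifLim_URS hz i j).2
  refine ⟨∑ i, ∑ j, |C i j|, ?_⟩
  filter_upwards [eventually_all.2 fun i => eventually_all.2 (hC i)] with ε h x i j
  have h1 : C i j ≤ ∑ i, ∑ j, |C i j| :=
    (le_abs_self _).trans ((Finset.single_le_sum (f := fun j => |C i j|)
      (fun _ _ => abs_nonneg _) (Finset.mem_univ j)).trans
      (Finset.single_le_sum (f := fun i => ∑ j, |C i j|)
        (fun _ _ => Finset.sum_nonneg fun _ _ => abs_nonneg _) (Finset.mem_univ i)))
  refine le_trans (le_of_eq ?_)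
    ((h i j x).trans (mul_le_mul_of_nonneg_right h1 (abs_nonneg ε)))
  congr 1
  ring

lemma IsTest₂.unifLim_slope_fst (hψ : IsTest₂ ψ) :
    UnifLim (fun ε x => (ψ (x - ε) x - ψ x x) / ε) fun x => -partialFst ψ x := by
  have h := unifLim_slope_of_periodic (G := fun s => ψ (s.2 - s.1) s.2)
    (hψ.1.comp ((contDiff_snd.sub contDiff_fst).prodMk contDiff_snd)) (fun ε x => by
      rw [show x + 2 * Real.pi - ε = x - ε + 2 * Real.pi by ring, hψ.2.1, hψ.2.2])
    (G₁ := fun x => -partialFst ψ x) (fun x => by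
      have h1 : HasDerivAt (fun s => ψ s x) (partialFst ψ x) (x - 0) := by
        simpa using hψ.hasDerivAt_partialFst x
      exact h1.comp_const_sub x 0)
  simpa only [sub_zero] using h

/-- The pole of `U` at `ε = 0` turns the difference of the shifted and the unshifted term into a
derivative of the test function. -/
lemma unifLim_test_mul_URS_sub (H : IsNondegenerate τ ν q p) (hz : theta τ z ≠ 0)
    (hψ : IsTest₂ ψ) (i j : Fin N) :
    UnifLim (fun ε x => ψ x x * URS τ ν ε q p z x i j
        - ψ (x - ε) x * URS τ ν ε q p z (x - ε) i j)
      fun x => -((if i = j then 1 else 0) / ν) * partialFst ψ x := by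
  have h1 := H.unifLim_URS hz i j
  have hU : IsLoop fun x => UCM τ ν q (momentumCM τ ν q p) z x i j / ν := by
    simpa only [div_eq_mul_inv] using (isLoop_UCM H hz i j).mul (isLoop_const ν⁻¹)
  have hs := hψ.unifLim_slope_fst
  have hs' : UnifLim (fun ε x => ψ (x - ε) x) fun x => ψ x x :=
    .of_slope hψ.isLoop_diag.exists_bound hs
  have h2 := (((hψ.isLoop_diag.unifLim).mul h1).sub (hs'.mul (h1.shift hU))).add
    (hs.const_mul ((if i = j then 1 else 0) / ν))
  refine (h2.congr ?_).congr_right fun x => by ring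
  filter_upwards [eventually_ne_zero'] with ε hε x
  have h4 : (ε : ℂ) ≠ 0 := by exact_mod_cast hε
  have := H.coupling
  field_simp
  ring

variable (τ ν p) in
/-- The density on the diagonal of the entries of the Ruijsenaars-Schneider structure, all terms
being transported to the same point by periodicity. -/
def densityRS (ε : ℝ) (q p : Fin N → ℝ → ℂ) (z w : ℂ) (ψ : ℝ → ℝ → ℂ) (i k j l : Fin N)
    (x : ℝ) : ℂ :=
  (ψ x x * URS τ ν ε q p z x i j - ψ (x - ε) x * URS τ ν ε q p z (x - ε) i j) *
      (ε * partialShifted τ ν ε q p w x j k l)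
    - (ψ x x * URS τ ν ε q p w x k l - ψ x (x - ε) * URS τ ν ε q p w (x - ε) k l) *
      (ε * partialShifted τ ν ε q p z x l i j)
    - ψ x x * (ε * URS τ ν ε q p z x i j * partialTotal τ ν ε q p w x j k l
      - ε * URS τ ν ε q p w x k l * partialTotal τ ν ε q p z x l i j)

lemma IsTest₂.isLoop_sub_left (hψ : IsTest₂ ψ) (ε : ℝ) : IsLoop fun x => ψ (x - ε) x :=
  ⟨hψ.1.comp ((contDiff_id.sub contDiff_const).prodMk contDiff_id), fun x => by
    have e : x + 2 * Real.pi - ε = x - ε + 2 * Real.pi := by ring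
    exact (congrArg (fun y => ψ y (x + 2 * Real.pi)) e).trans
      ((hψ.2.1 (x - ε) _).trans (hψ.2.2 (x - ε) x))⟩

lemma isLoop_densityRS (H : IsNondegenerate τ ν q p) (hz : theta τ z ≠ 0) (hw : theta τ w ≠ 0)
    {ε : ℝ} (hε : IsRegularStep τ ν ε q p z w) (hψ : IsTest₂ ψ) (i k j l : Fin N) :
    IsLoop (densityRS τ ν ε q p z w ψ i k j l) := by
  have hU : ∀ {z}, theta τ z ≠ 0 → ∀ i j, IsLoop fun x => URS τ ν ε q p z x i j := fun hz =>
    isLoop_URS H.im_pos H.loop_q H.loop_p H.theta_sub hε.theta_step hε.theta_shiftArg hz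
  have hS : ∀ {z}, theta τ z ≠ 0 → ∀ a i j, IsLoop fun x => partialShifted τ ν ε q p z x a i j :=
    fun hz => isLoop_partialShifted H.im_pos H.loop_q H.loop_p H.theta_sub hε.theta_step
      hε.theta_shiftArg hz
  have hT : ∀ {z}, theta τ z ≠ 0 → ∀ a i j, IsLoop fun x => partialTotal τ ν ε q p z x a i j :=
    fun hz a i j => (isLoop_partialLocal H.im_pos H.loop_q H.loop_p H.theta_sub hε.theta_step
      hε.theta_shiftArg hz a i j).add (hS hz a i j)
  have hd := hψ.isLoop_diag
  have hc : IsLoop fun _ => (ε : ℂ) := isLoop_const _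
  exact (((hd.mul (hU hz i j)).sub ((hψ.isLoop_sub_left ε).mul ((hU hz i j).shift_sub ε))).mul
      (hc.mul (hS hw j k l))).sub
    (((hd.mul (hU hw k l)).sub ((hψ.swap.isLoop_sub_left ε).mul ((hU hw k l).shift_sub ε))).mul
      (hc.mul (hS hz l i j))) |>.sub
    (hd.mul (((hc.mul (hU hz i j)).mul (hT hw j k l)).sub
      ((hc.mul (hU hw k l)).mul (hT hz l i j))))

lemma rhsRS_apply_eq_integral (H : IsNondegenerate τ ν q p) (hz : theta τ z ≠ 0)
    (hw : theta τ w ≠ 0) (hzw : theta τ (z - w) ≠ 0) {ε : ℝ} (hε : IsRegularStep τ ν ε q p z w)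
    (hψ : IsTest₂ ψ) (i k j l : Fin N) :
    rhsRS τ ν ε q p z w ψ (i, k) (j, l) =
      ∫ x in (0 : ℝ)..(2 * Real.pi), densityRS τ ν ε q p z w ψ i k j l x := by
  have hU : ∀ {z}, theta τ z ≠ 0 → ∀ i j, IsLoop fun x => URS τ ν ε q p z x i j := fun hz =>
    isLoop_URS H.im_pos H.loop_q H.loop_p H.theta_sub hε.theta_step hε.theta_shiftArg hz
  have hS : ∀ {z}, theta τ z ≠ 0 → ∀ a i j, IsLoop fun x => partialShifted τ ν ε q p z x a i j :=
    fun hz => isLoop_partialShifted H.im_pos H.loop_q H.loop_p H.theta_sub hε.theta_step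
      hε.theta_shiftArg hz
  have hL : ∀ {z}, theta τ z ≠ 0 → ∀ a i j, IsLoop fun x => partialLocal τ ν ε q p z x a i j :=
    fun hz => isLoop_partialLocal H.im_pos H.loop_q H.loop_p H.theta_sub hε.theta_step
      hε.theta_shiftArg hz
  have hd := hψ.isLoop_diag
  rw [rhsRS_apply H.im_pos hz hw hzw H.theta_sub hε]
  have a1 := hd.mul (((hU hz i j).mul (hL hw j k l)).sub ((hU hw k l).mul (hL hz l i j)))
  have a2 := (hψ.isLoop_sub_left ε).mul (((hU hz i j).shift_sub ε).mul (hS hw j k l))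
  have a3 := (hψ.swap.isLoop_sub_left ε).mul (((hU hw k l).shift_sub ε).mul (hS hz l i j))
  have hshift := a2.integral_shift ε
  simp only [add_sub_cancel_right] at hshift
  rw [hshift, ← intervalIntegral.integral_const_mul, ← intervalIntegral.integral_const_mul,
    ← intervalIntegral.integral_const_mul,
    ← intervalIntegral.integral_add (((isLoop_const _).mul a1).intervalIntegrable _ _)
      (((isLoop_const _).mul a2).intervalIntegrable _ _),
    ← intervalIntegral.integral_add
      ((((isLoop_const _).mul a1).add ((isLoop_const _).mul a2)).intervalIntegrable _ _)
      (((isLoop_const _).mul a3).intervalIntegrable _ _)]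
  congr 1
  funext x
  simp only [densityRS, partialTotal]
  ring

lemma unifLim_densityRS (H : IsNondegenerate τ ν q p) (hz : theta τ z ≠ 0) (hw : theta τ w ≠ 0)
    (hψ : IsTest₂ ψ) (i k j l : Fin N) :
    UnifLim (fun ε => densityRS τ ν ε q p z w ψ i k j l) fun x => 1 / ν ^ 2 *
      (-(ψ x x * limitLocal τ ν q z w x i k j l)
        + (if i = j then partialFst ψ x * limitShifted τ q w x j k l else 0)
        - if k = l then partialSnd ψ x * limitShifted τ q z x l i j else 0) := by
  refine (((((unifLim_test_mul_URS_sub H hz hψ i j).mul (H.unifLim_mul_partialShifted hw j k l)).sub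
    ((unifLim_test_mul_URS_sub H hw hψ.swap k l).mul (H.unifLim_mul_partialShifted hz l i j))).sub
    (hψ.isLoop_diag.unifLim.mul
      (((H.unifLim_mul_URS hz i j).mul (H.unifLim_partialTotal hw j k l)).sub
        ((H.unifLim_mul_URS hw k l).mul (H.unifLim_partialTotal hz l i j))))).congr
    (.of_forall fun ε x => rfl)).congr_right fun x => ?_
  have e : partialFst (fun x y => ψ y x) x = partialSnd ψ x := rfl
  rw [limitLocal, e]
  split_ifs <;> ring

lemma tendsto_rhsRS (H : IsNondegenerate τ ν q p) (hz : theta τ z ≠ 0) (hw : theta τ w ≠ 0)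
    (hzw : theta τ (z - w) ≠ 0) (hψ : IsTest₂ ψ) :
    Tendsto (fun ε : ℝ => rhsRS τ ν ε q p z w ψ) (𝓝[≠] 0)
      (𝓝 ((1 / ν ^ 2) • rhsMaillet (UCM τ ν q (momentumCM τ ν q p)) (rCM τ q) z w ψ)) := by
  refine tendsto_pi_nhds.2 fun ⟨i, k⟩ => tendsto_pi_nhds.2 fun ⟨j, l⟩ => ?_
  have hreg := H.isRegularStep_eventually hz hw
  have h0 : IsLoop fun x => 1 / ν ^ 2 * (-(ψ x x * limitLocal τ ν q z w x i k j l)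
        + (if i = j then partialFst ψ x * limitShifted τ q w x j k l else 0)
        - if k = l then partialSnd ψ x * limitShifted τ q z x l i j else 0) :=
    (isLoop_const _).mul (((hψ.isLoop_diag.mul (isLoop_limitLocal H hz hw i k j l)).neg.add
      (isLoop_ite (fun _ => hψ.isLoop_partialFst.mul (isLoop_limitShifted H hw j k l))
        fun _ => isLoop_const 0)).sub
      (isLoop_ite (fun _ => hψ.isLoop_partialSnd.mul (isLoop_limitShifted H hz l i j))
        fun _ => isLoop_const 0))
  have h := (unifLim_densityRS H hz hw hψ i k j l).tendsto_integral
    (hreg.mono fun ε hε => (isLoop_densityRS H hz hw hε hψ i k j l).continuous) h0.continuous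
    0 (2 * Real.pi)
  rw [Matrix.smul_apply, smul_eq_mul, rhsMaillet_apply H hz hw hzw hψ,
    ← intervalIntegral.integral_const_mul]
  refine h.congr' ?_
  filter_upwards [hreg] with ε hε
  exact (rhsRS_apply_eq_integral H hz hw hzw hε hψ i k j l).symm

lemma tendsto_mul_sMinus_add_sPlus (H : IsNondegenerate τ ν q p) (hz : theta τ z ≠ 0)
    (hw : theta τ w ≠ 0) (x : ℝ) :
    Tendsto (fun ε : ℝ => (ε : ℂ) ^ 2 •
        (in₁ (URS τ ν ε q p z x) * in₂ (URS τ ν ε q p w x) * sMinus τ ν ε q p w x +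
          in₁ (URS τ ν ε q p z x) * in₂ (URS τ ν ε q p w x) * sPlus τ ν ε q p z x))
      (𝓝[≠] 0) (𝓝 ((1 / ν ^ 2) • (rCM τ q z w x + flip₁₂ (rCM τ q w z x)))) := by
  refine tendsto_pi_nhds.2 fun ⟨i, k⟩ => tendsto_pi_nhds.2 fun ⟨j, l⟩ => ?_
  have h := (((H.unifLim_mul_URS hz i j).mul (H.unifLim_mul_partialShifted hw j k l)).add
    ((H.unifLim_mul_URS hw k l).mul (H.unifLim_mul_partialShifted hz l i j))).tendsto x
  have e : (-(if i = j then 1 else 0) / ν * (-limitShifted τ q w x j k l / ν) +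
      -(if k = l then 1 else 0) / ν * (-limitShifted τ q z x l i j / ν) : ℂ) =
      ((1 / ν ^ 2) • (rCM τ q z w x + flip₁₂ (rCM τ q w z x))) (i, k) (j, l) := by
    rw [Matrix.smul_apply, smul_eq_mul, rCM_add_flip_apply H.im_pos]
    split_ifs <;> ring
  rw [← e]
  refine h.congr' ?_
  filter_upwards [H.isRegularStep_eventually hz hw] with ε hε
  rw [Matrix.smul_apply, smul_eq_mul, Matrix.add_apply, mul_sMinus_apply (hε.det_right x),
    mul_sPlus_apply (hε.det_left x)]
  ring

lemma exists_tendsto_localRS (H : IsNondegenerate τ ν q p) (hz : theta τ z ≠ 0)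
    (hw : theta τ w ≠ 0) (hzw : theta τ (z - w) ≠ 0) (x : ℝ) : ∃ L : Mat₂ N,
      Tendsto (fun ε : ℝ => (ε : ℂ) • localRS τ ν ε q p z w x) (𝓝[≠] 0) (𝓝 L) ∧
      0 = localMaillet (UCM τ ν q (momentumCM τ ν q p)) (rCM τ q) z w x x
        + (∑ i, ∑ j ∈ Finset.univ.erase i, (alphaSq ν q j x - alphaSq ν q i x) •
            (kroneckerD τ w (q j x - q i x) • EE i i j i + E2 τ (q j x - q i x) • EE i i j j))
        + ν ^ 2 • L := by
  refine ⟨Matrix.of fun a b => limitLocal τ ν q z w x a.1 a.2 b.1 b.2 / ν ^ 2,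
    tendsto_pi_nhds.2 fun ⟨i, k⟩ => tendsto_pi_nhds.2 fun ⟨j, l⟩ =>
      by simpa only [Matrix.smul_apply, smul_eq_mul, Matrix.of_apply] using
        (H.unifLim_localRS hz hw hzw i k j l).tendsto x, ?_⟩
  ext ⟨i, k⟩ ⟨j, l⟩
  rw [Matrix.add_apply, Matrix.add_apply, Matrix.smul_apply, extra_apply,
    localMaillet_apply H hz hw hzw, Matrix.of_apply, smul_eq_mul,
    mul_div_cancel₀ _ (pow_ne_zero 2 H.coupling), Matrix.zero_apply]
  ring

end Limit

end EllipticField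

end

theorem mainTheorem6 {N : ℕ} (τ : ℂ) (hτ : 0 < τ.im) (ν : ℂ) (hν : ν ≠ 0)
    (q p : Fin N → ℝ → ℂ) (hq : ∀ i, IsLoop (q i)) (hp : ∀ i, IsLoop (p i))
    (hqq : ∀ i j, i ≠ j → ∀ x, theta τ (q i x - q j x) ≠ 0)
    (hα : ∀ i x, alphaSq ν q i x ≠ 0)
    (z w : ℂ) (hz : theta τ z ≠ 0) (hw : theta τ w ≠ 0) (hzw : theta τ (z - w) ≠ 0) :
    -- limit of the `U`-matrix
    (∃ C : ℝ, ∀ᶠ ε : ℝ in 𝓝[≠] 0, ∀ x i j,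
      ‖URS τ ν ε q p z x i j -
        (-(if i = j then 1 else 0) / (ν * ε) + UCM τ ν q (momentumCM τ ν q p) z x i j / ν)‖
          ≤ C * |ε|) ∧
    -- the map of the momenta is canonical
    (∀ φ χ : ℝ → ℂ, IsLoop φ → IsLoop χ → ∀ i j,
      HasPoissonBracket (smear φ fun Q P => momentumCM τ ν Q P i)
        (smear χ fun Q P => momentumCM τ ν Q P j) q p 0 ∧
      HasPoissonBracket (smear φ fun Q P => momentumCM τ ν Q P i)
        (smear χ fun Q _ => Q j) q p
        (if i = j then ∫ x in (0 : ℝ)..(2 * Real.pi), φ x * χ x else 0)) ∧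
    -- the Ruijsenaars-Schneider structure
    (∀ᶠ ε : ℝ in 𝓝[≠] 0, ∀ φ χ : ℝ → ℂ, IsLoop φ → IsLoop χ → ∀ i j k l,
      HasPoissonBracket (smear φ fun Q P x => URS τ ν ε Q P z x i j)
        (smear χ fun Q P x => URS τ ν ε Q P w x k l) q p
        (rhsRS τ ν ε q p z w (fun x y => φ x * χ y) (i, k) (j, l))) ∧
    -- limit of the left-hand side, the limit bracket being canonical in `q` and `momentumCM`
    (∀ φ χ : ℝ → ℂ, IsLoop φ → IsLoop χ → ∀ i j k l, ∃ (B : ℝ → ℂ) (B₀ : ℂ),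
      (∀ᶠ ε : ℝ in 𝓝[≠] 0, HasPoissonBracket (smear φ fun Q P x => URS τ ν ε Q P z x i j)
        (smear χ fun Q P x => URS τ ν ε Q P w x k l) q p (B ε)) ∧
      HasPoissonBracket (smear φ fun Q P x => UCM τ ν Q P z x i j)
        (smear χ fun Q P x => UCM τ ν Q P w x k l) q (momentumCM τ ν q p) B₀ ∧
      Tendsto B (𝓝[≠] 0) (𝓝 (B₀ / ν ^ 2))) ∧
    -- limit of the right-hand side as a distribution
    (∀ ψ : ℝ → ℝ → ℂ, IsTest₂ ψ →
      Tendsto (fun ε : ℝ => rhsRS τ ν ε q p z w ψ) (𝓝[≠] 0)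
        (𝓝 ((1 / ν ^ 2) • rhsMaillet (UCM τ ν q (momentumCM τ ν q p)) (rCM τ q) z w ψ))) ∧
    -- the resulting Maillet structure
    (∀ φ χ : ℝ → ℂ, IsLoop φ → IsLoop χ → ∀ i j k l,
      HasPoissonBracket (smear φ fun Q P x => UCM τ ν Q P z x i j)
        (smear χ fun Q P x => UCM τ ν Q P w x k l) q (momentumCM τ ν q p)
        (rhsMaillet (UCM τ ν q (momentumCM τ ν q p)) (rCM τ q) z w
          (fun x y => φ x * χ y) (i, k) (j, l))) ∧
    -- the coefficient of `δ'(x - y)`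
    (∀ x, Tendsto (fun ε : ℝ => (ε : ℂ) ^ 2 •
        (in₁ (URS τ ν ε q p z x) * in₂ (URS τ ν ε q p w x) * sMinus τ ν ε q p w x +
          in₁ (URS τ ν ε q p z x) * in₂ (URS τ ν ε q p w x) * sPlus τ ν ε q p z x))
      (𝓝[≠] 0) (𝓝 ((1 / ν ^ 2) • (rCM τ q z w x + flip₁₂ (rCM τ q w z x))))) ∧
    -- the coefficient of `δ(x - y)`
    (∀ x, ∃ L : Mat₂ N,
      Tendsto (fun ε : ℝ => (ε : ℂ) • localRS τ ν ε q p z w x) (𝓝[≠] 0) (𝓝 L) ∧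
      0 = localMaillet (UCM τ ν q (momentumCM τ ν q p)) (rCM τ q) z w x x
        + (∑ i, ∑ j ∈ Finset.univ.erase i, (alphaSq ν q j x - alphaSq ν q i x) •
            (kroneckerD τ w (q j x - q i x) • EE i i j i + E2 τ (q j x - q i x) • EE i i j j))
        + ν ^ 2 • L) := by
  have H : IsNondegenerate τ ν q p :=
    ⟨hτ, deriv_theta_zero_ne_zero hτ hz, hν, hq, hp, hqq, hα⟩
  have hreg := H.isRegularStep_eventually hz hw
  have hRS := fun (ε : ℝ) (hε : IsRegularStep τ ν ε q p z w) {φ χ : ℝ → ℂ} (hφ : IsLoop φ)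
    (hχ : IsLoop χ) i j k l => hasPoissonBracket_URS hτ hq hp hz hw hzw hqq hε hφ hχ i j k l
  have hCM := fun {φ χ : ℝ → ℂ} (hφ : IsLoop φ) (hχ : IsLoop χ) i j k l =>
    hasPoissonBracket_UCM H H.isLoop_momentumCM hz hw hzw hφ hχ i j k l
  refine ⟨exists_bound_URS H hz, fun φ χ hφ hχ i j => ⟨hasPoissonBracket_momentumCM H hφ hχ i j,
    hasPoissonBracket_momentumCM_position H hφ hχ i j⟩,
    hreg.mono fun ε hε φ χ hφ hχ i j k l => hRS ε hε hφ hχ i j k l,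
    fun φ χ hφ hχ i j k l => ⟨_, _, hreg.mono fun ε hε => hRS ε hε hφ hχ i j k l,
      hCM hφ hχ i j k l, ?_⟩,
    fun ψ hψ => tendsto_rhsRS H hz hw hzw hψ, fun φ χ hφ hχ i j k l => hCM hφ hχ i j k l,
    tendsto_mul_sMinus_add_sPlus H hz hw, exists_tendsto_localRS H hz hw hzw⟩
  have h := tendsto_pi_nhds.1 (tendsto_pi_nhds.1
    (tendsto_rhsRS H hz hw hzw (hφ.isTest₂_mul hχ)) (i, k)) (j, l)
  rwa [Matrix.smul_apply, smul_eq_mul, one_div_mul_eq_div] at h
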